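/- Let $C[0,1]$ carry the supremum norm $\|\cdot\|$. Observe $X_{n,j}=\mu_{n,j}+\epsilon_{n,j}$, $1\le j\le n$, where the mean functions are piecewise constant in $j$: for fixed $m\ge 0$, $0=s_0<s_1<\dots<s_m<s_{m+1}=1$ and $\mu_0,\dots,\mu_m\in C[0,1]$ with $\mu_{i}\ne\mu_{i-1}$, we have $\mu_{n,j}=\mu_i$ for $\lfloor ns_i\rfloor\le j<\lfloor ns_{i+1}\rfloor$ (and $\mu_{n,n}=\mu_m$). The errors $\epsilon_{n,j}$ form a triangular array of random elements of $C[0,1]$ on a probability space such that, for some even integer $J\ge 2$ and some constant $C$: (A1) $\mathbb E[\epsilon_{n,j}(t)]=0$ for all $t$, and $\mathbb E\|\epsilon_{n,j}\|^{4}\le C$ for all $1\le j\le n$; (A2) the rows are stationary with a common autocovariance: $\mathbb E[\epsilon_{n,i}(t)\epsilon_{n,j}(u)]=\gamma(j-i,t,u)$ for all $1\le i,j\le n$ and $t,u\in[0,1]$; (A3) there are a metric $\rho$ on $[0,1]$ with packing numbers $D(\omega,\rho)$ (the maximal number of points with pairwise $\rho$-distances larger than $\omega$) satisfying $\int_0^\tau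 D(\omega,\rho)^{1/J}\,d\omega<\infty$ for some $\tau>0$, and random variables $M_{n,j}\ge 0$ such that almost surely $|\epsilon_{n,j}(t)-\epsilon_{n,j}(u)|\le M_{n,j}\,\rho(t,u)$ for all $t,u$, while $\mathbb E[M_{n,j}^J]\le C$ and $\mathbb E[(\|\epsilon_{n,i}\|M_{n,j})^J]\le C$ for all $1\le i,j\le n$; (A4) the $\varphi$-mixing coefficients $\varphi(k)=\sup_n\sup_{i}\sup\{|\mathbb P(B\mid A)-\mathbb P(B)|:\ A\in\sigma(\epsilon_{n,1},\dots,\epsilon_{n,i}),\ \mathbb P(A)>0,\ B\in\sigma(\epsilon_{n,i+k},\dots,\epsilon_{n,n})\}$ satisfy $\sum_{k}(k+1)^{J/2-1}\varphi(k)^{1/J}<\infty$. Let $\xi_n$ be thresholds with $\xi_n/(\log n)^2\to\infty$ and $\xi_n/\sqrt n\to 0$, and let $\hat S_n$ be the set of change points estimated by binary segmentation $\mathrm{BINSEG}(1,n,\xi_n)$: for $X_{n,s},\dots,X_{n,e}$ with $s<e$, let $b$ maximize over $s<b\le e$ the norm of $$U_{s,e}^b=\sqrt{\tfrac{(b-s)(e-b+1)}{e-s+1}}\Big(\tfrac1{b-s}\sum_{j=s}^{b-1}X_{n,j}-\tfrac1{e-b+1}\sum_{j=b}^{e}X_{n,j}\Big)$$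 (ties resolved arbitrarily); if $\|U_{s,e}^b\|>\xi_n$, add $b$ to $\hat S_n$ and continue with $\mathrm{BINSEG}(s,b-1,\xi_n)$ and $\mathrm{BINSEG}(b,e,\xi_n)$; otherwise, and if $s\ge e$, stop. The points of $\hat S_n$ are the first time points of new segments; let $\hat\mu^{(j)}$ be the average of $X_{n,1},\dots,X_{n,n}$ over the estimated segment that contains $j$. Let $K:\mathbb R\to\mathbb R$ be a kernel, i.e. symmetric with $K(0)=1$, $K(1)=0$, $K(x)=0$ for $|x|>1$, bounded, and continuous at $0$. Let $c=c_n\in\mathbb N$ and define $$\hat\sigma^2=\sum_{l=-c}^{c}\hat\sigma_l^2\,K(l/c),\qquad \hat\sigma_l^2=\frac1n\sum_{\substack{1\le j\le n\\ 1\le j+l\le n}}\big(X_{n,j}-\hat\mu^{(j)}\big)\big(X_{n,j+l}-\hat\mu^{(j)}\big).$$ If $c\to\infty$ and $c^3/n\to 0$, then the long-run variance $\sigma^2(t)=\sum_{h\in\mathbb Z}\gamma(h,t,t)$ converges for every $t\in[0,1]$ and defines a function $\sigma^2\in C[0,1]$, and $\|\hat\sigma^2-\sigma^2\|=o_{\mathbb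 P}(1)$. -/

import Mathlib

open MeasureTheory Filter Topology
open scoped unitInterval ENNReal NNReal

noncomputable section

namespace FunctionalTS

/-- Curves on `[0,1]`; the norm of `C(I, ℝ)` is the supremum norm. -/
abbrev Curve := C(I, ℝ)

/-! ### The piecewise constant mean and the observations -/

/-- The number of true change locations that are not later than `j`, i.e. the `i` with
`⌊n s_i⌋ ≤ j < ⌊n s_{i+1}⌋`, where `s_0 = 0`, `s_{m+1} = 1`, and `s` lists `s_1, …, s_m`. -/
def segIndex {m : ℕ} (s : Fin m → ℝ) (n j : ℕ) : Fin (m + 1) :=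
  ⟨(Finset.univ.filter fun k : Fin m => ⌊(n : ℝ) * s k⌋₊ ≤ j).card,
    Nat.lt_succ_of_le ((Finset.card_filter_le _ _).trans (by simp))⟩

/-- The observations `X_{n,j} = μ_{n,j} + ε_{n,j}` with mean `μ_i` on the `i`-th segment. -/
def obs {Ω : Type*} {m : ℕ} (s : Fin m → ℝ) (μ : Fin (m + 1) → Curve)
    (ε : ℕ → ℕ → Ω → Curve) (n j : ℕ) (ω : Ω) : Curve :=
  μ (segIndex s n j) + ε n j ω

/-! ### Conditions on the triangular array of errors `ε n j`, `1 ≤ j ≤ n` -/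

/-- The errors are random variables in `C[0,1]`, centred, with bounded fourth moments of the
supremum norm. -/
structure CondA1 {Ω : Type*} [MeasurableSpace Ω] (P : Measure Ω)
    (ε : ℕ → ℕ → Ω → Curve) : Prop where
  measurable : ∀ n, ∀ j ∈ Finset.Icc 1 n, ∀ t, Measurable fun ω => ε n j ω t
  moment : ∃ C : ℝ≥0, ∀ n, ∀ j ∈ Finset.Icc 1 n, ∫⁻ ω, ‖ε n j ω‖ₑ ^ 4 ∂P ≤ C
  centred : ∀ n, ∀ j ∈ Finset.Icc 1 n, ∀ t, ∫ ω, ε n j ω t ∂P = 0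

/-- The rows are stationary, with one autocovariance function `γ` for all rows. -/
def CondA2 {Ω : Type*} [MeasurableSpace Ω] (P : Measure Ω)
    (ε : ℕ → ℕ → Ω → Curve) (γ : ℤ → I → I → ℝ) : Prop :=
  ∀ n, ∀ i ∈ Finset.Icc 1 n, ∀ j ∈ Finset.Icc 1 n, ∀ t u,
    ∫ ω, ε n i ω t * ε n j ω u ∂P = γ ((j : ℤ) - (i : ℤ)) t u

/-- The packing number `D(w, ρ)`: the maximal number of points of `[0,1]` with pairwise
`ρ`-distances larger than `w`. -/
def packingNumber (ρ : I → I → ℝ) (w : ℝ) : ℝ≥0∞ :=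
  ⨆ (F : Finset I) (_ : ∀ t ∈ F, ∀ u ∈ F, t ≠ u → w < ρ t u), (F.card : ℝ≥0∞)

/-- The errors are Lipschitz with respect to a metric `ρ` on `[0,1]` whose packing numbers satisfy
`∫_0^τ D(w, ρ)^{1/J} dw < ∞`, with random Lipschitz constants `M_{n,j}` such that the `J`-th
moments of `M_{n,j}` and of the products `‖ε_{n,i}‖ M_{n,j}` are bounded. -/
def CondA3 {Ω : Type*} [MeasurableSpace Ω] (P : Measure Ω)
    (ε : ℕ → ℕ → Ω → Curve) (J : ℕ) : Prop :=
  ∃ (ρ : I → I → ℝ) (M : ℕ → ℕ → Ω → ℝ≥0) (τ : ℝ) (C : ℝ≥0),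
    (∀ t u, 0 ≤ ρ t u) ∧ (∀ t u, ρ t u = 0 ↔ t = u) ∧ (∀ t u, ρ t u = ρ u t) ∧
    (∀ t u v, ρ t v ≤ ρ t u + ρ u v) ∧
    0 < τ ∧ ∫⁻ w in Set.Ioo 0 τ, packingNumber ρ w ^ (1 / (J : ℝ)) < ∞ ∧
    ∀ n, ∀ j ∈ Finset.Icc 1 n,
      Measurable (M n j) ∧
      (∀ᵐ ω ∂P, ∀ t u, |ε n j ω t - ε n j ω u| ≤ M n j ω * ρ t u) ∧
      ∫⁻ ω, (M n j ω : ℝ≥0∞) ^ J ∂P ≤ C ∧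
      ∀ i ∈ Finset.Icc 1 n, ∫⁻ ω, (‖ε n i ω‖ₑ * (M n j ω : ℝ≥0∞)) ^ J ∂P ≤ C

/-- The σ-field generated by `ε_{n,j}`, `a ≤ j ≤ b`. -/
@[reducible] def rowSigma {Ω : Type*} (ε : ℕ → ℕ → Ω → Curve) (n a b : ℕ) : MeasurableSpace Ω :=
  ⨆ j ∈ Finset.Icc a b, ⨆ t : I, MeasurableSpace.comap (fun ω => ε n j ω t) (borel ℝ)

/-- The `φ`-mixing coefficients of the array: the supremum of `|P(B | A) - P(B)|` over all rows `n`
and all `A`, `B` in the σ-fields of `ε_{n,1}, …, ε_{n,i}` and of `ε_{n,i+k}, …, ε_{n,n}`. -/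
def phiMixing {Ω : Type*} [MeasurableSpace Ω] (P : Measure Ω)
    (ε : ℕ → ℕ → Ω → Curve) (k : ℕ) : ℝ :=
  sSup {x | ∃ (n i : ℕ) (A B : Set Ω), 1 ≤ i ∧ i + k ≤ n ∧
    MeasurableSet[rowSigma ε n 1 i] A ∧ MeasurableSet[rowSigma ε n (i + k) n] B ∧
    0 < P.real A ∧ x = |P.real (A ∩ B) / P.real A - P.real B|}

/-- The array is `φ`-mixing with `∑_k (k+1)^{J/2-1} φ(k)^{1/J} < ∞`. -/
def CondA4 {Ω : Type*} [MeasurableSpace Ω] (P : Measure Ω)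
    (ε : ℕ → ℕ → Ω → Curve) (J : ℕ) : Prop :=
  Summable fun k : ℕ =>
    ((k : ℝ) + 1) ^ ((J : ℝ) / 2 - 1) * phiMixing P ε k ^ (1 / (J : ℝ))

/-! ### Change point estimation by binary segmentation -/

/-- The average of `x j` over a finite set `A` of time points. -/
def avg (x : ℕ → Curve) (A : Finset ℕ) : Curve :=
  ((A.card : ℝ)⁻¹) • ∑ j ∈ A, x j

/-- The CUSUM statistic of `x s, …, x e` for a new segment starting at `b`, `s < b ≤ e`. -/
def cusum (x : ℕ → Curve) (s e b : ℕ) : Curve :=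
  √(((b : ℝ) - s) * ((e : ℝ) + 1 - b) / ((e : ℝ) + 1 - s)) •
    (avg x (Finset.Ico s b) - avg x (Finset.Icc b e))

/-- `BinSeg x ξ s e S`: the set `S` of estimated change points (first time points of new segments)
is an output of binary segmentation with threshold `ξ` applied to `x s, …, x e`. Ties in the
maximization of the CUSUM statistic may be resolved in any way. -/
inductive BinSeg (x : ℕ → Curve) (ξ : ℝ) : ℕ → ℕ → Finset ℕ → Prop
  | short (s e : ℕ) (h : e ≤ s) : BinSeg x ξ s e ∅
  | noChange (s e : ℕ) (h : s < e) (hξ : ∀ b ∈ Finset.Ioc s e, ‖cusum x s e b‖ ≤ ξ) :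
      BinSeg x ξ s e ∅
  | split (s e b : ℕ) (S T : Finset ℕ) (hb : b ∈ Finset.Ioc s e)
      (hmax : ∀ b' ∈ Finset.Ioc s e, ‖cusum x s e b'‖ ≤ ‖cusum x s e b‖)
      (hξ : ξ < ‖cusum x s e b‖)
      (hS : BinSeg x ξ s (b - 1) S) (hT : BinSeg x ξ b e T) :
      BinSeg x ξ s e (insert b (S ∪ T))

/-! ### The long run variance estimator -/

/-- A kernel: symmetric, `K 0 = 1`, `K 1 = 0`, vanishing outside `[-1,1]`, bounded, and
continuous at `0`. -/
structure IsKernel (K : ℝ → ℝ) : Prop where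
  symm : ∀ x, K (-x) = K x
  zero : K 0 = 1
  one : K 1 = 0
  support : ∀ x, 1 < |x| → K x = 0
  bounded : ∃ B, ∀ x, |K x| ≤ B
  continuousAt : ContinuousAt K 0

/-- `μ̂^{(j)}`: the average of those `x 1, …, x n` that are in the same segment as `j`, i.e. not
separated from `j` by a change point in `S`. -/
def segMean (x : ℕ → Curve) (n : ℕ) (S : Finset ℕ) (j : ℕ) : Curve :=
  avg x ((Finset.Icc 1 n).filter fun k => ∀ b ∈ S, b ≤ k ↔ b ≤ j)

/-- `σ̂²_l`: the lag `l` autocovariance estimator, with sum over `1 ≤ j, j + l ≤ n`. -/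
def lagEstimator (x : ℕ → Curve) (n : ℕ) (S : Finset ℕ) (l : ℤ) : Curve :=
  ((n : ℝ)⁻¹) • ∑ p ∈ (Finset.Icc 1 n ×ˢ Finset.Icc 1 n).filter
      (fun p => (p.2 : ℤ) = (p.1 : ℤ) + l),
    (x p.1 - segMean x n S p.1) * (x p.2 - segMean x n S p.1)

/-- `σ̂² = ∑_{l=-c}^{c} σ̂²_l K(l/c)`. -/
def lrvEstimator (K : ℝ → ℝ) (c : ℕ) (x : ℕ → Curve) (n : ℕ) (S : Finset ℕ) : Curve :=
  ∑ l ∈ Finset.Icc (-(c : ℤ)) (c : ℤ), K ((l : ℝ) / (c : ℝ)) • lagEstimator x n S l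

end FunctionalTS

end

noncomputable section

namespace FunctionalTS

/-! ### CUSUM statistics and bridges of partial sums -/

/-! Write Γ_l for the curve t ↦ γ(l,t,t), φ for the mixing coefficients and r for `locRadius`. The
estimator is compared with the long-run variance through two intermediate curves: `errorEstimator`,
the same kernel sum formed from the unobservable errors, and `biasedVariance`, the mean of that sum.

Bias. The covariance inequality for φ-mixing gives ‖Γ_l‖ ≤ C φ(l)^{1/2}, which is summable, so
`biasedVariance` converges to ∑ Γ_|l| by dominated convergence, with K(l/c) → K(0) = 1.

Fluctuation. For fixed l the products ε_j ε_{j+l} are sorted by j modulo l+1. Within one class they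
depend on disjoint blocks of the row, so a class behaves like a mixing sequence of about n/(l+1)
terms, and the supremum norm of its centred sum has order √(n/(l+1)). The l+1 classes together cost
√(n(l+1)); summing over |l| ≤ c and dividing by n leaves √(c³/n), which is why c³/n → 0 is the right
condition. The supremum norms are handled in `exists_sum_blocks_bound`: a martingale approximation
(`eLpNorm_sum_le_of_mixing`) bounds the moments of values and increments, and chaining
(`exists_chaining_bound`) passes to the supremum.

Centring. Replacing observations by errors costs the error of the estimated mean. With probability
tending to one, binary segmentation returns exactly one point within r of each true change and
nothing else (`SegModel.binSeg_eq`). Hence the mean is off by a bounded amount only within r + c of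
a change point and by O((log n)^4/√n) elsewhere, and the average of these errors, multiplied by c,
tends to zero (`exists_weights`).

Why binary segmentation succeeds. The CUSUM statistic is the bridge of the partial sums divided by a
multiple of √(u(1-u)), where u is the relative position. On a stretch of constant mean the bridge is
linear up to noise while √(u(1-u)) is strictly concave, so without noise a maximizer cannot lie
inside such a stretch; `cusum_max_le` is the quantitative form. An interval containing a change well
inside has a statistic of order √n, above the threshold; an interval without one has only noise,
below it. Induction over the recursion keeps all interval ends within r of true change points. The
noise bounds this requires, a√h for all lengths h and a small multiple of h for h ≥ r, follow from
the second moments of partial sums by a Rademacher–Menshov maximal inequality and a union over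
dyadic scales. -/

/-- The bridge of the partial sums of `x s, …, x e`, i.e. the CUSUM statistic before
normalization. -/
def bridge (x : ℕ → Curve) (s e b : ℕ) : Curve :=
  ∑ j ∈ Finset.Ico s b, x j -
    (((b : ℝ) - s) / ((e : ℝ) + 1 - s)) • ∑ j ∈ Finset.Ico s (e + 1), x j

/-- The normalization of the bridge. -/
def bridgeSd (s e b : ℕ) : ℝ := √(((b : ℝ) - s) * ((e : ℝ) + 1 - b) / ((e : ℝ) + 1 - s))

lemma bridgeSd_nonneg (s e b : ℕ) : 0 ≤ bridgeSd s e b := Real.sqrt_nonneg _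

/-- The square of the normalization is (b-s)(e+1-b)/(e+1-s), and multiplying the difference of the
two averages by it gives a centred partial sum. In contrast to the CUSUM statistic, the bridge
remains meaningful at b = s and b = e+1, where it vanishes. -/
lemma bridge_eq_smul_cusum (x : ℕ → Curve) {s e b : ℕ} (h1 : s < b) (h2 : b ≤ e) :
    bridge x s e b = bridgeSd s e b • cusum x s e b := by
  have e1 : Finset.Icc b e = Finset.Ico b (e + 1) := by ext; simp
  have h1' : (0 : ℝ) < (b : ℝ) - s := by
    have : (s : ℝ) < b := by exact_mod_cast h1
    linarith
  have h2' : (0 : ℝ) < (e : ℝ) + 1 - b := by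
    have : (b : ℝ) ≤ e := by exact_mod_cast h2
    linarith
  have h3' : (0 : ℝ) < (e : ℝ) + 1 - s := by linarith
  have c1 : ((Finset.Ico s b).card : ℝ) = (b : ℝ) - s := by
    rw [Nat.card_Ico, Nat.cast_sub h1.le]
  have c2 : ((Finset.Ico b (e + 1)).card : ℝ) = (e : ℝ) + 1 - b := by
    rw [Nat.card_Ico, Nat.cast_sub (by omega), Nat.cast_succ]
  unfold bridge bridgeSd cusum avg
  rw [e1, c1, c2, smul_smul, Real.mul_self_sqrt (by positivity),
    ← Finset.sum_Ico_consecutive x h1.le (show b ≤ e + 1 by omega), smul_sub, smul_smul, smul_smul,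
    smul_add]
  generalize (∑ j ∈ Finset.Ico s b, x j) = p
  generalize (∑ j ∈ Finset.Ico b (e + 1), x j) = q
  have k1 : ((b : ℝ) - s) * ((e : ℝ) + 1 - b) / ((e : ℝ) + 1 - s) * ((b : ℝ) - s)⁻¹ =
      1 - ((b : ℝ) - s) / ((e : ℝ) + 1 - s) := by field_simp; ring
  have k2 : ((b : ℝ) - s) * ((e : ℝ) + 1 - b) / ((e : ℝ) + 1 - s) * ((e : ℝ) + 1 - b)⁻¹ =
      ((b : ℝ) - s) / ((e : ℝ) + 1 - s) := by field_simp
  rw [k1, k2, sub_smul, one_smul]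
  abel

lemma norm_bridge_le {x : ℕ → Curve} {s e : ℕ} {M : ℝ} (hse : s ≤ e)
    (hM : ∀ b ∈ Finset.Ioc s e, ‖cusum x s e b‖ ≤ M) {b : ℕ} (h1 : s ≤ b) (h2 : b ≤ e + 1) :
    ‖bridge x s e b‖ ≤ M * bridgeSd s e b := by
  rcases h1.eq_or_lt with rfl | h1
  · simp [bridge, bridgeSd]
  rcases h2.eq_or_lt with rfl | h2
  · have : ((e : ℝ) + 1 - s) ≠ 0 := by
      have : (s : ℝ) ≤ e := by exact_mod_cast hse
      linarith
    simp [bridge, bridgeSd, this]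
  · have h2 : b ≤ e := by omega
    rw [bridge_eq_smul_cusum x h1 h2, norm_smul, Real.norm_of_nonneg (bridgeSd_nonneg s e b), mul_comm]
    exact mul_le_mul_of_nonneg_right (hM b (Finset.mem_Ioc.2 ⟨h1, h2⟩)) (Real.sqrt_nonneg _)

/-- Let w be the average of the two square roots and D the claimed gap. Since x ↦ x(1-x) is
quadratic, averaging its values loses exactly D, so convexity of the square gives w² + D ≤ z(1-z) ≤
1/4. This forces 2w + D ≤ 1, hence (w + D)² ≤ w² + D. -/
lemma sqrt_mul_one_sub_strictConcave {x y z l : ℝ} (hx : 0 ≤ x) (hx1 : x ≤ 1) (hy : 0 ≤ y)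
    (hy1 : y ≤ 1) (hl : 0 ≤ l) (hl1 : l ≤ 1) (hz : z = l * x + (1 - l) * y) :
    l * √(x * (1 - x)) + (1 - l) * √(y * (1 - y)) + l * (1 - l) * (y - x) ^ 2 ≤
      √(z * (1 - z)) := by
  have half : ∀ w : ℝ, √(w * (1 - w)) ≤ 1 / 2 := fun w => by
    rw [Real.sqrt_le_left (by norm_num)]; nlinarith [sq_nonneg (w - 1 / 2)]
  have hp0 := half x
  have hq0 := half y
  have hp : √(x * (1 - x)) ^ 2 = x * (1 - x) := Real.sq_sqrt (mul_nonneg hx (by linarith))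
  have hq : √(y * (1 - y)) ^ 2 = y * (1 - y) := Real.sq_sqrt (mul_nonneg hy (by linarith))
  have hpn := Real.sqrt_nonneg (x * (1 - x))
  have hqn := Real.sqrt_nonneg (y * (1 - y))
  set p := √(x * (1 - x))
  set q := √(y * (1 - y))
  have hl' : 0 ≤ 1 - l := by linarith
  set D := l * (1 - l) * (y - x) ^ 2 with hD
  have hDn : 0 ≤ D := by positivity
  set w := l * p + (1 - l) * q with hw
  have hwn : 0 ≤ w := by positivity
  have hw2 : w ≤ 1 / 2 := by
    have := mul_le_mul_of_nonneg_left hp0 hl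
    have := mul_le_mul_of_nonneg_left hq0 hl'
    linarith
  have hsq : w ^ 2 + D ≤ z * (1 - z) := by
    have e1 : z * (1 - z) = l * p ^ 2 + (1 - l) * q ^ 2 + D := by rw [hp, hq, hD, hz]; ring
    have e2 : l * p ^ 2 + (1 - l) * q ^ 2 - w ^ 2 = l * (1 - l) * (p - q) ^ 2 := by rw [hw]; ring
    have : 0 ≤ l * (1 - l) * (p - q) ^ 2 := by positivity
    linarith
  have hz4 : z * (1 - z) ≤ 1 / 4 := by nlinarith [sq_nonneg (z - 1 / 2)]
  apply Real.le_sqrt_of_sq_le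
  have : 2 * w + D ≤ 1 := by nlinarith
  nlinarith

/-- If all CUSUM statistics are bounded by the one at `b` and the mean is constant around `b`, then
the size of the statistic at `b` is governed by the noise. -/
lemma cusum_max_le {x ν : ℕ → Curve} {s e b τ₀ τ₁ : ℕ} {v : Curve} {M η : ℝ}
    (hM : ∀ b' ∈ Finset.Ioc s e, ‖cusum x s e b'‖ ≤ M) (hb : M = ‖cusum x s e b‖)
    (h0 : s ≤ τ₀) (h1 : τ₀ < b) (h2 : b < τ₁) (h3 : τ₁ ≤ e + 1)
    (hx : ∀ j ∈ Finset.Ico τ₀ τ₁, x j = v + ν j)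
    (hν0 : ‖∑ j ∈ Finset.Ico τ₀ b, ν j‖ ≤ η * ((b : ℝ) - τ₀))
    (hν1 : ‖∑ j ∈ Finset.Ico b τ₁, ν j‖ ≤ η * ((τ₁ : ℝ) - b)) :
    M * ((τ₁ : ℝ) - τ₀) ≤ 2 * η * (((e : ℝ) + 1 - s) * √((e : ℝ) + 1 - s)) := by
  have r0 : (s : ℝ) ≤ τ₀ := by exact_mod_cast h0
  have r1 : (τ₀ : ℝ) < b := by exact_mod_cast h1
  have r2 : (b : ℝ) < τ₁ := by exact_mod_cast h2
  have r3 : (τ₁ : ℝ) ≤ (e : ℝ) + 1 := by exact_mod_cast h3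
  set L : ℝ := (e : ℝ) + 1 - s with hL
  have hLpos : 0 < L := by linarith
  set l : ℝ := ((τ₁ : ℝ) - b) / (τ₁ - τ₀) with hl
  have hd : (0 : ℝ) < (τ₁ : ℝ) - τ₀ := by linarith
  have hl0 : 0 ≤ l := div_nonneg (by linarith) hd.le
  have hl1 : 1 - l = ((b : ℝ) - τ₀) / (τ₁ - τ₀) := by rw [hl]; field_simp; ring
  have hl1' : 0 ≤ 1 - l := by rw [hl1]; exact div_nonneg (by linarith) hd.le
  have hbr0 := norm_bridge_le (by omega) hM h0 (show τ₀ ≤ e + 1 by omega)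
  have hbr1 := norm_bridge_le (by omega) hM (show s ≤ τ₁ by omega) h3
  have hbb : ‖bridge x s e b‖ = M * bridgeSd s e b := by
    rw [bridge_eq_smul_cusum x (by omega) (by omega), norm_smul,
      Real.norm_of_nonneg (bridgeSd_nonneg s e b), mul_comm, hb]
  -- On the stretch of constant mean the bridge is affine in the time point up to noise, so its
  -- value at b is the convex combination of the values at τ₀ and τ₁ plus the bridge of the noise.
  have key : bridge x s e b = l • bridge x s e τ₀ + (1 - l) • bridge x s e τ₁ +
      (l • (∑ j ∈ Finset.Ico τ₀ b, ν j) - (1 - l) • ∑ j ∈ Finset.Ico b τ₁, ν j) := by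
    have sum0 : ∑ j ∈ Finset.Ico τ₀ b, x j =
        ((b : ℝ) - τ₀) • v + ∑ j ∈ Finset.Ico τ₀ b, ν j := by
      rw [Finset.sum_congr rfl fun j hj => hx j (by simp at hj ⊢; omega), Finset.sum_add_distrib,
        Finset.sum_const, Nat.card_Ico, ← Nat.cast_smul_eq_nsmul ℝ, Nat.cast_sub h1.le]
    have sum1 : ∑ j ∈ Finset.Ico b τ₁, x j =
        ((τ₁ : ℝ) - b) • v + ∑ j ∈ Finset.Ico b τ₁, ν j := by
      rw [Finset.sum_congr rfl fun j hj => hx j (by simp at hj ⊢; omega), Finset.sum_add_distrib,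
        Finset.sum_const, Nat.card_Ico, ← Nat.cast_smul_eq_nsmul ℝ, Nat.cast_sub h2.le]
    unfold bridge
    rw [← Finset.sum_Ico_consecutive x (h0.trans h1.le) h2.le,
      ← Finset.sum_Ico_consecutive x h0 h1.le, sum0, sum1]
    generalize (∑ j ∈ Finset.Ico τ₀ b, ν j) = p
    generalize (∑ j ∈ Finset.Ico b τ₁, ν j) = q
    generalize (∑ j ∈ Finset.Ico s τ₀, x j) = y
    generalize (∑ j ∈ Finset.Ico s (e + 1), x j) = z
    rw [hl1, hl]
    ext t
    simp only [ContinuousMap.add_apply, ContinuousMap.sub_apply, ContinuousMap.smul_apply,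
      smul_eq_mul]
    field_simp
    ring
  have hnorm : M * bridgeSd s e b ≤ l * (M * bridgeSd s e τ₀) + (1 - l) * (M * bridgeSd s e τ₁) +
      (l * (η * ((b : ℝ) - τ₀)) + (1 - l) * (η * ((τ₁ : ℝ) - b))) := by
    rw [← hbb, key]
    refine (norm_add_le _ _).trans (add_le_add ((norm_add_le _ _).trans ?_)
      ((norm_sub_le _ _).trans ?_))
    · rw [norm_smul, norm_smul, Real.norm_of_nonneg hl0, Real.norm_of_nonneg hl1']
      gcongr
    · rw [norm_smul, norm_smul, Real.norm_of_nonneg hl0, Real.norm_of_nonneg hl1']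
      gcongr
  have sd : ∀ c : ℕ, s ≤ c → (c : ℝ) ≤ (e : ℝ) + 1 → bridgeSd s e c =
      √L * √((((c : ℝ) - s) / L) * (1 - ((c : ℝ) - s) / L)) := by
    intro c _ hc
    rw [← Real.sqrt_mul hLpos.le]
    unfold bridgeSd
    congr 1
    rw [hL] at hLpos ⊢
    field_simp
    ring
  have div1 : ∀ c : ℝ, (c : ℝ) ≤ (e : ℝ) + 1 → (c - s) / L ≤ 1 := fun c hc => by
    rw [div_le_one hLpos]; linarith
  have conc := sqrt_mul_one_sub_strictConcave (x := ((τ₀ : ℝ) - s) / L) (y := ((τ₁ : ℝ) - s) / L)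
    (z := ((b : ℝ) - s) / L) (l := l) (div_nonneg (by linarith) hLpos.le) (div1 _ (by linarith))
    (div_nonneg (by linarith) hLpos.le) (div1 _ (by linarith)) hl0 (by linarith)
    (by rw [hl1, hl]; field_simp; ring)
  rw [sd b (by omega) (by linarith), sd τ₀ h0 (by linarith), sd τ₁ (by omega) r3] at hnorm
  have hM0 : 0 ≤ M := hb ▸ norm_nonneg _
  have hsL : 0 < √L := Real.sqrt_pos.2 hLpos
  have hprod : 0 < l * (1 - l) := by
    rw [hl1, hl]
    exact mul_pos (div_pos (by linarith) hd) (div_pos (by linarith) hd)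
  -- The noise term carries the same factor l(1-l) as the concavity gap. It cancels, so the bound
  -- does not degenerate when b is next to τ₀ or τ₁.
  have e3 : l * (η * ((b : ℝ) - τ₀)) + (1 - l) * (η * ((τ₁ : ℝ) - b)) =
      l * (1 - l) * (2 * η * (τ₁ - τ₀)) := by
    rw [hl1, hl]; field_simp; ring
  rw [e3] at hnorm
  have e4 : (((τ₁ : ℝ) - s) / L - ((τ₀ : ℝ) - s) / L) ^ 2 = ((τ₁ : ℝ) - τ₀) ^ 2 / L ^ 2 := by
    field_simp; ring
  rw [e4] at conc
  have h5 := mul_le_mul_of_nonneg_left conc (mul_nonneg hM0 hsL.le)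
  have h6 : l * (1 - l) * (M * √L * (((τ₁ : ℝ) - τ₀) ^ 2 / L ^ 2)) ≤
      l * (1 - l) * (2 * η * (τ₁ - τ₀)) := by linarith
  have h7 := le_of_mul_le_mul_left h6 hprod
  have h8 : M * ((τ₁ : ℝ) - τ₀) * (√L / L ^ 2) ≤ 2 * η := by
    refine le_of_mul_le_mul_right ?_ hd
    calc _ = M * √L * (((τ₁ : ℝ) - τ₀) ^ 2 / L ^ 2) := by ring
      _ ≤ _ := h7
  have h9 : √L / L ^ 2 = (L * √L)⁻¹ := by
    have : L ^ 2 = L * √L * √L := by rw [mul_assoc, Real.mul_self_sqrt hLpos.le]; ring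
    rw [this, div_mul_cancel_right₀ hsL.ne']
  rw [h9, ← div_eq_mul_inv, div_le_iff₀ (by positivity)] at h8
  exact h8

lemma cusum_sub_const (x : ℕ → Curve) (v : Curve) {s e b : ℕ} (h1 : s < b) (h2 : b ≤ e) :
    cusum (fun j => x j - v) s e b = cusum x s e b := by
  have a : ∀ A : Finset ℕ, A.Nonempty → avg (fun j => x j - v) A = avg x A - v := by
    intro A hA
    have : (A.card : ℝ) ≠ 0 := by exact_mod_cast hA.card_pos.ne'
    unfold avg
    rw [Finset.sum_sub_distrib, Finset.sum_const, ← Nat.cast_smul_eq_nsmul ℝ, smul_sub, smul_smul,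
      inv_mul_cancel₀ this, one_smul]
  unfold cusum
  rw [a _ (Finset.nonempty_Ico.2 h1), a _ (Finset.nonempty_Icc.2 h2), sub_sub_sub_cancel_right]

/-- The size of a CUSUM statistic is bounded by the normalized sums on both sides. -/
lemma norm_cusum_le (x : ℕ → Curve) (v : Curve) {s e b : ℕ} (h1 : s < b) (h2 : b ≤ e) :
    ‖cusum x s e b‖ ≤ ‖∑ j ∈ Finset.Ico s b, (x j - v)‖ / √((b : ℝ) - s) +
      ‖∑ j ∈ Finset.Ico b (e + 1), (x j - v)‖ / √((e : ℝ) + 1 - b) := by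
  have e1 : Finset.Icc b e = Finset.Ico b (e + 1) := by ext; simp
  have h1' : (0 : ℝ) < (b : ℝ) - s := by
    have : (s : ℝ) < b := by exact_mod_cast h1
    linarith
  have h2' : (0 : ℝ) < (e : ℝ) + 1 - b := by
    have : (b : ℝ) ≤ e := by exact_mod_cast h2
    linarith
  have h3' : (0 : ℝ) < (e : ℝ) + 1 - s := by linarith
  have c1 : ((Finset.Ico s b).card : ℝ) = (b : ℝ) - s := by
    rw [Nat.card_Ico, Nat.cast_sub h1.le]
  have c2 : ((Finset.Ico b (e + 1)).card : ℝ) = (e : ℝ) + 1 - b := by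
    rw [Nat.card_Ico, Nat.cast_sub (by omega), Nat.cast_succ]
  rw [← cusum_sub_const x v h1 h2]
  unfold cusum avg
  rw [e1, c1, c2, smul_sub, smul_smul, smul_smul]
  have s1 : √(((b : ℝ) - s) * ((e : ℝ) + 1 - b) / ((e : ℝ) + 1 - s)) ≤ √((b : ℝ) - s) := by
    apply Real.sqrt_le_sqrt
    rw [div_le_iff₀ h3']
    exact mul_le_mul_of_nonneg_left (by linarith) h1'.le
  have s2 : √(((b : ℝ) - s) * ((e : ℝ) + 1 - b) / ((e : ℝ) + 1 - s)) ≤ √((e : ℝ) + 1 - b) := by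
    apply Real.sqrt_le_sqrt
    rw [div_le_iff₀ h3', mul_comm]
    exact mul_le_mul_of_nonneg_left (by linarith) h2'.le
  have inv : ∀ y : ℝ, 0 < y → √y * y⁻¹ = (√y)⁻¹ := fun y hy => by
    have := Real.mul_self_sqrt hy.le
    have h0 := (Real.sqrt_pos.2 hy).ne'
    field_simp
    nlinarith
  refine (norm_sub_le _ _).trans (add_le_add ?_ ?_)
  · rw [norm_smul, Real.norm_of_nonneg (by positivity), div_eq_inv_mul (‖_‖)]
    refine mul_le_mul_of_nonneg_right ?_ (norm_nonneg _)
    rw [← inv _ h1']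
    exact mul_le_mul_of_nonneg_right s1 (by positivity)
  · rw [norm_smul, Real.norm_of_nonneg (by positivity), div_eq_inv_mul (‖_‖)]
    refine mul_le_mul_of_nonneg_right ?_ (norm_nonneg _)
    rw [← inv _ h2']
    exact mul_le_mul_of_nonneg_right s2 (by positivity)

/-! ### Binary segmentation under control of the noise -/

/-- Observations `x j = μ k + ε j` for `t k ≤ j < t (k + 1)`, where the segments have length at
least `κ n`, the jumps have size at least `Δ`, the means are bounded by `B`, and the partial sums of
the noise that start at a change point are controlled by `a` and, beyond distance `r`, by a small
multiple of their length. The last fields relate these constants to the threshold `ξ`. -/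
structure SegModel (x ε μ : ℕ → Curve) (t : ℕ → ℕ) (m n : ℕ) (a r κ B Δ ξ : ℝ) : Prop where
  κ_pos : 0 < κ
  Δ_pos : 0 < Δ
  B_pos : 0 < B
  a_nonneg : 0 ≤ a
  one_le_r : 1 ≤ r
  t_zero : t 0 = 1
  t_last : t (m + 1) = n + 1
  gap : ∀ k ≤ m, κ * n ≤ (t (k + 1) : ℝ) - t k
  mean : ∀ k ≤ m, ∀ j, t k ≤ j → j < t (k + 1) → x j = μ k + ε j
  bound : ∀ k ≤ m, ‖μ k‖ ≤ B
  jump : ∀ k < m, Δ ≤ ‖μ (k + 1) - μ k‖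
  noise : ∀ k ≤ m + 1, ∀ b, 1 ≤ b → b ≤ n + 1 →
    ‖∑ j ∈ Finset.range b, ε j - ∑ j ∈ Finset.range (t k), ε j‖ ≤ a * √|(b : ℝ) - t k|
  noise_far : ∀ k ≤ m + 1, ∀ b, 1 ≤ b → b ≤ n + 1 → r ≤ |(b : ℝ) - t k| →
    ‖∑ j ∈ Finset.range b, ε j - ∑ j ∈ Finset.range (t k), ε j‖ ≤
      κ ^ 2 * Δ / 64 * |(b : ℝ) - t k|
  r_le : 4 * r ≤ κ * n
  a_le : 16 * (a * √n) ≤ κ * Δ * n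
  le_threshold : 2 * (4 * B * r + a * (1 + 2 * √r)) ≤ ξ
  threshold_lt : ξ < κ * Δ / 4 * √n
  a_le' : 2 * (a * (1 + 2 * √r)) ≤ κ * Δ / 8 * √n
  r_le' : 2 * r + 64 * (a * √r) / (κ ^ 2 * Δ) ≤ (κ * Δ / (16 * B)) ^ 2 * n

lemma sqrt_add_le_add {x y : ℝ} (hx : 0 ≤ x) (hy : 0 ≤ y) : √(x + y) ≤ √x + √y := by
  rw [Real.sqrt_le_left (by positivity), add_sq, Real.sq_sqrt hx, Real.sq_sqrt hy]
  have := mul_nonneg (Real.sqrt_nonneg x) (Real.sqrt_nonneg y)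
  linarith

namespace SegModel

variable {x ε μ : ℕ → Curve} {t : ℕ → ℕ} {m n : ℕ} {a r κ B Δ ξ : ℝ}

lemma four_le (h : SegModel x ε μ t m n a r κ B Δ ξ) : 4 ≤ κ * n := by
  linarith [h.r_le, h.one_le_r]

lemma lt_succ (h : SegModel x ε μ t m n a r κ B Δ ξ) {k : ℕ} (hk : k ≤ m) : t k < t (k + 1) := by
  have h1 := h.gap k hk
  have h2 := h.four_le
  have : (t k : ℝ) < t (k + 1) := by linarith
  exact_mod_cast this

lemma monotone (h : SegModel x ε μ t m n a r κ B Δ ξ) {i k : ℕ} (hik : i ≤ k) (hk : k ≤ m + 1) :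
    t i ≤ t k := by
  induction k, hik using Nat.le_induction with
  | base => exact le_rfl
  | succ k hik ih => exact (ih (by omega)).trans (h.lt_succ (by omega)).le

lemma gap' (h : SegModel x ε μ t m n a r κ B Δ ξ) {i k : ℕ} (hik : i < k) (hk : k ≤ m + 1) :
    κ * n ≤ (t k : ℝ) - t i := by
  have h1 := h.gap i (by omega)
  have h2 : (t (i + 1) : ℝ) ≤ t k := by exact_mod_cast h.monotone hik hk
  linarith

lemma one_le_t (h : SegModel x ε μ t m n a r κ B Δ ξ) {k : ℕ} (hk : k ≤ m + 1) : 1 ≤ t k := by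
  have := h.monotone (Nat.zero_le k) hk
  rwa [h.t_zero] at this

lemma t_le (h : SegModel x ε μ t m n a r κ B Δ ξ) {k : ℕ} (hk : k ≤ m + 1) : t k ≤ n + 1 := by
  have := h.monotone hk le_rfl
  rwa [h.t_last] at this

/-- No monotonicity of `t` is used, and the lemma is applied both to the true and to the estimated
change points. -/
lemma exists_segment {i i' : ℕ} (hi : i < i')
    {j : ℕ} (h1 : t i ≤ j) (h2 : j < t i') :
    ∃ k, i ≤ k ∧ k < i' ∧ t k ≤ j ∧ j < t (k + 1) := by
  induction i', hi using Nat.le_induction with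
  | base => exact ⟨i, le_rfl, by omega, h1, h2⟩
  | succ l hl ih =>
    by_cases hj : j < t l
    · obtain ⟨k, hk⟩ := ih hj
      exact ⟨k, hk.1, by omega, hk.2.2⟩
    · exact ⟨l, by omega, by omega, by omega, h2⟩

lemma norm_mean_le (h : SegModel x ε μ t m n a r κ B Δ ξ) {j : ℕ} (h1 : 1 ≤ j) (h2 : j ≤ n) :
    ‖x j - ε j‖ ≤ B := by
  obtain ⟨k, -, hk, hk1, hk2⟩ := exists_segment (t := t) (i := 0) (i' := m + 1) (j := j) (by omega)
    (by rw [h.t_zero]; omega) (by rw [h.t_last]; omega)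
  rw [h.mean k (by omega) j hk1 hk2, add_sub_cancel_right]
  exact h.bound k (by omega)

/-- Noise is controlled only for sums that start at a true change point. Starting at s instead costs
√r twice: once for the sum between s and that change point, once for the altered distance to b. -/
lemma noise_near (h : SegModel x ε μ t m n a r κ B Δ ξ) {k s b : ℕ} (hk : k ≤ m + 1)
    (hs : |(s : ℝ) - t k| ≤ r) (hs1 : 1 ≤ s) (hsn : s ≤ n + 1) (hb1 : 1 ≤ b) (hbn : b ≤ n + 1) :
    ‖∑ j ∈ Finset.range b, ε j - ∑ j ∈ Finset.range s, ε j‖ ≤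
      a * (√|(b : ℝ) - s| + 2 * √r) := by
  have h1 := h.noise k hk b hb1 hbn
  have h2 := h.noise k hk s hs1 hsn
  have h3 : √|(s : ℝ) - t k| ≤ √r := Real.sqrt_le_sqrt hs
  have h4 : √|(b : ℝ) - t k| ≤ √|(b : ℝ) - s| + √r := by
    refine (Real.sqrt_le_sqrt ?_).trans (sqrt_add_le_add (abs_nonneg _)
      (by linarith [h.one_le_r]))
    calc |(b : ℝ) - t k| = |((b : ℝ) - s) + (s - t k)| := by ring_nf
      _ ≤ _ := (abs_add_le _ _).trans (by linarith)
  have := h.a_nonneg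
  calc _ = ‖(∑ j ∈ Finset.range b, ε j - ∑ j ∈ Finset.range (t k), ε j) -
        (∑ j ∈ Finset.range s, ε j - ∑ j ∈ Finset.range (t k), ε j)‖ := by congr 1; abel
    _ ≤ a * √|(b : ℝ) - t k| + a * √|(s : ℝ) - t k| := (norm_sub_le _ _).trans (add_le_add h1 h2)
    _ ≤ a * (√|(b : ℝ) - s| + √r) + a * √r := by gcongr
    _ = _ := by ring

lemma sum_sub_const {s b : ℕ} (hsb : s ≤ b) (v : Curve) :
    ∑ j ∈ Finset.Ico s b, (x j - v) = ∑ j ∈ Finset.Ico s b, (x j - ε j - v) +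
      (∑ j ∈ Finset.range b, ε j - ∑ j ∈ Finset.range s, ε j) := by
  rw [← Finset.sum_Ico_eq_sub _ hsb, ← Finset.sum_add_distrib]
  exact Finset.sum_congr rfl fun j _ => by abel

/-- Between approximate change points, all but few time points have the same mean. -/
lemma sum_misfit_le (h : SegModel x ε μ t m n a r κ B Δ ξ) {i s e : ℕ} (hi : i ≤ m)
    (hs : |(s : ℝ) - t i| ≤ r) (he : |(e : ℝ) - t (i + 1)| ≤ r) (hs1 : 1 ≤ s) (hen : e ≤ n + 1) :
    ∑ j ∈ Finset.Ico s e, ‖x j - ε j - μ i‖ ≤ 4 * B * r := by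
  have hsub : ∀ j ∈ Finset.Ico s e, ‖x j - ε j - μ i‖ ≤
      if j ∈ Finset.Ico s (t i) ∪ Finset.Ico (t (i + 1)) e then 2 * B else 0 := by
    intro j hj
    rw [Finset.mem_Ico] at hj
    split_ifs with hj2
    · refine (norm_sub_le _ _).trans ?_
      linarith [h.norm_mean_le (j := j) (by omega) (by omega), h.bound i hi]
    · simp only [Finset.mem_union, Finset.mem_Ico, not_or, not_and, not_lt] at hj2
      rw [h.mean i hi j (by omega) (by omega)]
      simp
  refine (Finset.sum_le_sum hsub).trans ?_
  have hB := h.B_pos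
  have hr := h.one_le_r
  have hc : ∀ p q : ℕ, |(p : ℝ) - q| ≤ r → ((Finset.Ico p q).card : ℝ) ≤ r := by
    intro p q hpq
    rw [Nat.card_Ico]
    rcases le_total p q with hp | hp
    · rw [Nat.cast_sub hp]; linarith [(abs_le.1 hpq).1]
    · rw [Nat.sub_eq_zero_of_le hp]; simp; linarith
  have hu : ((Finset.Ico s (t i) ∪ Finset.Ico (t (i + 1)) e).card : ℝ) ≤ 2 * r := by
    calc _ ≤ (((Finset.Ico s (t i)).card + (Finset.Ico (t (i + 1)) e).card : ℕ) : ℝ) := by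
          exact_mod_cast Finset.card_union_le _ _
      _ ≤ 2 * r := by
          push_cast
          linarith [hc s (t i) hs, hc (t (i + 1)) e (by rw [abs_sub_comm]; exact he)]
  rw [← Finset.sum_filter, Finset.sum_const, nsmul_eq_mul]
  have : (((Finset.Ico s e).filter
      (· ∈ Finset.Ico s (t i) ∪ Finset.Ico (t (i + 1)) e)).card : ℝ) ≤ 2 * r :=
    le_trans (by exact_mod_cast Finset.card_le_card fun j hj => (Finset.mem_filter.1 hj).2) hu
  nlinarith

lemma div_sqrt_le {c y h : ℝ} (hc : 0 ≤ c) (hy : 0 ≤ y) (hh : 1 ≤ h) {r : ℝ} :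
    (y + c * (√h + 2 * √r)) / √h ≤ y + c * (1 + 2 * √r) := by
  have h1 : 1 ≤ √h := Real.one_le_sqrt.2 hh
  rw [div_le_iff₀ (by linarith)]
  have h2 := Real.sqrt_nonneg r
  have := mul_nonneg hc h2
  nlinarith [mul_nonneg hy (sub_nonneg.2 h1), mul_nonneg this (sub_nonneg.2 h1)]

/-- No false alarm between consecutive change points. -/
lemma no_false_alarm (h : SegModel x ε μ t m n a r κ B Δ ξ) {i s e b : ℕ} (hi : i ≤ m)
    (hs : |(s : ℝ) - t i| ≤ r) (he : |(e : ℝ) + 1 - t (i + 1)| ≤ r) (hs1 : 1 ≤ s) (hen : e ≤ n)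
    (h1 : s < b) (h2 : b ≤ e) : ‖cusum x s e b‖ ≤ ξ := by
  have he' : |((e + 1 : ℕ) : ℝ) - t (i + 1)| ≤ r := by push_cast; exact he
  have r1 : (1 : ℝ) ≤ (b : ℝ) - s := by
    have : ((s + 1 : ℕ) : ℝ) ≤ b := by exact_mod_cast h1
    push_cast at this; linarith
  have r2 : (1 : ℝ) ≤ (e : ℝ) + 1 - b := by
    have : (b : ℝ) ≤ e := by exact_mod_cast h2
    linarith
  have hB := h.B_pos
  have hr := h.one_le_r
  have mis := h.sum_misfit_le hi hs he' hs1 (by omega)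
  have hl : ‖∑ j ∈ Finset.Ico s b, (x j - μ i)‖ ≤
      4 * B * r + a * (√((b : ℝ) - s) + 2 * √r) := by
    rw [sum_sub_const (x := x) (ε := ε) h1.le]
    refine (norm_add_le _ _).trans (add_le_add ?_ ?_)
    · refine (norm_sum_le _ _).trans (le_trans ?_ mis)
      exact Finset.sum_le_sum_of_subset_of_nonneg (Finset.Ico_subset_Ico le_rfl (by omega))
        fun _ _ _ => norm_nonneg _
    · have := h.noise_near (k := i) (s := s) (b := b) (by omega) hs hs1 (by omega) (by omega)
        (by omega)
      rwa [abs_of_nonneg (by linarith)] at this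
  have hr' : ‖∑ j ∈ Finset.Ico b (e + 1), (x j - μ i)‖ ≤
      4 * B * r + a * (√((e : ℝ) + 1 - b) + 2 * √r) := by
    rw [sum_sub_const (x := x) (ε := ε) (by omega)]
    refine (norm_add_le _ _).trans (add_le_add ?_ ?_)
    · refine (norm_sum_le _ _).trans (le_trans ?_ mis)
      exact Finset.sum_le_sum_of_subset_of_nonneg (Finset.Ico_subset_Ico h1.le le_rfl)
        fun _ _ _ => norm_nonneg _
    · have := h.noise_near (k := i + 1) (s := e + 1) (b := b) (by omega) he' (by omega) (by omega)
        (by omega) (by omega)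
      rw [norm_sub_rev, abs_sub_comm] at this
      push_cast at this
      rwa [abs_of_nonneg (by linarith)] at this
  refine (norm_cusum_le x (μ i) h1 h2).trans (le_trans (add_le_add
    (b := 4 * B * r + a * (1 + 2 * √r)) (d := 4 * B * r + a * (1 + 2 * √r)) ?_ ?_) ?_)
  · refine le_trans (div_le_div_of_nonneg_right hl (Real.sqrt_nonneg _)) ?_
    exact div_sqrt_le h.a_nonneg (by positivity) r1
  · refine le_trans (div_le_div_of_nonneg_right hr' (Real.sqrt_nonneg _)) ?_
    exact div_sqrt_le h.a_nonneg (by positivity) r2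
  · linarith [h.le_threshold]

lemma norm_sum_le_of_near (h : SegModel x ε μ t m n a r κ B Δ ξ) {s b : ℕ} (hs1 : 1 ≤ s)
    (hsb : s ≤ b) (hbn : b ≤ n + 1)
    (hk : ‖∑ j ∈ Finset.range b, ε j - ∑ j ∈ Finset.range s, ε j‖ ≤
      a * (√((b : ℝ) - s) + 2 * √r)) :
    ‖∑ j ∈ Finset.Ico s b, x j‖ ≤ ((b : ℝ) - s) * B + a * (√((b : ℝ) - s) + 2 * √r) := by
  have := sum_sub_const (x := x) (ε := ε) hsb 0
  simp only [sub_zero] at this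
  rw [this]
  refine (norm_add_le _ _).trans (add_le_add ?_ hk)
  refine (norm_sum_le_of_le _ (f := fun j => x j - ε j) (n := fun _ => B) fun j hj => ?_).trans ?_
  · rw [Finset.mem_Ico] at hj
    exact h.norm_mean_le (by omega) (by omega)
  · rw [Finset.sum_const, Nat.card_Ico, nsmul_eq_mul, Nat.cast_sub hsb]

/-- P and Q stand for the norms of the sums over the shorter and the longer side of a split. When
the shorter side is centred by the average over the longer one, the correction is no larger than the
bound for the shorter side itself, because an average over more points has the smaller noise. -/
lemma short_side_arith {p q B c P Q : ℝ} (hp : 1 ≤ p) (hpq : p ≤ q) (hc : 0 ≤ c) {r : ℝ}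
    (hP : P ≤ p * B + c * (√p + 2 * √r))
    (hQ : Q ≤ q * B + c * (√q + 2 * √r)) :
    (P + p * (q⁻¹ * Q)) / √p ≤ 2 * (√p * B + c * (1 + 2 * √r)) := by
  have h1 : 1 ≤ √p := Real.one_le_sqrt.2 hp
  have hq : 0 < q := by linarith
  have hsq : √p ≤ √q := Real.sqrt_le_sqrt hpq
  have hpp : √p * √p = p := Real.mul_self_sqrt (by linarith)
  have hqq : √q * √q = q := Real.mul_self_sqrt (by linarith)
  have hrn := Real.sqrt_nonneg r
  rw [div_le_iff₀ (by linarith)]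
  have hcr := mul_nonneg hc hrn
  have e1 : P ≤ (√p * B + c * (1 + 2 * √r)) * √p := by
    have : (√p * B + c * (1 + 2 * √r)) * √p = p * B + c * √p + 2 * (c * √r) * √p := by
      linear_combination B * hpp
    rw [this]
    nlinarith
  have e2 : p * (q⁻¹ * Q) ≤ (√p * B + c * (1 + 2 * √r)) * √p := by
    have : q⁻¹ * Q ≤ B + c * (1 + 2 * √r) * (√q)⁻¹ := by
      rw [inv_mul_le_iff₀ hq]
      have h3 : q * (B + c * (1 + 2 * √r) * (√q)⁻¹) = q * B + c * (1 + 2 * √r) * √q := by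
        have : q * (√q)⁻¹ = √q := by
          rw [← div_eq_mul_inv, div_eq_iff (by linarith), hqq]
        rw [mul_add, mul_comm q (c * _ * _), mul_assoc _ (√q)⁻¹, mul_comm (√q)⁻¹, this]
      rw [h3]
      nlinarith [mul_nonneg hcr (show (0 : ℝ) ≤ √q - 1 by linarith)]
    have h4 : (√q)⁻¹ ≤ (√p)⁻¹ := inv_anti₀ (by linarith) hsq
    have hc' : 0 ≤ c * (1 + 2 * √r) := by positivity
    calc p * (q⁻¹ * Q) ≤ p * (B + c * (1 + 2 * √r) * (√p)⁻¹) := by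
          refine mul_le_mul_of_nonneg_left (this.trans ?_) (by linarith)
          gcongr
      _ = _ := by
          have : p * (√p)⁻¹ = √p := by
            rw [← div_eq_mul_inv, div_eq_iff (by linarith), hpp]
          rw [mul_add, mul_comm p (c * _ * _), mul_assoc _ (√p)⁻¹, mul_comm (√p)⁻¹, this]
          linear_combination (-B) * hpp
  linarith

/-- Large CUSUM statistics do not occur near the ends. -/
lemma far_from_ends (h : SegModel x ε μ t m n a r κ B Δ ξ) {i i' s e b : ℕ} (hi : i ≤ m + 1)
    (hi' : i' ≤ m + 1) (hs : |(s : ℝ) - t i| ≤ r) (he : |(e : ℝ) + 1 - t i'| ≤ r) (hs1 : 1 ≤ s)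
    (hen : e ≤ n) (h1 : s < b) (h2 : b ≤ e) (hM : κ * Δ / 4 * √n ≤ ‖cusum x s e b‖) :
    (κ * Δ / (16 * B)) ^ 2 * n ≤ (b : ℝ) - s ∧ (κ * Δ / (16 * B)) ^ 2 * n ≤ (e : ℝ) + 1 - b := by
  have he' : |((e + 1 : ℕ) : ℝ) - t i'| ≤ r := by push_cast; exact he
  have r1 : (1 : ℝ) ≤ (b : ℝ) - s := by
    have : ((s + 1 : ℕ) : ℝ) ≤ b := by exact_mod_cast h1
    push_cast at this; linarith
  have r2 : (1 : ℝ) ≤ (e : ℝ) + 1 - b := by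
    have : (b : ℝ) ≤ e := by exact_mod_cast h2
    linarith
  have hB := h.B_pos
  have hr := h.one_le_r
  have hl : ‖∑ j ∈ Finset.Ico s b, x j‖ ≤
      ((b : ℝ) - s) * B + a * (√((b : ℝ) - s) + 2 * √r) := by
    refine h.norm_sum_le_of_near hs1 h1.le (by omega) ?_
    have := h.noise_near (k := i) (s := s) (b := b) (by omega) hs hs1 (by omega) (by omega)
      (by omega)
    rwa [abs_of_nonneg (by linarith)] at this
  have hr' : ‖∑ j ∈ Finset.Ico b (e + 1), x j‖ ≤
      ((e : ℝ) + 1 - b) * B + a * (√((e : ℝ) + 1 - b) + 2 * √r) := by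
    have := h.norm_sum_le_of_near (s := b) (b := e + 1) (by omega) (by omega) (by omega) ?_
    · push_cast at this; exact this
    have := h.noise_near (k := i') (s := e + 1) (b := b) (by omega) he' (by omega) (by omega)
      (by omega) (by omega)
    rw [norm_sub_rev, abs_sub_comm] at this
    rwa [abs_of_nonneg (by push_cast; linarith)] at this
  have c1 : ((Finset.Ico s b).card : ℝ) = (b : ℝ) - s := by
    rw [Nat.card_Ico, Nat.cast_sub h1.le]
  have c2 : ((Finset.Ico b (e + 1)).card : ℝ) = (e : ℝ) + 1 - b := by
    rw [Nat.card_Ico, Nat.cast_sub (by omega)]; push_cast; ring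
  have fin : ∀ p : ℝ, 1 ≤ p → ‖cusum x s e b‖ ≤ 2 * (√p * B + a * (1 + 2 * √r)) →
      (κ * Δ / (16 * B)) ^ 2 * n ≤ p := by
    intro p hp hc
    have h3 := h.a_le'
    have h4 : κ * Δ / (16 * B) * √n ≤ √p := by
      rw [div_mul_eq_mul_div, div_le_iff₀ (by positivity)]
      linarith
    have := h.κ_pos
    have := h.Δ_pos
    calc (κ * Δ / (16 * B)) ^ 2 * n = (κ * Δ / (16 * B) * √n) ^ 2 := by
          rw [mul_pow, Real.sq_sqrt (Nat.cast_nonneg n)]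
      _ ≤ (√p) ^ 2 := by gcongr
      _ = p := Real.sq_sqrt (by linarith)
  rcases le_total ((b : ℝ) - s) ((e : ℝ) + 1 - b) with hle | hle
  · have : (κ * Δ / (16 * B)) ^ 2 * n ≤ (b : ℝ) - s := by
      -- Centring at the average over the longer side makes the contribution of that side vanish, so
      -- the shorter side alone has to produce a statistic of order √n and must therefore be long.
      refine fin _ r1 ((norm_cusum_le x (avg x (Finset.Ico b (e + 1))) h1 h2).trans ?_)
      have z : ∑ j ∈ Finset.Ico b (e + 1), (x j - avg x (Finset.Ico b (e + 1))) = 0 := by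
        rw [Finset.sum_sub_distrib, Finset.sum_const, ← Nat.cast_smul_eq_nsmul ℝ, avg, smul_smul,
          mul_inv_cancel₀ (by rw [c2]; linarith), one_smul, sub_self]
      rw [z, norm_zero, zero_div, add_zero]
      refine le_trans ?_ (short_side_arith r1 hle h.a_nonneg hl hr')
      gcongr
      rw [Finset.sum_sub_distrib, Finset.sum_const, ← Nat.cast_smul_eq_nsmul ℝ, c1]
      refine (norm_sub_le _ _).trans ?_
      rw [norm_smul, Real.norm_of_nonneg (by linarith), avg, norm_smul, c2,
        Real.norm_of_nonneg (by positivity)]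
    exact ⟨this, this.trans hle⟩
  · have : (κ * Δ / (16 * B)) ^ 2 * n ≤ (e : ℝ) + 1 - b := by
      refine fin _ r2 ((norm_cusum_le x (avg x (Finset.Ico s b)) h1 h2).trans ?_)
      have z : ∑ j ∈ Finset.Ico s b, (x j - avg x (Finset.Ico s b)) = 0 := by
        rw [Finset.sum_sub_distrib, Finset.sum_const, ← Nat.cast_smul_eq_nsmul ℝ, avg, smul_smul,
          mul_inv_cancel₀ (by rw [c1]; linarith), one_smul, sub_self]
      rw [z, norm_zero, zero_div, zero_add]
      refine le_trans ?_ (short_side_arith r2 hle h.a_nonneg hr' hl)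
      gcongr
      rw [Finset.sum_sub_distrib, Finset.sum_const, ← Nat.cast_smul_eq_nsmul ℝ, c2]
      refine (norm_sub_le _ _).trans ?_
      rw [norm_smul, Real.norm_of_nonneg (by linarith), avg, norm_smul, c1,
        Real.norm_of_nonneg (by positivity)]
    exact ⟨this.trans hle, this⟩

end SegModel

/-! ### Detection and localization of the change points -/

namespace SegModel

variable {x ε μ : ℕ → Curve} {t : ℕ → ℕ} {m n : ℕ} {a r κ B Δ ξ : ℝ}

lemma n_pos (h : SegModel x ε μ t m n a r κ B Δ ξ) : (0 : ℝ) < n := by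
  have h1 := h.four_le
  have h2 := h.κ_pos
  by_contra hn
  have : (n : ℝ) = 0 := le_antisymm (not_lt.1 hn) (Nat.cast_nonneg n)
  rw [this] at h1
  linarith

lemma bridgeSd_le {s e b : ℕ} (h1 : s ≤ b) (h2 : b ≤ e + 1) (hs : 1 ≤ s) (hen : e ≤ n)
    (hse : s ≤ e) : bridgeSd s e b ≤ √n / 2 := by
  have r1 : (s : ℝ) ≤ b := by exact_mod_cast h1
  have r2 : (b : ℝ) ≤ (e : ℝ) + 1 := by exact_mod_cast h2
  have r3 : (1 : ℝ) ≤ s := by exact_mod_cast hs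
  have r4 : (e : ℝ) ≤ n := by exact_mod_cast hen
  have r5 : (s : ℝ) ≤ e := by exact_mod_cast hse
  have : √n / 2 = √((n : ℝ) / 4) := by
    rw [Real.sqrt_div (by positivity)]
    congr 1
    rw [show (4 : ℝ) = 2 ^ 2 by norm_num, Real.sqrt_sq (by norm_num)]
  rw [this]
  apply Real.sqrt_le_sqrt
  rw [div_le_iff₀ (by linarith)]
  nlinarith [sq_nonneg ((b - s : ℝ) - ((e : ℝ) + 1 - b)),
    mul_nonneg (show (0 : ℝ) ≤ (e : ℝ) + 1 - s by linarith)
      (show (0 : ℝ) ≤ (n : ℝ) - ((e : ℝ) + 1 - s) by linarith)]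

/-- Between p and q the bridge grows with slope v minus the overall mean, up to noise. Small values
of the bridge at both points therefore force v close to the overall mean; the constant is (1/8 + 1/8
+ 1/16) / (3/4) = 5/12. -/
lemma slope_le (h : SegModel x ε μ t m n a r κ B Δ ξ) {s e p q : ℕ} {v : Curve} (h0 : s ≤ p)
    (hpq : p < q)
    (hx : ∀ j, p ≤ j → j < q → x j = v + ε j)
    (hε : ‖∑ j ∈ Finset.range q, ε j - ∑ j ∈ Finset.range p, ε j‖ ≤ a * √n)
    (hp : ‖bridge x s e p‖ ≤ κ * Δ * n / 8) (hq : ‖bridge x s e q‖ ≤ κ * Δ * n / 8)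
    (hd : 3 / 4 * (κ * n) ≤ (q : ℝ) - p) :
    ‖v - ((e : ℝ) + 1 - s)⁻¹ • ∑ j ∈ Finset.Ico s (e + 1), x j‖ ≤ 5 / 12 * Δ := by
  have hn := h.n_pos
  have hκ := h.κ_pos
  have key : ((q : ℝ) - p) • (v - ((e : ℝ) + 1 - s)⁻¹ • ∑ j ∈ Finset.Ico s (e + 1), x j) =
      bridge x s e q - bridge x s e p -
        (∑ j ∈ Finset.range q, ε j - ∑ j ∈ Finset.range p, ε j) := by
    unfold bridge
    rw [← Finset.sum_Ico_eq_sub _ hpq.le, ← Finset.sum_Ico_consecutive x h0 hpq.le,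
      Finset.sum_congr rfl fun j hj => hx j (Finset.mem_Ico.1 hj).1 (Finset.mem_Ico.1 hj).2,
      Finset.sum_add_distrib, Finset.sum_const, Nat.card_Ico, ← Nat.cast_smul_eq_nsmul ℝ,
      Nat.cast_sub hpq.le]
    ext u
    simp only [ContinuousMap.add_apply, ContinuousMap.sub_apply, ContinuousMap.smul_apply,
      smul_eq_mul]
    ring
  have hnorm := congrArg norm key
  have hd' : 0 < (q : ℝ) - p := lt_of_lt_of_le (by positivity) hd
  rw [norm_smul, Real.norm_of_nonneg hd'.le] at hnorm
  have h1 : ((q : ℝ) - p) * ‖v - ((e : ℝ) + 1 - s)⁻¹ • ∑ j ∈ Finset.Ico s (e + 1), x j‖ ≤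
      5 / 16 * (κ * Δ * n) := by
    rw [hnorm]
    refine (norm_sub_le _ _).trans ?_
    linarith [norm_sub_le (bridge x s e q) (bridge x s e p), h.a_le]
  have h2 := mul_le_mul_of_nonneg_right hd
    (norm_nonneg (v - ((e : ℝ) + 1 - s)⁻¹ • ∑ j ∈ Finset.Ico s (e + 1), x j))
  have h3 : 0 < 3 / 4 * (κ * n) := by positivity
  refine le_of_mul_le_mul_left ?_ h3
  linarith

/-- An interval that contains a change point far from its ends has a large CUSUM statistic. -/
lemma le_of_forall_cusum_le (h : SegModel x ε μ t m n a r κ B Δ ξ) {i i' s e : ℕ} {M : ℝ}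
    (hii : i + 1 < i') (hi' : i' ≤ m + 1) (hs : |(s : ℝ) - t i| ≤ r)
    (he : |(e : ℝ) + 1 - t i'| ≤ r) (hs1 : 1 ≤ s) (hen : e ≤ n)
    (hM : ∀ b ∈ Finset.Ioc s e, ‖cusum x s e b‖ ≤ M) : κ * Δ / 4 * √n ≤ M := by
  by_contra! hlt
  have hr := h.r_le
  have hr1 := h.one_le_r
  have g1 := h.gap i (by omega)
  have g2 := h.gap (i + 1) (by omega)
  have g3 : (t (i + 1 + 1) : ℝ) ≤ t i' := by exact_mod_cast h.monotone (by omega) hi'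
  obtain ⟨hs', hs''⟩ := abs_le.1 hs
  obtain ⟨he', he''⟩ := abs_le.1 he
  have b1 : s < t (i + 1) := by
    have : (s : ℝ) < t (i + 1) := by linarith
    exact_mod_cast this
  have b2 : t (i + 1) < e + 1 := by
    have : ((t (i + 1) : ℕ) : ℝ) < ((e + 1 : ℕ) : ℝ) := by push_cast; linarith
    exact_mod_cast this
  have b3 := h.lt_succ (k := i) (by omega)
  have b4 := h.lt_succ (k := i + 1) (by omega)
  have hM0 : 0 ≤ M := (norm_nonneg _).trans
    (hM (t (i + 1)) (Finset.mem_Ioc.2 ⟨b1, by omega⟩))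
  have hbr : ∀ c, s ≤ c → c ≤ e + 1 → ‖bridge x s e c‖ ≤ κ * Δ * n / 8 := by
    intro c h1 h2
    refine (norm_bridge_le (by omega) hM h1 h2).trans ?_
    calc M * bridgeSd s e c ≤ κ * Δ / 4 * √n * (√n / 2) :=
          mul_le_mul hlt.le (bridgeSd_le h1 h2 hs1 hen (by omega)) (bridgeSd_nonneg _ _ _)
            (hM0.trans hlt.le)
      _ = κ * Δ / 8 * (√n * √n) := by ring
      _ = _ := by rw [Real.mul_self_sqrt (Nat.cast_nonneg n)]; ring
  have hε : ∀ c, 1 ≤ c → c ≤ n + 1 →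
      ‖∑ j ∈ Finset.range c, ε j - ∑ j ∈ Finset.range (t (i + 1)), ε j‖ ≤ a * √n := by
    intro c h1 h2
    refine (h.noise (i + 1) (by omega) c h1 h2).trans
      (mul_le_mul_of_nonneg_left (Real.sqrt_le_sqrt ?_) h.a_nonneg)
    have r1 : (1 : ℝ) ≤ c := by exact_mod_cast h1
    have r2 : (c : ℝ) ≤ n + 1 := by exact_mod_cast h2
    have r3 : (1 : ℝ) ≤ t (i + 1) := by exact_mod_cast h.one_le_t (by omega)
    have r4 : (t (i + 1) : ℝ) ≤ n + 1 := by exact_mod_cast h.t_le (by omega)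
    rw [abs_le]; constructor <;> linarith
  have s1 := h.slope_le (s := s) (e := e) (p := max s (t i)) (q := t (i + 1)) (v := μ i)
    (le_max_left _ _) (by omega)
    (fun j h1 h2 => h.mean i (by omega) j (by omega) h2)
    (by rw [norm_sub_rev]; exact hε _ (by omega) (by omega))
    (hbr _ (le_max_left _ _) (by omega)) (hbr _ b1.le (by omega))
    (by
      rw [Nat.cast_max]
      rcases max_cases (s : ℝ) (t i) with hm | hm <;> rw [hm.1] <;> linarith)
  have s2 := h.slope_le (s := s) (e := e) (p := t (i + 1)) (q := min (e + 1) (t (i + 1 + 1)))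
    (v := μ (i + 1)) b1.le (by omega)
    (fun j h1 h2 => h.mean (i + 1) (by omega) j h1 (by omega))
    (hε _ (by omega) (by omega)) (hbr _ b1.le (by omega))
    (hbr _ (by omega) (by omega))
    (by
      push_cast
      rcases min_cases ((e : ℝ) + 1) (t (i + 1 + 1)) with hm | hm <;> rw [hm.1] <;> linarith)
  have := h.jump i (by omega)
  have hΔ := h.Δ_pos
  -- The means on both sides of the change would each be within 5Δ/12 of the overall mean, so the
  -- jump would be at most 5Δ/6, contradicting its size Δ.
  have tri := norm_sub_le
    (μ (i + 1) - ((e : ℝ) + 1 - s)⁻¹ • ∑ j ∈ Finset.Ico s (e + 1), x j)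
    (μ i - ((e : ℝ) + 1 - s)⁻¹ • ∑ j ∈ Finset.Ico s (e + 1), x j)
  rw [sub_sub_sub_cancel_right] at tri
  linarith

set_option maxHeartbeats 600000 in
/-- A maximizer of the CUSUM statistic is close to a change point. -/
lemma exists_near (h : SegModel x ε μ t m n a r κ B Δ ξ) {i i' s e b : ℕ}
    (hii : i + 1 < i') (hi' : i' ≤ m + 1) (hs : |(s : ℝ) - t i| ≤ r)
    (he : |(e : ℝ) + 1 - t i'| ≤ r) (hs1 : 1 ≤ s) (hen : e ≤ n) (hb : b ∈ Finset.Ioc s e)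
    (hM : ∀ b' ∈ Finset.Ioc s e, ‖cusum x s e b'‖ ≤ ‖cusum x s e b‖) :
    ∃ k, i < k ∧ k < i' ∧ |(b : ℝ) - t k| ≤ r := by
  by_contra! hno
  obtain ⟨hb1, hb2⟩ := Finset.mem_Ioc.1 hb
  have hr := h.r_le
  have hr1 := h.one_le_r
  have hn := h.n_pos
  have hκ := h.κ_pos
  have hΔ := h.Δ_pos
  have hlow := h.le_of_forall_cusum_le hii hi' hs he hs1 hen hM
  obtain ⟨f1, f2⟩ := h.far_from_ends (by omega) hi' hs he hs1 hen hb1 hb2 hlow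
  have hfar := h.r_le'
  obtain ⟨hs', hs''⟩ := abs_le.1 hs
  obtain ⟨he', he''⟩ := abs_le.1 he
  have hanr : 0 ≤ a * √r := mul_nonneg h.a_nonneg (Real.sqrt_nonneg _)
  set η := κ ^ 2 * Δ / 64 with hη
  have hηpos : 0 < η := by positivity
  have hdiv : 64 * (a * √r) / (κ ^ 2 * Δ) = a * √r / η := by rw [hη]; field_simp
  have hq : 0 ≤ a * √r / η := by positivity
  rw [hdiv] at hfar
  have hqη : a * √r / η * η = a * √r := div_mul_cancel₀ _ hηpos.ne'
  have hbi : t i ≤ b := by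
    have : (t i : ℝ) ≤ b := by linarith
    exact_mod_cast this
  have hbi' : b < t i' := by
    have : (b : ℝ) < t i' := by linarith
    exact_mod_cast this
  obtain ⟨k, hk1, hk2, hk3, hk4⟩ := exists_segment (t := t) (by omega) hbi hbi'
  have hk3' : (t k : ℝ) ≤ b := by exact_mod_cast hk3
  have hk4' : (b : ℝ) < t (k + 1) := by exact_mod_cast hk4
  have gk := h.gap k (by omega)
  -- the noise to the left of `b`
  have left : ‖∑ j ∈ Finset.Ico (max s (t k)) b, ε j‖ ≤
      2 * η * ((b : ℝ) - (max s (t k) : ℕ)) := by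
    rw [Finset.sum_Ico_eq_sub _ (by omega)]
    -- In the outermost segment the stretch may start at s, which is only near a change point. The
    -- extra noise a√r is absorbed because b is far from the ends; this is the reason for the factor
    -- 2 in front of η.
    rcases hk1.eq_or_lt with rfl | hik
    · have n1 := h.noise_far i (by omega) b (by omega) (by omega)
        (by rw [abs_of_nonneg (by linarith)]; linarith)
      rw [abs_of_nonneg (by linarith)] at n1
      have n2 : ‖∑ j ∈ Finset.range (max s (t i)), ε j - ∑ j ∈ Finset.range (t i), ε j‖ ≤
          a * √r := by
        refine (h.noise i (by omega) _ (by omega) (by omega)).trans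
          (mul_le_mul_of_nonneg_left (Real.sqrt_le_sqrt ?_) h.a_nonneg)
        rw [Nat.cast_max]
        rcases max_cases (s : ℝ) (t i) with hm | hm <;> rw [hm.1]
        · exact hs
        · simp; linarith
      have hm : (max s (t i) : ℕ) ≤ (t i : ℝ) + r := by
        rw [Nat.cast_max]; exact max_le (by linarith) (by linarith)
      have hm' : (max s (t i) : ℕ) ≤ (s : ℝ) + r := by
        rw [Nat.cast_max]; exact max_le (by linarith) (by linarith)
      calc _ = ‖(∑ j ∈ Finset.range b, ε j - ∑ j ∈ Finset.range (t i), ε j) -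
            (∑ j ∈ Finset.range (max s (t i)), ε j - ∑ j ∈ Finset.range (t i), ε j)‖ := by
            congr 1; abel
        _ ≤ η * ((b : ℝ) - t i) + a * √r := (norm_sub_le _ _).trans (add_le_add n1 n2)
        _ = η * ((b : ℝ) - t i + a * √r / η) := by linear_combination -hqη
        _ ≤ η * ((b : ℝ) - (max s (t i) : ℕ) + (r + a * √r / η)) :=
            mul_le_mul_of_nonneg_left (by linarith) hηpos.le
        _ ≤ η * ((b : ℝ) - (max s (t i) : ℕ) + ((b : ℝ) - (max s (t i) : ℕ))) :=
            mul_le_mul_of_nonneg_left (by linarith) hηpos.le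
        _ = _ := by ring
    · have hno' := hno k hik hk2
      have hsk : max s (t k) = t k := by
        apply max_eq_right
        have := h.gap' hik (by omega)
        have : (s : ℝ) ≤ t k := by linarith
        exact_mod_cast this
      rw [hsk]
      refine (h.noise_far k (by omega) b (by omega) (by omega) hno'.le).trans ?_
      rw [abs_of_nonneg (by linarith), ← hη]
      linarith [mul_nonneg hηpos.le (sub_nonneg.2 hk3')]
  have right : ‖∑ j ∈ Finset.Ico b (min (e + 1) (t (k + 1))), ε j‖ ≤
      2 * η * (((min (e + 1) (t (k + 1)) : ℕ) : ℝ) - b) := by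
    rw [Finset.sum_Ico_eq_sub _ (by omega), norm_sub_rev]
    rcases (Nat.succ_le_of_lt hk2).eq_or_lt with hki | hki
    · have hki : k + 1 = i' := hki
      rw [hki] at hk4' ⊢
      have n1 := h.noise_far i' (by omega) b (by omega) (by omega)
        (by rw [abs_of_nonpos (by linarith)]; linarith)
      rw [abs_of_nonpos (by linarith)] at n1
      have n2 : ‖∑ j ∈ Finset.range (min (e + 1) (t i')), ε j - ∑ j ∈ Finset.range (t i'), ε j‖ ≤
          a * √r := by
        have := h.one_le_t hi'
        refine (h.noise i' (by omega) _ (by omega) (by omega)).trans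
          (mul_le_mul_of_nonneg_left (Real.sqrt_le_sqrt ?_) h.a_nonneg)
        push_cast
        rcases min_cases ((e : ℝ) + 1) (t i') with hm | hm <;> rw [hm.1]
        · exact he
        · simp; linarith
      have hm : (t i' : ℝ) - r ≤ (min (e + 1) (t i') : ℕ) := by
        push_cast; exact le_min (by linarith) (by linarith)
      have hm' : (e : ℝ) + 1 - r ≤ (min (e + 1) (t i') : ℕ) := by
        push_cast; exact le_min (by linarith) (by linarith)
      calc _ = ‖(∑ j ∈ Finset.range b, ε j - ∑ j ∈ Finset.range (t i'), ε j) -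
            (∑ j ∈ Finset.range (min (e + 1) (t i')), ε j -
              ∑ j ∈ Finset.range (t i'), ε j)‖ := by
            congr 1; abel
        _ ≤ η * -((b : ℝ) - t i') + a * √r := (norm_sub_le _ _).trans (add_le_add n1 n2)
        _ = η * (-((b : ℝ) - t i') + a * √r / η) := by linear_combination -hqη
        _ ≤ η * (((min (e + 1) (t i') : ℕ) : ℝ) - b + (r + a * √r / η)) :=
            mul_le_mul_of_nonneg_left (by linarith) hηpos.le
        _ ≤ η * (((min (e + 1) (t i') : ℕ) : ℝ) - b +
              (((min (e + 1) (t i') : ℕ) : ℝ) - b)) :=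
            mul_le_mul_of_nonneg_left (by linarith) hηpos.le
        _ = _ := by ring
    · have hki : k + 1 < i' := hki
      have hno' := hno (k + 1) (by omega) hki
      have hsk : min (e + 1) (t (k + 1)) = t (k + 1) := by
        apply min_eq_right
        have := h.gap' hki (by omega)
        have : ((t (k + 1) : ℕ) : ℝ) ≤ ((e + 1 : ℕ) : ℝ) := by push_cast; linarith
        exact_mod_cast this
      rw [hsk]
      refine (h.noise_far (k + 1) (by omega) b (by omega) (by omega) hno'.le).trans ?_
      rw [abs_of_nonpos (by linarith), ← hη]
      linarith [mul_nonneg hηpos.le (sub_nonneg.2 hk4'.le)]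
  have lt1 : max s (t k) < b := by
    rcases hk3.eq_or_lt with heq | hlt
    · rcases hk1.eq_or_lt with rfl | hik
      · rw [heq] at hs'; linarith
      · have := hno k hik hk2
        rw [heq, sub_self, abs_zero] at this
        linarith
    · exact max_lt hb1 hlt
  have hmax := cusum_max_le hM rfl (le_max_left s (t k)) lt1 (show b < min (e + 1) (t (k + 1)) by
    omega) (min_le_left _ _) (v := μ k) (ν := ε)
    (fun j hj => by
      rw [Finset.mem_Ico] at hj
      exact h.mean k (by omega) j (by omega) (by omega)) left right
  have hlen : κ * n / 2 ≤ ((min (e + 1) (t (k + 1)) : ℕ) : ℝ) - (max s (t k) : ℕ) := by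
    have e1 : (t (k + 1) : ℝ) - r ≤ (min (e + 1) (t (k + 1)) : ℕ) := by
      have : (t (k + 1) : ℝ) ≤ t i' := by exact_mod_cast h.monotone hk2 hi'
      push_cast; exact le_min (by linarith) (by linarith)
    have e2 : ((max s (t k) : ℕ) : ℝ) ≤ t k + r := by
      have : (t i : ℝ) ≤ t k := by exact_mod_cast h.monotone hk1 (by omega)
      rw [Nat.cast_max]; exact max_le (by linarith) (by linarith)
    linarith
  have hsn : 0 < √(n : ℝ) := Real.sqrt_pos.2 hn
  have hL : ((e : ℝ) + 1 - s) * √((e : ℝ) + 1 - s) ≤ n * √n := by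
    have r1 : (1 : ℝ) ≤ s := by exact_mod_cast hs1
    have r2 : (e : ℝ) ≤ n := by exact_mod_cast hen
    exact mul_le_mul (by linarith) (Real.sqrt_le_sqrt (by linarith)) (Real.sqrt_nonneg _) hn.le
  -- With η = κ²Δ/64 the lower bounds for the maximum and for the length of the stretch give a
  -- product 8η n√n, while `cusum_max_le` allows only 4η n√n.
  have h1 : κ * Δ / 4 * √n * (κ * n / 2) ≤ 2 * (2 * η) * (n * √n) := by
    refine (mul_le_mul hlow hlen (by positivity) (norm_nonneg _)).trans (hmax.trans ?_)
    gcongr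
  have h2 : κ * Δ / 4 * √n * (κ * n / 2) = 8 * η * (n * √n) := by rw [hη]; ring
  have h3 : 0 < η * (n * √n) := by positivity
  linarith

/-- Binary segmentation finds exactly one point close to each change point. -/
lemma binSeg_eq (h : SegModel x ε μ t m n a r κ B Δ ξ) {s e : ℕ} {S : Finset ℕ}
    (hS : BinSeg x ξ s e S) : ∀ i i', i < i' → i' ≤ m + 1 → |(s : ℝ) - t i| ≤ r →
    |(e : ℝ) + 1 - t i'| ≤ r → 1 ≤ s → e ≤ n →
    ∃ b : ℕ → ℕ, (∀ k, i < k → k < i' → |(b k : ℝ) - t k| ≤ r) ∧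
      ∀ y, y ∈ S ↔ ∃ k, i < k ∧ k < i' ∧ y = b k := by
  -- The invariant of the recursion: s and e + 1 are within r of true change points with indices i <
  -- i'. A split point is again within r of some change point strictly between, so both subintervals
  -- satisfy the invariant.
  induction hS with
  | short s e hse =>
    intro i i' hii hi' hs he hs1 hen
    exfalso
    have := h.gap' hii hi'
    have hr := h.r_le
    have hr1 := h.one_le_r
    have : (e : ℝ) ≤ s := by exact_mod_cast hse
    linarith [(abs_le.1 hs).2, (abs_le.1 he).1]
  | noChange s e hse hξ =>
    intro i i' hii hi' hs he hs1 hen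
    rcases (Nat.succ_le_of_lt hii).eq_or_lt with heq | hlt
    · refine ⟨fun _ => 0, fun k _ _ => by omega, fun y => ⟨fun hy => by simp at hy, ?_⟩⟩
      rintro ⟨k, _, _, _⟩; omega
    · exact absurd (h.le_of_forall_cusum_le hlt hi' hs he hs1 hen hξ) (not_le.2 h.threshold_lt)
  | split s e b S T hb hmax hξ _ _ ihS ihT =>
    intro i i' hii hi' hs he hs1 hen
    obtain ⟨hb1, hb2⟩ := Finset.mem_Ioc.1 hb
    rcases (Nat.succ_le_of_lt hii).eq_or_lt with heq | hlt
    · have heq : i + 1 = i' := heq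
      subst heq
      exact absurd (h.no_false_alarm (by omega) hs he hs1 hen hb1 hb2) (not_le.2 hξ)
    · obtain ⟨k, hk1, hk2, hk⟩ := h.exists_near hlt hi' hs he hs1 hen hb hmax
      have hcast : (((b - 1 : ℕ) : ℝ) + 1) = b := by
        rw [Nat.cast_sub (by omega)]; push_cast; ring
      obtain ⟨bS, hbS, hmS⟩ := ihS i k hk1 (by omega) hs (by rw [hcast]; exact hk) hs1 (by omega)
      obtain ⟨bT, hbT, hmT⟩ := ihT k i' hk2 hi' hk he (by omega) hen
      refine ⟨fun l => if l < k then bS l else if l = k then b else bT l, ?_, ?_⟩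
      · intro l h1 h2
        rcases lt_trichotomy l k with hl | rfl | hl
        · simpa [hl] using hbS l h1 hl
        · simpa using hk
        · simpa [hl.not_gt, hl.ne'] using hbT l hl h2
      · intro y
        rw [Finset.mem_insert, Finset.mem_union, hmS, hmT]
        constructor
        · rintro (rfl | ⟨l, h1, h2, rfl⟩ | ⟨l, h1, h2, rfl⟩)
          · exact ⟨k, hk1, hk2, by simp⟩
          · exact ⟨l, h1, by omega, by simp [h2]⟩
          · exact ⟨l, by omega, h2, by simp [h1.not_gt, h1.ne']⟩
        · rintro ⟨l, h1, h2, rfl⟩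
          rcases lt_trichotomy l k with hl | rfl | hl
          · exact Or.inr (Or.inl ⟨l, h1, hl, by simp [hl]⟩)
          · simp
          · exact Or.inr (Or.inr ⟨l, hl, h2, by simp [hl.not_gt, hl.ne']⟩)

end SegModel

/-! ### The estimated segment means -/

namespace SegModel

variable {x ε μ : ℕ → Curve} {t : ℕ → ℕ} {m n : ℕ} {a r κ B Δ ξ : ℝ}

open Classical in
/-- The mean is estimated well by binary segmentation, except near change points. -/
lemma norm_mean_sub_segMean_le (h : SegModel x ε μ t m n a r κ B Δ ξ) {S : Finset ℕ}
    (hS : BinSeg x ξ 1 n S) {j : ℕ} (hj1 : 1 ≤ j) (hjn : j ≤ n) :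
    ‖x j - ε j - segMean x n S j‖ ≤ 2 * (4 * B * r + a * (√n + 2 * √r)) / (κ * n) +
      if ∃ k ≤ m + 1, |(j : ℝ) - t k| ≤ r then 2 * B else 0 := by
  have hr1 := h.one_le_r
  have hr := h.r_le
  have hB := h.B_pos
  have hκn : 0 < κ * n := mul_pos h.κ_pos h.n_pos
  obtain ⟨b₀, hb₀, hmem⟩ := h.binSeg_eq hS 0 (m + 1) (by omega) le_rfl
    (by rw [h.t_zero]; simp; linarith) (by rw [h.t_last]; simp; linarith) le_rfl le_rfl
  -- Adding 1 and n + 1 to the estimated change points makes the estimated segments exactly the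
  -- intervals [b k, b (k+1)), each of length at least κn/2.
  obtain ⟨b, hbdef⟩ : ∃ b : ℕ → ℕ, b = fun k => if k = 0 then 1 else if k < m + 1 then b₀ k
    else n + 1 := ⟨_, rfl⟩
  have b0 : b 0 = 1 := by simp [hbdef]
  have bm : b (m + 1) = n + 1 := by simp [hbdef]
  have bk : ∀ k, 0 < k → k < m + 1 → b k = b₀ k := fun k h1 h2 => by simp only [hbdef, h1.ne', h2, if_true, if_false]
  have hbt : ∀ k ≤ m + 1, |(b k : ℝ) - t k| ≤ r := by
    intro k hk
    rcases Nat.eq_zero_or_pos k with rfl | hk0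
    · rw [b0, h.t_zero, sub_self, abs_zero]; linarith
    rcases hk.eq_or_lt with rfl | hk
    · rw [bm, h.t_last, sub_self, abs_zero]; linarith
    · rw [bk k hk0 hk]; exact hb₀ k hk0 hk
  have hlen : ∀ k ≤ m, κ * n / 2 ≤ (b (k + 1) : ℝ) - b k := by
    intro k hk
    linarith [h.gap k hk, (abs_le.1 (hbt k (by omega))).2, (abs_le.1 (hbt (k + 1) (by omega))).1]
  have hlt : ∀ k ≤ m, b k < b (k + 1) := by
    intro k hk
    have : (b k : ℝ) < b (k + 1) := by linarith [hlen k hk]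
    exact_mod_cast this
  have hmono : ∀ l k, l ≤ k → k ≤ m + 1 → b l ≤ b k := by
    intro l k hlk hk
    induction k, hlk using Nat.le_induction with
    | base => exact le_rfl
    | succ k hlk ih => exact (ih (by omega)).trans (hlt k (by omega)).le
  obtain ⟨k, -, hk, hk1, hk2⟩ := exists_segment (t := b) (i := 0) (i' := m + 1) (j := j)
    (by omega) (by omega) (by omega)
  have hbk1 : 1 ≤ b k := by rw [← b0]; exact hmono 0 k (by omega) (by omega)
  have hbkn : b (k + 1) ≤ n + 1 := by rw [← bm]; exact hmono (k + 1) (m + 1) (by omega) le_rfl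
  have hclass : (Finset.Icc 1 n).filter (fun y => ∀ z ∈ S, z ≤ y ↔ z ≤ j) =
      Finset.Ico (b k) (b (k + 1)) := by
    ext y
    rw [Finset.mem_filter, Finset.mem_Icc, Finset.mem_Ico]
    constructor
    · rintro ⟨⟨hy1, hyn⟩, hy⟩
      constructor
      · rcases Nat.eq_zero_or_pos k with rfl | hk0
        · omega
        · rw [bk k hk0 hk] at hk1 ⊢
          exact (hy _ ((hmem _).2 ⟨k, hk0, hk, rfl⟩)).2 hk1
      · rcases (Nat.succ_le_of_lt hk).eq_or_lt with hkm | hkm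
        · have hkm : k + 1 = m + 1 := hkm
          rw [hkm, bm]; omega
        · have hkm : k + 1 < m + 1 := hkm
          rw [bk (k + 1) (by omega) hkm] at hk2 ⊢
          by_contra hcon
          exact absurd ((hy _ ((hmem _).2 ⟨k + 1, by omega, hkm, rfl⟩)).1 (not_lt.1 hcon))
            (not_le.2 hk2)
    · rintro ⟨hy1, hy2⟩
      refine ⟨⟨by omega, by omega⟩, fun z hz => ?_⟩
      obtain ⟨l, hl0, hlm, rfl⟩ := (hmem z).1 hz
      rw [← bk l hl0 hlm]
      rcases le_or_gt l k with hlk | hlk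
      · have := hmono l k hlk (by omega)
        exact ⟨fun _ => by omega, fun _ => by omega⟩
      · have := hmono (k + 1) l hlk (by omega)
        exact ⟨fun _ => by omega, fun _ => by omega⟩
  have hcard : ((Finset.Ico (b k) (b (k + 1))).card : ℝ) = (b (k + 1) : ℝ) - b k := by
    rw [Nat.card_Ico, Nat.cast_sub (by omega)]
  have hc2 := hlen k (by omega)
  have hcpos : 0 < (b (k + 1) : ℝ) - b k := by linarith
  have hmean : ‖segMean x n S j - μ k‖ ≤
      2 * (4 * B * r + a * (√n + 2 * √r)) / (κ * n) := by
    have e1 : segMean x n S j - μ k =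
        ((b (k + 1) : ℝ) - b k)⁻¹ • ∑ y ∈ Finset.Ico (b k) (b (k + 1)), (x y - μ k) := by
      unfold segMean
      rw [hclass, avg, hcard, Finset.sum_sub_distrib, Finset.sum_const, ← Nat.cast_smul_eq_nsmul ℝ,
        hcard, smul_sub, smul_smul, inv_mul_cancel₀ hcpos.ne', one_smul]
    have e2 : ‖∑ y ∈ Finset.Ico (b k) (b (k + 1)), (x y - μ k)‖ ≤
        4 * B * r + a * (√n + 2 * √r) := by
      rw [sum_sub_const (x := x) (ε := ε) (by omega)]
      refine (norm_add_le _ _).trans (add_le_add ((norm_sum_le _ _).trans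
        (h.sum_misfit_le (by omega) (hbt k (by omega)) (hbt (k + 1) (by omega)) hbk1 hbkn)) ?_)
      refine (h.noise_near (k := k) (by omega) (hbt k (by omega)) hbk1 (by omega) (by omega)
        hbkn).trans (mul_le_mul_of_nonneg_left ?_ h.a_nonneg)
      gcongr
      rw [abs_of_pos hcpos]
      have r1 : (1 : ℝ) ≤ b k := by exact_mod_cast hbk1
      have r2 : (b (k + 1) : ℝ) ≤ n + 1 := by exact_mod_cast hbkn
      linarith
    rw [e1, norm_smul, Real.norm_of_nonneg (by positivity), mul_comm, ← div_eq_mul_inv,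
      div_le_div_iff₀ hcpos hκn]
    have hnn : 0 ≤ 4 * B * r + a * (√n + 2 * √r) := (norm_nonneg _).trans e2
    nlinarith [mul_le_mul e2 le_rfl hκn.le hnn, mul_le_mul_of_nonneg_left hc2 hnn]
  have hfit : ‖x j - ε j - μ k‖ ≤ if ∃ k ≤ m + 1, |(j : ℝ) - t k| ≤ r then 2 * B else 0 := by
    split_ifs with hc
    · refine (norm_sub_le _ _).trans ?_
      linarith [h.norm_mean_le hj1 hjn, h.bound k (by omega)]
    · push Not at hc
      have rk1 : (b k : ℝ) ≤ j := by exact_mod_cast hk1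
      have rk2 : (j : ℝ) < b (k + 1) := by exact_mod_cast hk2
      have h1 : t k ≤ j := by
        by_contra hcon
        have : (j : ℝ) < t k := by exact_mod_cast not_le.1 hcon
        have h2 := hc k (by omega)
        rw [abs_of_neg (by linarith)] at h2
        linarith [(abs_le.1 (hbt k (by omega))).1]
      have h2 : j < t (k + 1) := by
        by_contra hcon
        have : (t (k + 1) : ℝ) ≤ j := by exact_mod_cast not_lt.1 hcon
        have h2 := hc (k + 1) (by omega)
        rw [abs_of_nonneg (by linarith)] at h2
        linarith [(abs_le.1 (hbt (k + 1) (by omega))).2]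
      rw [h.mean k (by omega) j h1 h2]
      simp
  calc _ = ‖(x j - ε j - μ k) - (segMean x n S j - μ k)‖ := by rw [sub_sub_sub_cancel_right]
    _ ≤ _ := (norm_sub_le _ _).trans (by linarith)

end SegModel

/-! ### A moment inequality for sums of martingale differences -/

/-- Binomial expansion: in every term of order at least two in y, a factor y² is split off and the
remaining mixed monomial of even degree p-2 is bounded by the sum of the two pure powers. The linear
term is kept exact, since orthogonality will remove it after integration. -/
lemma add_pow_le_of_even {p : ℕ} (hp : Even p) (hp2 : 2 ≤ p) (x y : ℝ) :
    (x + y) ^ p ≤ x ^ p + p * (x ^ (p - 1) * y) + 2 ^ p * (x ^ (p - 2) * y ^ 2 + y ^ p) := by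
  obtain ⟨q, rfl⟩ : ∃ q, p = q + 2 := ⟨p - 2, by omega⟩
  have hq : Even q := by
    rcases hp with ⟨k, hk⟩; exact ⟨k - 1, by omega⟩
  simp only [show q + 2 - 1 = q + 1 by omega, show q + 2 - 2 = q by omega]
  have hterm : ∀ k ∈ Finset.range (q + 1), y ^ (k + 2) * x ^ (q - k) * ((q + 2).choose (k + 2)) ≤
      ((q + 2).choose (k + 2) : ℝ) * (x ^ q * y ^ 2 + y ^ (q + 2)) := by
    intro k hk
    have hk : k ≤ q := by simpa [Nat.lt_succ_iff] using hk
    rw [mul_comm]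
    refine mul_le_mul_of_nonneg_left ?_ (Nat.cast_nonneg _)
    have h1 : y ^ k * x ^ (q - k) ≤ x ^ q + y ^ q := by
      calc y ^ k * x ^ (q - k) ≤ |y| ^ k * |x| ^ (q - k) := by
            rw [← abs_pow, ← abs_pow, ← abs_mul]; exact le_abs_self _
        _ ≤ (max |x| |y|) ^ k * (max |x| |y|) ^ (q - k) := by
            gcongr
            · exact le_max_right _ _
            · exact le_max_left _ _
        _ = (max |x| |y|) ^ q := by rw [← pow_add]; congr 1; omega
        _ ≤ |x| ^ q + |y| ^ q := by
            rcases max_cases |x| |y| with hm | hm <;> rw [hm.1]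
            · linarith [pow_nonneg (abs_nonneg y) q]
            · linarith [pow_nonneg (abs_nonneg x) q]
        _ = _ := by rw [hq.pow_abs, hq.pow_abs]
    calc y ^ (k + 2) * x ^ (q - k) = y ^ 2 * (y ^ k * x ^ (q - k)) := by ring
      _ ≤ y ^ 2 * (x ^ q + y ^ q) := mul_le_mul_of_nonneg_left h1 (sq_nonneg y)
      _ = _ := by ring
  have hsum : (∑ k ∈ Finset.range (q + 1), ((q + 2).choose (k + 2) : ℝ)) ≤ 2 ^ (q + 2) := by
    have := Nat.sum_range_choose (q + 2)
    rw [Finset.sum_range_succ', Finset.sum_range_succ'] at this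
    have h2 : ∑ k ∈ Finset.range (q + 1), (q + 2).choose (k + 2) ≤ 2 ^ (q + 2) := by
      rw [← this]; simp only [add_assoc, Nat.reduceAdd]; omega
    exact_mod_cast h2
  have hR : 0 ≤ x ^ q * y ^ 2 + y ^ (q + 2) :=
    add_nonneg (mul_nonneg (hq.pow_nonneg x) (sq_nonneg y)) (hp.pow_nonneg y)
  rw [add_comm x y, add_pow, Finset.sum_range_succ', Finset.sum_range_succ']
  have h3 := Finset.sum_le_sum hterm
  rw [← Finset.sum_mul] at h3
  have h4 := mul_le_mul_of_nonneg_right hsum hR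
  have e1 : ∑ k ∈ Finset.range (q + 1),
      y ^ (k + 1 + 1) * x ^ (q + 2 - (k + 1 + 1)) * ((q + 2).choose (k + 1 + 1) : ℝ) =
      ∑ k ∈ Finset.range (q + 1), y ^ (k + 2) * x ^ (q - k) * ((q + 2).choose (k + 2) : ℝ) := by
    refine Finset.sum_congr rfl fun k _ => ?_
    rw [show q + 2 - (k + 1 + 1) = q - k by omega]
  rw [e1]
  simp only [zero_add, pow_one, pow_zero, Nat.choose_one_right, Nat.choose_zero_right,
    Nat.sub_zero, one_mul, Nat.cast_one, mul_one, show q + 2 - 1 = q + 1 by omega]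
  have e2 : y * x ^ (q + 1) * ((q + 2 : ℕ) : ℝ) = ((q + 2 : ℕ) : ℝ) * (x ^ (q + 1) * y) := by ring
  rw [e2]
  linarith

/-- A weighted Young inequality, by cases according to whether N y² ≤ x². The weight is for sums of
N terms: the first summand inflates the running moment by a factor 1 + O(1/N) per step, harmless
over N steps. -/
lemma pow_mul_sq_le {q : ℕ} (hq : Even q) (x y : ℝ) {N : ℝ} (hN : 1 ≤ N) :
    x ^ q * y ^ 2 ≤ x ^ (q + 2) / N + N ^ (q / 2) * y ^ (q + 2) := by
  have hN0 : 0 < N := by linarith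
  have hx := hq.pow_nonneg x
  have hy := (hq.add (even_two)).pow_nonneg y
  have hx' := (hq.add (even_two)).pow_nonneg x
  rcases le_total (N * y ^ 2) (x ^ 2) with h | h
  · have : y ^ 2 ≤ x ^ 2 / N := by rw [le_div_iff₀ hN0]; linarith
    calc x ^ q * y ^ 2 ≤ x ^ q * (x ^ 2 / N) := mul_le_mul_of_nonneg_left this hx
      _ = x ^ (q + 2) / N := by ring
      _ ≤ _ := le_add_of_nonneg_right (by positivity)
  · have h1 : x ^ q ≤ N ^ (q / 2) * y ^ q := by
      have e : ∀ z : ℝ, z ^ q = (z ^ 2) ^ (q / 2) := fun z => by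
        rw [← pow_mul, Nat.mul_div_cancel' hq.two_dvd]
      rw [e x, e y, ← mul_pow]
      exact pow_le_pow_left₀ (sq_nonneg x) h _
    calc x ^ q * y ^ 2 ≤ N ^ (q / 2) * y ^ q * y ^ 2 :=
          mul_le_mul_of_nonneg_right h1 (sq_nonneg y)
      _ = N ^ (q / 2) * y ^ (q + 2) := by ring
      _ ≤ _ := le_add_of_nonneg_left (by positivity)

/-- Discrete Gronwall inequality. -/
lemma le_of_recurrence {u : ℕ → ℝ} {α β : ℝ} (hα : 0 ≤ α) (hβ : 0 ≤ β) (h0 : u 0 ≤ 0)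
    (h : ∀ k, u (k + 1) ≤ (1 + α) * u k + β) (k : ℕ) : u k ≤ k * β * (1 + α) ^ k := by
  induction k with
  | zero => simpa using h0
  | succ k ih =>
    have h1 : (1 : ℝ) ≤ (1 + α) ^ (k + 1) := one_le_pow₀ (by linarith)
    calc u (k + 1) ≤ (1 + α) * (k * β * (1 + α) ^ k) + β := (h k).trans (by gcongr)
      _ ≤ (1 + α) * (k * β * (1 + α) ^ k) + β * (1 + α) ^ (k + 1) := by nlinarith
      _ = _ := by push_cast; ring

section Moments

variable {Ω : Type*} {mΩ : MeasurableSpace Ω} {P : Measure Ω}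

lemma integrable_pow_mul_pow {p i j : ℕ} (hij : i + j = p) {X Y : Ω → ℝ}
    (hp : p ≠ 0) (hX : MemLp X p P) (hY : MemLp Y p P) :
    Integrable (fun ω => X ω ^ i * Y ω ^ j) P := by
  have hX' := hX.integrable_norm_pow hp
  have hY' := hY.integrable_norm_pow hp
  refine (hX'.add hY').mono' ?_ (ae_of_all _ fun ω => ?_)
  · exact (hX.aestronglyMeasurable.pow i).mul (hY.aestronglyMeasurable.pow j)
  · simp only [Pi.add_apply]
    rw [norm_mul, norm_pow, norm_pow]
    calc ‖X ω‖ ^ i * ‖Y ω‖ ^ j ≤ (max ‖X ω‖ ‖Y ω‖) ^ i * (max ‖X ω‖ ‖Y ω‖) ^ j := by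
          gcongr
          · exact le_max_left _ _
          · exact le_max_right _ _
      _ = (max ‖X ω‖ ‖Y ω‖) ^ p := by rw [← pow_add, hij]
      _ ≤ _ := by
          rcases max_cases ‖X ω‖ ‖Y ω‖ with hm | hm <;> rw [hm.1]
          · linarith [pow_nonneg (norm_nonneg (Y ω)) p]
          · linarith [pow_nonneg (norm_nonneg (X ω)) p]

/-- Adding one term multiplies the p-th moment of the running sum by at most 1 + 2^p/N and adds
O(N^{p/2-1}) L, because the linear term has mean zero. After N steps the factors are bounded by
exp(2^p) and the additions by O(N^{p/2}) L. -/
lemma integral_sum_pow_le {p : ℕ} (hp : Even p) (hp2 : 2 ≤ p) {D : ℕ → Ω → ℝ}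
    (hD : ∀ k, MemLp (D k) p P) {L : ℝ} (hL : ∀ k, ∫ ω, D k ω ^ p ∂P ≤ L)
    (orth : ∀ k, ∫ ω, (∑ i ∈ Finset.range k, D i ω) ^ (p - 1) * D k ω ∂P = 0) (N : ℕ) :
    ∫ ω, (∑ i ∈ Finset.range N, D i ω) ^ p ∂P ≤
      2 ^ (p + 1) * Real.exp (2 ^ p) * (N : ℝ) ^ (p / 2) * L := by
  have hp0 : p ≠ 0 := by omega
  have hq : Even (p - 2) := by rcases hp with ⟨k, hk⟩; exact ⟨k - 1, by omega⟩
  have hL0 : 0 ≤ L := (integral_nonneg fun ω => hp.pow_nonneg _).trans (hL 0)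
  rcases Nat.eq_zero_or_pos N with rfl | hN
  · simp [hp0, show p / 2 ≠ 0 by omega]
  have hN1 : (1 : ℝ) ≤ N := by exact_mod_cast hN
  have hM : ∀ k, MemLp (fun ω => ∑ i ∈ Finset.range k, D i ω) p P := fun k =>
    memLp_finsetSum _ fun i _ => hD i
  have step : ∀ k, ∫ ω, (∑ i ∈ Finset.range (k + 1), D i ω) ^ p ∂P ≤
      (1 + 2 ^ p / N) * ∫ ω, (∑ i ∈ Finset.range k, D i ω) ^ p ∂P +
        2 ^ (p + 1) * (N : ℝ) ^ (p / 2 - 1) * L := by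
    intro k
    set M : Ω → ℝ := fun ω => ∑ i ∈ Finset.range k, D i ω with hMdef
    have i1 : Integrable (fun ω => M ω ^ p) P := by
      simpa using integrable_pow_mul_pow (i := p) (j := 0) rfl hp0 (hM k) (hD k)
    have i2 : Integrable (fun ω => D k ω ^ p) P := by
      simpa using integrable_pow_mul_pow (i := 0) (j := p) (by omega) hp0 (hM k) (hD k)
    have i3 : Integrable (fun ω => M ω ^ (p - 1) * D k ω) P := by
      simpa using integrable_pow_mul_pow (i := p - 1) (j := 1) (by omega) hp0 (hM k) (hD k)
    have i5 : Integrable (fun ω => (∑ i ∈ Finset.range (k + 1), D i ω) ^ p) P := by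
      simpa using integrable_pow_mul_pow (i := p) (j := 0) rfl hp0 (hM (k + 1)) (hD k)
    have pw : ∀ ω, (∑ i ∈ Finset.range (k + 1), D i ω) ^ p ≤
        (1 + 2 ^ p / N) * M ω ^ p + p * (M ω ^ (p - 1) * D k ω) +
          2 ^ (p + 1) * (N : ℝ) ^ (p / 2 - 1) * D k ω ^ p := by
      intro ω
      rw [Finset.sum_range_succ]
      refine (add_pow_le_of_even hp hp2 _ _).trans ?_
      have h1 := pow_mul_sq_le hq (M ω) (D k ω) hN1
      rw [show p - 2 + 2 = p by omega, show (p - 2) / 2 = p / 2 - 1 by omega] at h1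
      have h2 : (1 : ℝ) ≤ (N : ℝ) ^ (p / 2 - 1) := one_le_pow₀ hN1
      have h3 := mul_le_mul_of_nonneg_right h2 (hp.pow_nonneg (D k ω))
      rw [one_mul] at h3
      have h4 : M ω ^ (p - 2) * D k ω ^ 2 + D k ω ^ p ≤
          M ω ^ p / N + 2 * ((N : ℝ) ^ (p / 2 - 1) * D k ω ^ p) := by linarith
      have h5 := mul_le_mul_of_nonneg_left h4 (show (0 : ℝ) ≤ 2 ^ p by positivity)
      calc _ ≤ M ω ^ p + p * (M ω ^ (p - 1) * D k ω) +
            2 ^ p * (M ω ^ p / N + 2 * ((N : ℝ) ^ (p / 2 - 1) * D k ω ^ p)) := by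
            linarith
        _ = _ := by ring
    have i4 : Integrable (fun ω => (1 + 2 ^ p / N) * M ω ^ p + p * (M ω ^ (p - 1) * D k ω)) P :=
      (i1.const_mul _).add (i3.const_mul _)
    calc _ ≤ ∫ ω, ((1 + 2 ^ p / N) * M ω ^ p + p * (M ω ^ (p - 1) * D k ω) +
          2 ^ (p + 1) * (N : ℝ) ^ (p / 2 - 1) * D k ω ^ p) ∂P :=
          integral_mono i5 (i4.add (i2.const_mul _)) pw
      _ = (1 + 2 ^ p / N) * ∫ ω, M ω ^ p ∂P + p * ∫ ω, M ω ^ (p - 1) * D k ω ∂P +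
          2 ^ (p + 1) * (N : ℝ) ^ (p / 2 - 1) * ∫ ω, D k ω ^ p ∂P := by
          rw [integral_add i4 (i2.const_mul _),
            integral_add (i1.const_mul _) (i3.const_mul _), integral_const_mul,
            integral_const_mul, integral_const_mul]
      _ ≤ _ := by
          rw [orth k, mul_zero, add_zero]
          gcongr
          exact hL k
  have hrec := le_of_recurrence (u := fun k => ∫ ω, (∑ i ∈ Finset.range k, D i ω) ^ p ∂P)
    (α := 2 ^ p / N) (β := 2 ^ (p + 1) * (N : ℝ) ^ (p / 2 - 1) * L) (by positivity) (by positivity)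
    (by simp [hp0]) step N
  have hexp : (1 + (2 : ℝ) ^ p / N) ^ N ≤ Real.exp (2 ^ p) := by
    calc (1 + (2 : ℝ) ^ p / N) ^ N ≤ (Real.exp (2 ^ p / N)) ^ N := by
          gcongr
          linarith [Real.add_one_le_exp ((2 : ℝ) ^ p / N)]
      _ = _ := by
          rw [← Real.exp_nat_mul, mul_div_cancel₀ _ (by positivity)]
  refine hrec.trans ?_
  calc (N : ℝ) * (2 ^ (p + 1) * (N : ℝ) ^ (p / 2 - 1) * L) * (1 + 2 ^ p / N) ^ N
      ≤ (N : ℝ) * (2 ^ (p + 1) * (N : ℝ) ^ (p / 2 - 1) * L) * Real.exp (2 ^ p) := by gcongr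
    _ = 2 ^ (p + 1) * Real.exp (2 ^ p) * ((N : ℝ) * (N : ℝ) ^ (p / 2 - 1)) * L := by ring
    _ = _ := by rw [← pow_succ', show p / 2 - 1 + 1 = p / 2 by omega]

/-- The norm form of `integral_sum_pow_le`. -/
lemma eLpNorm_sum_le_of_orthogonal {p : ℕ} (hp : Even p) (hp2 : 2 ≤ p) {D : ℕ → Ω → ℝ}
    (hD : ∀ k, MemLp (D k) p P) {L : ℝ} (hL0 : 0 ≤ L)
    (hL : ∀ k, eLpNorm (D k) p P ≤ ENNReal.ofReal L)
    (orth : ∀ k, ∫ ω, (∑ i ∈ Finset.range k, D i ω) ^ (p - 1) * D k ω ∂P = 0) (N : ℕ) :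
    eLpNorm (fun ω => ∑ i ∈ Finset.range N, D i ω) p P ≤
      ENNReal.ofReal ((2 ^ (p + 1) * Real.exp (2 ^ p)) * (√N * L)) := by
  have hp0 : p ≠ 0 := by omega
  have hpE : (p : ℝ≥0∞) ≠ 0 := by exact_mod_cast hp0
  have toInt : ∀ (f : Ω → ℝ), MemLp f p P → ∀ c, 0 ≤ c →
      (eLpNorm f p P ≤ ENNReal.ofReal c ↔ ∫ ω, f ω ^ p ∂P ≤ c ^ p) := by
    intro f hf c hc
    rw [hf.eLpNorm_eq_integral_rpow_norm hpE (ENNReal.natCast_ne_top p),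
      ENNReal.ofReal_le_ofReal_iff hc]
    have e : ∫ ω, ‖f ω‖ ^ (p : ℝ≥0∞).toReal ∂P = ∫ ω, f ω ^ p ∂P := by
      refine integral_congr_ae (ae_of_all _ fun ω => ?_)
      simp only [ENNReal.toReal_natCast, Real.rpow_natCast, Real.norm_eq_abs, hp.pow_abs]
    rw [e, ENNReal.toReal_natCast,
      Real.rpow_inv_le_iff_of_pos (integral_nonneg fun ω => hp.pow_nonneg _) hc (by positivity),
      Real.rpow_natCast]
  have hM : MemLp (fun ω => ∑ i ∈ Finset.range N, D i ω) p P :=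
    memLp_finsetSum _ fun i _ => hD i
  rw [toInt _ hM _ (by positivity)]
  refine (integral_sum_pow_le hp hp2 hD (fun k => (toInt _ (hD k) L hL0).1 (hL k)) orth N).trans ?_
  have h1 : (√N) ^ p = (N : ℝ) ^ (p / 2) := by
    conv_lhs => rw [← Nat.mul_div_cancel' hp.two_dvd, pow_mul, Real.sq_sqrt (Nat.cast_nonneg N)]
  -- The constant is at least one, hence at most its own p-th power, so no p-th root of it is
  -- needed.
  have h2 : (1 : ℝ) ≤ 2 ^ (p + 1) * Real.exp (2 ^ p) :=
    one_le_mul_of_one_le_of_one_le (one_le_pow₀ (by norm_num))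
      (Real.one_le_exp (by positivity))
  rw [mul_pow _ (√N * L), mul_pow (√N), h1, mul_assoc _ _ (L ^ p)]
  exact mul_le_mul_of_nonneg_right (le_self_pow₀ h2 hp0) (by positivity)

end Moments

/-! ### Conditional expectations under `φ`-mixing -/

section Mixing

variable {Ω : Type*} {F G mΩ : MeasurableSpace Ω} {P : Measure Ω} {φ : ℝ}

/-- The `φ`-mixing coefficient of `F` and `G` is at most `φ`. -/
def PhiBound (F G : MeasurableSpace Ω) {mΩ : MeasurableSpace Ω} (P : Measure Ω) (φ : ℝ) : Prop :=
  ∀ A B, MeasurableSet[F] A → MeasurableSet[G] B →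
    |P.real (A ∩ B) - P.real A * P.real B| ≤ φ * P.real A

lemma PhiBound.mono {F' G' : MeasurableSpace Ω} {φ' : ℝ} (h : PhiBound F G P φ) (hF : F' ≤ F)
    (hG : G' ≤ G) (hφ : φ ≤ φ') : PhiBound F' G' P φ' := fun A B hA hB =>
  (h A B (hF A hA) (hG B hB)).trans (mul_le_mul_of_nonneg_right hφ measureReal_nonneg)

variable [IsProbabilityMeasure P]

/-- Integrated over any set A of F, the deviation is the mixing defect of A and B, hence at most φ
P(A); comparison of integrals over all sets of F yields the almost sure bound. -/
lemma PhiBound.abs_condExp_indicator_sub_le (h : PhiBound F G P φ) (hF : F ≤ mΩ) (hG : G ≤ mΩ)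
    {B : Set Ω} (hB : MeasurableSet[G] B) :
    ∀ᵐ ω ∂P, |P[B.indicator (fun _ => (1 : ℝ)) | F] ω - P.real B| ≤ φ := by
  have hBm : MeasurableSet B := hG B hB
  have hint : Integrable (B.indicator fun _ => (1 : ℝ)) P := (integrable_const 1).indicator hBm
  have hf : Integrable (P[B.indicator (fun _ => (1 : ℝ)) | F]) (P.trim hF) :=
    integrable_condExp.trim hF stronglyMeasurable_condExp
  have val : ∀ A, MeasurableSet[F] A →
      ∫ ω in A, P[B.indicator (fun _ => (1 : ℝ)) | F] ω ∂(P.trim hF) = P.real (A ∩ B) := by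
    intro A hA
    rw [← setIntegral_trim hF stronglyMeasurable_condExp hA, setIntegral_condExp hF hint hA,
      integral_indicator hBm, Measure.restrict_restrict hBm, setIntegral_const, smul_eq_mul,
      mul_one, Set.inter_comm]
  have cst : ∀ (A : Set Ω) (c : ℝ), MeasurableSet[F] A →
      ∫ _ in A, c ∂(P.trim hF) = P.real A * c := by
    intro A c hA
    rw [setIntegral_const, smul_eq_mul, measureReal_def, trim_measurableSet_eq hF hA,
      measureReal_def]
  have up : P[B.indicator (fun _ => (1 : ℝ)) | F] ≤ᵐ[P.trim hF] fun _ => P.real B + φ := by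
    refine ae_le_of_forall_setIntegral_le hf (integrable_const _) fun A hA _ => ?_
    rw [val A hA, cst A _ hA]
    have := (abs_le.1 (h A B hA hB)).2
    linarith
  have lo : (fun _ => P.real B - φ) ≤ᵐ[P.trim hF] P[B.indicator (fun _ => (1 : ℝ)) | F] := by
    refine ae_le_of_forall_setIntegral_le (integrable_const _) hf fun A hA _ => ?_
    rw [val A hA, cst A _ hA]
    have := (abs_le.1 (h A B hA hB)).1
    linarith
  filter_upwards [ae_le_of_ae_le_trim up, ae_le_of_ae_le_trim lo] with ω h1 h2
  rw [abs_le]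
  constructor <;> linarith

/-- The positive and the negative terms are two subfamilies, each with sum at most φ in absolute
value. -/
lemma sum_abs_le_of_forall_abs_sum_le {ι : Type*} {s : Finset ι} {d : ι → ℝ}
    (h : ∀ u ⊆ s, |∑ i ∈ u, d i| ≤ φ) : ∑ i ∈ s, |d i| ≤ 2 * φ := by
  have h1 := (abs_le.1 (h _ (Finset.filter_subset (fun i => 0 ≤ d i) s))).2
  have h2 := (abs_le.1 (h _ (Finset.filter_subset (fun i => ¬ 0 ≤ d i) s))).1
  rw [← Finset.sum_filter_add_sum_filter_not s (fun i => 0 ≤ d i) (fun i => |d i|),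
    Finset.sum_congr rfl fun i hi => abs_of_nonneg (Finset.mem_filter.1 hi).2,
    Finset.sum_congr (s₁ := s.filter fun i => ¬ 0 ≤ d i) rfl
      fun i hi => abs_of_neg (not_le.1 (Finset.mem_filter.1 hi).2), Finset.sum_neg_distrib]
  linarith

/-- Hölder's inequality with the weights |d i|. -/
lemma abs_sum_mul_pow_le {ι : Type*} (s : Finset ι) {p : ℕ} (hp : p ≠ 0) (d y : ι → ℝ) :
    |∑ i ∈ s, d i * y i| ^ p ≤ (∑ i ∈ s, |d i|) ^ (p - 1) * ∑ i ∈ s, |d i| * |y i| ^ p := by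
  have hp1 : (1 : ℝ) ≤ p := by exact_mod_cast Nat.one_le_iff_ne_zero.2 hp
  have hp0 : (0 : ℝ) < p := by linarith
  have h1 := Real.inner_le_weight_mul_Lp_of_nonneg s hp1 (fun i => |d i|) (fun i => |y i|)
    (fun i => abs_nonneg _) (fun i => abs_nonneg _)
  have h2 : |∑ i ∈ s, d i * y i| ≤ ∑ i ∈ s, |d i| * |y i| :=
    (Finset.abs_sum_le_sum_abs _ _).trans (le_of_eq (Finset.sum_congr rfl fun i _ => abs_mul _ _))
  have hw : 0 ≤ ∑ i ∈ s, |d i| := Finset.sum_nonneg fun i _ => abs_nonneg _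
  have hz : 0 ≤ ∑ i ∈ s, |d i| * |y i| ^ (p : ℝ) := Finset.sum_nonneg fun i _ => by positivity
  calc |∑ i ∈ s, d i * y i| ^ p ≤ ((∑ i ∈ s, |d i|) ^ (1 - (p : ℝ)⁻¹) *
        (∑ i ∈ s, |d i| * |y i| ^ (p : ℝ)) ^ (p : ℝ)⁻¹) ^ p :=
        pow_le_pow_left₀ (abs_nonneg _) (h2.trans h1) p
    _ = _ := by
        rw [mul_pow, ← Real.rpow_mul_natCast hw, ← Real.rpow_mul_natCast hz,
          inv_mul_cancel₀ hp0.ne', Real.rpow_one, sub_mul, inv_mul_cancel₀ hp0.ne', one_mul]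
        congr 1
        · rw [← Nat.cast_pred (Nat.pos_of_ne_zero hp), Real.rpow_natCast]
        · exact Finset.sum_congr rfl fun i _ => by rw [Real.rpow_natCast]

/-- With d_y = P(X = y | F) - P(X = y), the difference is ∑ y d_y. Every partial sum of the d_y is
the conditional deviation of an event of G, so ∑ |d_y| ≤ 2φ almost surely. Hölder with these weights
and |d_y| ≤ P(X = y | F) + P(X = y) give the bound (2φ)^{p-1} · 2 E|X|^p. Finite range keeps the
exceptional null sets finite in number. -/
lemma PhiBound.integral_condExp_finite_range_le (h : PhiBound F G P φ) (hF : F ≤ mΩ) (hG : G ≤ mΩ)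
    (hφ0 : 0 ≤ φ) (hφ1 : φ ≤ 1) {p : ℕ} (hp : 2 ≤ p) {X : Ω → ℝ} (hXm : Measurable[G] X)
    {R : Finset ℝ} (hR : ∀ ω, X ω ∈ R) :
    ∫ ω, |P[X | F] ω - ∫ ω', X ω' ∂P| ^ p ∂P ≤ 2 ^ p * φ * ∫ ω, |X ω| ^ p ∂P := by
  classical
  set T : ℝ → Set Ω := fun y => X ⁻¹' {y}
  have hI : ∀ y, MeasurableSet[G] (T y) := fun y => hXm (measurableSet_singleton y)
  have hIm : ∀ y, MeasurableSet (T y) := fun y => hG _ (hI y)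
  set g : ℝ → Ω → ℝ := fun y => P[(T y).indicator (fun _ => (1 : ℝ)) | F]
  set d : ℝ → Ω → ℝ := fun y ω => g y ω - P.real (T y)
  have hind : ∀ y, Integrable ((T y).indicator fun _ => (1 : ℝ)) P := fun y =>
    (integrable_const 1).indicator (hIm y)
  have repr : ∀ (f : ℝ → ℝ) (ω : Ω),
      f (X ω) = ∑ y ∈ R, f y * (T y).indicator (fun _ => (1 : ℝ)) ω := by
    intro f ω
    rw [Finset.sum_eq_single (X ω)]
    · simp [T]
    · intro y _ hy
      rw [Set.indicator_of_notMem (by simpa [T] using hy.symm), mul_zero]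
    · intro hn
      exact absurd (hR ω) hn
  have hint : ∀ f : ℝ → ℝ, ∫ ω, f (X ω) ∂P = ∑ y ∈ R, f y * P.real (T y) := by
    intro f
    simp_rw [repr f]
    rw [integral_finsetSum _ fun y _ => (hind y).const_mul _]
    refine Finset.sum_congr rfl fun y _ => ?_
    rw [integral_const_mul, integral_indicator (hIm y), setIntegral_const, smul_eq_mul, mul_one]
  have hcond : ∀ f : ℝ → ℝ, P[fun ω => f (X ω) | F] =ᵐ[P]
      fun ω => ∑ y ∈ R, f y * g y ω := by
    intro f
    have e : (fun ω => f (X ω)) =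
        ∑ y ∈ R, f y • (T y).indicator (fun _ => (1 : ℝ)) := by
      ext ω
      rw [repr f]; simp
    rw [e]
    refine (condExp_finsetSum (fun y _ => (hind y).smul (f y)) F).trans ?_
    have : ∀ y, P[f y • (T y).indicator (fun _ => (1 : ℝ)) | F] =ᵐ[P] f y • g y := fun y =>
      condExp_smul _ _ _
    filter_upwards [(ae_ball_iff (R.countable_toSet)).2 fun y _ => this y] with ω hω
    rw [Finset.sum_apply]
    exact Finset.sum_congr rfl fun y hy => by rw [hω y hy]; simp
  have hX : P[X | F] =ᵐ[P] fun ω => ∑ y ∈ R, y * g y ω := hcond id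
  -- the deviations are small in total
  have hsub : ∀ᵐ ω ∂P, ∀ u ∈ R.powerset, |∑ y ∈ u, d y ω| ≤ φ := by
    refine (ae_ball_iff (R.powerset.countable_toSet)).2 fun u hu => ?_
    have hu : u ⊆ R := Finset.mem_powerset.1 hu
    set B : Set Ω := X ⁻¹' (u : Set ℝ)
    have hB : MeasurableSet[G] B := hXm u.measurableSet
    have hBi : B.indicator (fun _ => (1 : ℝ)) = fun ω => (fun y => if y ∈ u then (1 : ℝ) else 0) (X ω) := by
      ext ω
      by_cases hω : X ω ∈ u
      · rw [Set.indicator_of_mem (by simpa [B] using hω)]; simp [hω]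
      · rw [Set.indicator_of_notMem (by simpa [B] using hω)]; simp [hω]
    have h1 := hcond (fun y => if y ∈ u then (1 : ℝ) else 0)
    have h2 := hint (fun y => if y ∈ u then (1 : ℝ) else 0)
    rw [← hBi] at h1
    have h3 : P.real B = ∫ ω, (fun y => if y ∈ u then (1 : ℝ) else 0) (X ω) ∂P := by
      rw [← hBi, integral_indicator (hG _ hB), setIntegral_const, smul_eq_mul, mul_one]
    filter_upwards [h1, h.abs_condExp_indicator_sub_le hF hG hB] with ω e1 e2
    rw [e1, h3, h2, ← Finset.sum_sub_distrib] at e2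
    convert e2 using 2
    rw [← Finset.sum_filter_add_sum_filter_not R (fun y => y ∈ u)]
    rw [Finset.sum_eq_zero (s := R.filter fun y => ¬ y ∈ u) fun y hy => by
      simp [(Finset.mem_filter.1 hy).2], add_zero]
    refine Finset.sum_congr ?_ fun y hy => by simp [(Finset.mem_filter.1 hy).2, d]
    ext y
    simp only [Finset.mem_filter]
    exact ⟨fun hy => ⟨hu hy, hy⟩, fun hy => hy.2⟩
  have hg0 : ∀ᵐ ω ∂P, ∀ y ∈ R, 0 ≤ g y ω := by
    refine (ae_ball_iff (R.countable_toSet)).2 fun y _ => ?_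
    exact condExp_nonneg (ae_of_all _ fun ω => Set.indicator_nonneg (fun _ _ => zero_le_one) ω)
  have hgi : ∀ y, Integrable (g y) P := fun y => integrable_condExp
  have hgint : ∀ y, ∫ ω, g y ω ∂P = P.real (T y) := fun y => by
    rw [integral_condExp hF, integral_indicator (hIm y), setIntegral_const, smul_eq_mul, mul_one]
  have hgi2 : ∀ y, Integrable (fun ω => |y| ^ p * (g y ω + P.real (T y))) P := fun y =>
    ((hgi y).add (integrable_const _)).const_mul _
  have hint2 : Integrable (fun ω => (2 * φ) ^ (p - 1) *
      ∑ y ∈ R, |y| ^ p * (g y ω + P.real (T y))) P :=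
    (integrable_finsetSum _ fun y _ => hgi2 y).const_mul _
  have pw : ∀ᵐ ω ∂P, |P[X | F] ω - ∫ ω', X ω' ∂P| ^ p ≤ (2 * φ) ^ (p - 1) *
      ∑ y ∈ R, |y| ^ p * (g y ω + P.real (T y)) := by
    filter_upwards [hX, hsub, hg0] with ω e1 e2 e3
    have e4 : P[X | F] ω - ∫ ω', X ω' ∂P = ∑ y ∈ R, d y ω * y := by
      rw [e1, show ∫ ω', X ω' ∂P = ∑ y ∈ R, y * P.real (T y) from hint id,
        ← Finset.sum_sub_distrib]
      exact Finset.sum_congr rfl fun y _ => by simp only [d]; ring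
    have e5 := sum_abs_le_of_forall_abs_sum_le (s := R) (d := fun y => d y ω)
      fun u hu => e2 u (Finset.mem_powerset.2 hu)
    rw [e4]
    refine (abs_sum_mul_pow_le R (by omega) (fun y => d y ω) fun y => y).trans ?_
    have e6 : ∑ y ∈ R, |d y ω| * |y| ^ p ≤
        ∑ y ∈ R, |y| ^ p * (g y ω + P.real (T y)) := by
      refine Finset.sum_le_sum fun y hy => ?_
      rw [mul_comm]
      refine mul_le_mul_of_nonneg_left ?_ (by positivity)
      have := e3 y hy
      have h0 : 0 ≤ P.real (T y) := measureReal_nonneg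
      simp only [d]
      rw [abs_le]; constructor <;> linarith
    refine mul_le_mul ?_ e6 (Finset.sum_nonneg fun y _ => by positivity) (by positivity)
    exact pow_le_pow_left₀ (Finset.sum_nonneg fun y _ => abs_nonneg _) e5 _
  calc _ ≤ ∫ ω, (2 * φ) ^ (p - 1) * ∑ y ∈ R, |y| ^ p * (g y ω + P.real (T y)) ∂P :=
        integral_mono_of_nonneg (ae_of_all _ fun ω => by positivity) hint2 pw
    _ = (2 * φ) ^ (p - 1) * (2 * ∫ ω, |X ω| ^ p ∂P) := by
        rw [integral_const_mul, integral_finsetSum _ fun y _ => hgi2 y, hint fun y => |y| ^ p]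
        congr 1
        rw [Finset.mul_sum]
        refine Finset.sum_congr rfl fun y _ => ?_
        rw [integral_const_mul (|y| ^ p), integral_add (hgi y) (integrable_const _), hgint]
        simp only [integral_const, probReal_univ, smul_eq_mul]
        ring
    _ ≤ _ := by
        -- The exponent p-1 is weakened to 1, which is enough because the summability assumption
        -- concerns φ^{1/p}.
        have h1 : φ ^ (p - 1) ≤ φ := by
          calc φ ^ (p - 1) ≤ φ ^ 1 := pow_le_pow_of_le_one hφ0 hφ1 (by omega)
            _ = φ := pow_one φ
        have h2 : 0 ≤ ∫ ω, |X ω| ^ p ∂P := integral_nonneg fun ω => by positivity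
        obtain ⟨q, rfl⟩ : ∃ q, p = q + 1 := ⟨p - 1, by omega⟩
        simp only [Nat.add_sub_cancel] at h1 ⊢
        rw [mul_pow]
        calc 2 ^ q * φ ^ q * (2 * ∫ ω, |X ω| ^ (q + 1) ∂P)
            = 2 ^ (q + 1) * φ ^ q * ∫ ω, |X ω| ^ (q + 1) ∂P := by ring
          _ ≤ _ := by gcongr

end Mixing

/-! ### Moment inequalities for mixing variables in L^p -/

section Mixing

variable {Ω : Type*} {F G mΩ : MeasurableSpace Ω} {P : Measure Ω} {φ : ℝ} [IsProbabilityMeasure P]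

omit [IsProbabilityMeasure P] in
lemma _root_.MeasureTheory.MemLp.exists_finite_range_approx {p : ℕ} {X : Ω → ℝ}
    (hX : MemLp X p P) {θ : ℝ≥0∞} (hθ : θ ≠ 0) :
    ∃ (Y : Ω → ℝ) (R : Finset ℝ), Measurable Y ∧ (∀ ω, Y ω ∈ R) ∧ MemLp Y p P ∧
      eLpNorm (X - Y) p P < θ := by
  obtain ⟨Y, hY, hYmem⟩ := hX.exists_simpleFunc_eLpNorm_sub_lt (ENNReal.natCast_ne_top p) hθ
  exact ⟨Y, Y.range, Y.measurable, Y.mem_range_self, hYmem, hY⟩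

omit [IsProbabilityMeasure P] in
lemma eLpNorm_le_ofReal_mul {p : ℕ} (hp : p ≠ 0) {X Y : Ω → ℝ} (hX : MemLp X p P)
    (hY : MemLp Y p P) {c : ℝ} (hc : 0 ≤ c)
    (h : ∫ ω, |X ω| ^ p ∂P ≤ c ^ p * ∫ ω, |Y ω| ^ p ∂P) :
    eLpNorm X p P ≤ ENNReal.ofReal c * eLpNorm Y p P := by
  have hpE : (p : ℝ≥0∞) ≠ 0 := by exact_mod_cast hp
  rw [hX.eLpNorm_eq_integral_rpow_norm hpE (ENNReal.natCast_ne_top p),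
    hY.eLpNorm_eq_integral_rpow_norm hpE (ENNReal.natCast_ne_top p), ← ENNReal.ofReal_mul hc]
  refine ENNReal.ofReal_le_ofReal ?_
  simp only [ENNReal.toReal_natCast, Real.rpow_natCast, Real.norm_eq_abs]
  have hYn : 0 ≤ ∫ ω, |Y ω| ^ p ∂P := integral_nonneg fun ω => by positivity
  have hXn : 0 ≤ ∫ ω, |X ω| ^ p ∂P := integral_nonneg fun ω => by positivity
  calc (∫ ω, |X ω| ^ p ∂P) ^ ((p : ℝ)⁻¹) ≤ (c ^ p * ∫ ω, |Y ω| ^ p ∂P) ^ ((p : ℝ)⁻¹) :=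
        Real.rpow_le_rpow hXn h (by positivity)
    _ = _ := by
        rw [Real.mul_rpow (by positivity) hYn, Real.pow_rpow_inv_natCast hc hp]

/-- Conditional expectations of `φ`-mixing variables are close to constant. -/
lemma PhiBound.eLpNorm_condExp_sub_le (h : PhiBound F G P φ) (hF : F ≤ mΩ) (hG : G ≤ mΩ)
    (hφ0 : 0 ≤ φ) (hφ1 : φ ≤ 1) {p : ℕ} (hp : 2 ≤ p) {X : Ω → ℝ} (hXm : Measurable[G] X)
    (hX : MemLp X p P) :
    eLpNorm (fun ω => P[X | F] ω - ∫ ω', X ω' ∂P) p P ≤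
      ENNReal.ofReal (2 * φ ^ (1 / (p : ℝ))) * eLpNorm X p P := by
  have hp0 : p ≠ 0 := by omega
  have hp1 : (1 : ℝ≥0∞) ≤ p := by exact_mod_cast (show 1 ≤ p by omega)
  set c : ℝ := 2 * φ ^ (1 / (p : ℝ)) with hc
  have hc0 : 0 ≤ c := by positivity
  have hcp : c ^ p = 2 ^ p * φ := by
    rw [hc, mul_pow, ← Real.rpow_natCast (φ ^ _), ← Real.rpow_mul hφ0, one_div,
      inv_mul_cancel₀ (by exact_mod_cast hp0), Real.rpow_one]
  -- the linear operator
  set T : (Ω → ℝ) → Ω → ℝ := fun Y ω => P[Y | F] ω - ∫ ω', Y ω' ∂P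
  have hT : ∀ Y, MemLp Y p P → MemLp (T Y) p P := fun Y hY =>
    (hY.condExp hp1).sub (memLp_const _)
  have hTle : ∀ Y, MemLp Y p P → eLpNorm (T Y) p P ≤ 2 * eLpNorm Y p P := by
    intro Y hY
    have h1 : eLpNorm (fun _ : Ω => ∫ ω', Y ω' ∂P) p P ≤ eLpNorm Y p P := by
      rw [← condExp_bot (μ := P) Y]
      exact eLpNorm_condExp_le_eLpNorm Y hp1
    calc eLpNorm (T Y) p P ≤ eLpNorm (P[Y | F]) p P + eLpNorm (fun _ : Ω => ∫ ω', Y ω' ∂P) p P :=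
          eLpNorm_sub_le (hY.condExp hp1).1 aestronglyMeasurable_const hp1
      _ ≤ eLpNorm Y p P + eLpNorm Y p P :=
          add_le_add (eLpNorm_condExp_le_eLpNorm Y hp1) h1
      _ = _ := (two_mul _).symm
  have hTsub : ∀ Y Z, MemLp Y p P → MemLp Z p P → T Y =ᵐ[P] T Z + T (Y - Z) := by
    intro Y Z hY hZ
    have iY := hY.integrable hp1
    have iZ := hZ.integrable hp1
    filter_upwards [condExp_sub iY iZ F] with ω hω
    simp only [T, Pi.add_apply]
    rw [hω, integral_sub' iY iZ]
    simp only [Pi.sub_apply]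
    ring
  refine ENNReal.le_of_forall_pos_le_add fun δ hδ _ => ?_
  have hXs : StronglyMeasurable[G] X := hXm.stronglyMeasurable
  -- Approximating with respect to the trimmed measure produces finite-range functions that are
  -- measurable for G, as the mixing bound requires.
  have hX' : MemLp X p (P.trim hG) :=
    ⟨hXs.aestronglyMeasurable, by rw [eLpNorm_trim hG hXs]; exact hX.2⟩
  set θ : ℝ≥0∞ := δ / (ENNReal.ofReal c + 2) with hθ
  have hθ0 : θ ≠ 0 := by
    rw [hθ]
    exact (ENNReal.div_pos (by exact_mod_cast hδ.ne') (by finiteness)).ne'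
  obtain ⟨Y, R, hYm, hYR, hYmem, hY⟩ := hX'.exists_finite_range_approx hθ0
  have hYs : StronglyMeasurable[G] Y := hYm.stronglyMeasurable
  have hYP : MemLp Y p P := by
    refine ⟨(hYs.mono hG).aestronglyMeasurable, ?_⟩
    rw [← eLpNorm_trim hG hYs]
    exact hYmem.2
  rw [eLpNorm_trim hG (hXs.sub hYs)] at hY
  have hsimple : eLpNorm (T Y) p P ≤ ENNReal.ofReal c * eLpNorm Y p P := by
    refine eLpNorm_le_ofReal_mul hp0 (hT _ hYP) hYP hc0 ?_
    rw [hcp]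
    exact h.integral_condExp_finite_range_le hF hG hφ0 hφ1 hp hYm hYR
  have hYX : eLpNorm Y p P ≤ eLpNorm X p P + θ := by
    have : Y = X - (X - Y) := by abel
    calc eLpNorm Y p P = eLpNorm (X - (X - Y)) p P := by rw [← this]
      _ ≤ eLpNorm X p P + eLpNorm (X - Y) p P := eLpNorm_sub_le hX.1 (hX.sub hYP).1 hp1
      _ ≤ _ := by gcongr
  calc eLpNorm (T X) p P = eLpNorm (T Y + T (X - Y)) p P := eLpNorm_congr_ae (hTsub X Y hX hYP)
    _ ≤ eLpNorm (T Y) p P + eLpNorm (T (X - Y)) p P :=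
        eLpNorm_add_le (hT _ hYP).1 (hT _ (hX.sub hYP)).1 hp1
    _ ≤ ENNReal.ofReal c * (eLpNorm X p P + θ) + 2 * θ := by
        refine add_le_add (hsimple.trans (by gcongr)) ((hTle _ (hX.sub hYP)).trans (by gcongr))
    _ = ENNReal.ofReal c * eLpNorm X p P + (ENNReal.ofReal c + 2) * θ := by ring
    _ = _ := by
        rw [hθ, ENNReal.mul_div_cancel (by simp) (by finiteness)]

/-- Moment inequality for partial sums of centred `φ`-mixing variables. -/
lemma eLpNorm_sum_le_of_mixing {p : ℕ} (hp : Even p) (hp2 : 2 ≤ p) {X : ℕ → Ω → ℝ}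
    {𝓕 𝓖 : ℕ → MeasurableSpace Ω} (h𝓕 : ∀ k, 𝓕 k ≤ mΩ) (h𝓖 : ∀ k, 𝓖 k ≤ mΩ) (hmono : Monotone 𝓕)
    (hbot : 𝓕 0 = ⊥) {φ : ℕ → ℝ} (hφ0 : ∀ k, 0 ≤ φ k) (hφ1 : ∀ k, φ k ≤ 1)
    (hmix : ∀ i k, PhiBound (𝓕 (k + 1 - i)) (𝓖 k) P (φ i) ∨ k < i)
    (hX𝓕 : ∀ k, Measurable[𝓕 (k + 1)] (X k)) (hX𝓖 : ∀ k, Measurable[𝓖 k] (X k))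
    (hX : ∀ k, MemLp (X k) p P) (h0 : ∀ k, ∫ ω, X k ω ∂P = 0)
    {L : ℝ} (hL0 : 0 ≤ L) (hL : ∀ k, eLpNorm (X k) p P ≤ ENNReal.ofReal L)
    {Φ : ℝ} (hΦ : ∀ N, ∑ i ∈ Finset.range N, φ i ^ (1 / (p : ℝ)) ≤ Φ) (N : ℕ) :
    eLpNorm (fun ω => ∑ k ∈ Finset.range N, X k ω) p P ≤
      ENNReal.ofReal ((2 ^ (p + 1) * Real.exp (2 ^ p)) * (√N * L) * (4 * Φ)) := by
  have hp0 : p ≠ 0 := by omega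
  have hp1 : (1 : ℝ≥0∞) ≤ p := by exact_mod_cast (show 1 ≤ p by omega)
  set A : ℝ := 2 ^ (p + 1) * Real.exp (2 ^ p) with hA
  have hA0 : 0 ≤ A := by positivity
  set E : ℕ → ℕ → Ω → ℝ := fun k i => P[X k | 𝓕 (k + 1 - i)] with hE
  have hEmem : ∀ k i, MemLp (E k i) p P := fun k i => (hX k).condExp hp1
  have hEle : ∀ k i, eLpNorm (E k i) p P ≤ ENNReal.ofReal (2 * φ i ^ (1 / (p : ℝ)) * L) := by
    intro k i
    rcases hmix i k with hm | hki
    · have := hm.eLpNorm_condExp_sub_le (h𝓕 _) (h𝓖 k) (hφ0 i) (hφ1 i) hp2 (hX𝓖 k) (hX k)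
      simp only [h0 k, sub_zero] at this
      refine this.trans ?_
      rw [ENNReal.ofReal_mul (q := L) (by have := hφ0 i; positivity)]
      exact mul_le_mul' le_rfl (hL k)
    -- For i > k the truncated index k + 1 - i is 0, where the filtration is trivial; conditioning
    -- then gives the expectation, which is zero.
    · have : E k i = 0 := by
        simp only [hE, show k + 1 - i = 0 by omega, hbot]
        rw [condExp_bot, h0 k]; rfl
      rw [this]; simp
  -- Telescoping in i writes X k as the sum of the D i k. For fixed i the sequence k ↦ D i k
  -- consists of martingale differences for the filtration shifted by i, with norms governed by φ i
  -- and φ (i + 1), so each of these sums obeys the martingale bound and the bounds are summable in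
  -- i.
  set D : ℕ → ℕ → Ω → ℝ := fun i k => E k i - E k (i + 1) with hD
  have hDmem : ∀ i k, MemLp (D i k) p P := fun i k => (hEmem k i).sub (hEmem k (i + 1))
  have hDm : ∀ i k, StronglyMeasurable[𝓕 (k + 1 - i)] (D i k) := fun i k =>
    stronglyMeasurable_condExp.sub
      (stronglyMeasurable_condExp.mono (hmono (by omega)))
  have hDle : ∀ i k, eLpNorm (D i k) p P ≤
      ENNReal.ofReal (2 * (φ i ^ (1 / (p : ℝ)) + φ (i + 1) ^ (1 / (p : ℝ))) * L) := by
    intro i k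
    have e0 := hφ0 i
    have e1 := hφ0 (i + 1)
    refine (eLpNorm_sub_le (hEmem k i).1 (hEmem k (i + 1)).1 hp1).trans
      ((add_le_add (hEle k i) (hEle k (i + 1))).trans (le_of_eq ?_))
    rw [← ENNReal.ofReal_add (by positivity) (by positivity)]
    congr 1; ring
  have horth : ∀ i k, ∫ ω, (∑ l ∈ Finset.range k, D i l ω) ^ (p - 1) * D i k ω ∂P = 0 := by
    intro i k
    set M : Ω → ℝ := fun ω => (∑ l ∈ Finset.range k, D i l ω) ^ (p - 1) with hM
    have hMm : StronglyMeasurable[𝓕 (k + 1 - (i + 1))] M := by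
      refine StronglyMeasurable.pow (Finset.stronglyMeasurable_fun_sum _ fun l hl => ?_) _
      rw [Finset.mem_range] at hl
      exact (hDm i l).mono (hmono (by omega))
    have hsum : MemLp (fun ω => ∑ l ∈ Finset.range k, D i l ω) p P :=
      memLp_finsetSum _ fun l _ => hDmem i l
    have hMD : Integrable (fun ω => M ω * D i k ω) P := by
      simpa using integrable_pow_mul_pow (i := p - 1) (j := 1) (by omega) hp0 hsum (hDmem i k)
    have hDint : Integrable (D i k) P := (hDmem i k).integrable hp1
    have hz : P[D i k | 𝓕 (k + 1 - (i + 1))] =ᵐ[P] 0 := by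
      have t1 := condExp_sub ((hEmem k i).integrable hp1) ((hEmem k (i + 1)).integrable hp1)
        (𝓕 (k + 1 - (i + 1)))
      have t2 : P[E k i | 𝓕 (k + 1 - (i + 1))] =ᵐ[P] E k (i + 1) :=
        condExp_condExp_of_le (hmono (by omega)) (h𝓕 _)
      have t3 : P[E k (i + 1) | 𝓕 (k + 1 - (i + 1))] = E k (i + 1) :=
        condExp_of_stronglyMeasurable (h𝓕 _) stronglyMeasurable_condExp integrable_condExp
      rw [t3] at t1
      filter_upwards [t1, t2] with ω s1 s2
      rw [s1, Pi.sub_apply, s2]; simp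
    rw [← integral_condExp (h𝓕 (k + 1 - (i + 1)))]
    have := condExp_mul_of_stronglyMeasurable_left (μ := P) hMm hMD hDint
    rw [integral_congr_ae (g := fun _ => (0 : ℝ))]
    · simp
    · filter_upwards [this, hz] with ω s1 s2
      change P[M * D i k | _] ω = 0
      rw [s1, Pi.mul_apply, s2]; simp
  have hmart : ∀ i, eLpNorm (fun ω => ∑ k ∈ Finset.range N, D i k ω) p P ≤ ENNReal.ofReal
      (A * (√N * (2 * (φ i ^ (1 / (p : ℝ)) + φ (i + 1) ^ (1 / (p : ℝ))) * L))) := fun i => by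
    have e0 := hφ0 i
    have e1 := hφ0 (i + 1)
    exact eLpNorm_sum_le_of_orthogonal hp hp2 (hDmem i) (by positivity) (hDle i) (horth i) N
  have hdecomp : (fun ω => ∑ k ∈ Finset.range N, X k ω) =
      ∑ i ∈ Finset.range N, fun ω => ∑ k ∈ Finset.range N, D i k ω := by
    ext ω
    rw [Finset.sum_apply, Finset.sum_comm]
    refine Finset.sum_congr rfl fun k hk => ?_
    have hk := Finset.mem_range.1 hk
    have e : ∑ i ∈ Finset.range N, D i k ω = E k 0 ω - E k N ω := by
      simp only [hD, Pi.sub_apply]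
      exact Finset.sum_range_sub' (fun i => E k i ω) N
    have t1 : E k 0 = X k := condExp_of_stronglyMeasurable (h𝓕 _)
      (hX𝓕 k).stronglyMeasurable
      ((hX k).integrable hp1)
    have t2 : E k N = 0 := by
      simp only [hE, show k + 1 - N = 0 by omega, hbot]
      rw [condExp_bot, h0 k]; rfl
    rw [e, t1, t2]; simp
  rw [hdecomp]
  refine (eLpNorm_sum_le (fun i _ => (memLp_finsetSum _ fun k _ => hDmem i k).1) hp1).trans
    ((Finset.sum_le_sum fun i _ => hmart i).trans ?_)
  rw [← ENNReal.ofReal_sum_of_nonneg fun i _ => by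
    have e0 := hφ0 i
    have e1 := hφ0 (i + 1)
    positivity]
  refine ENNReal.ofReal_le_ofReal ?_
  have hs1 := hΦ N
  have hs2 : ∑ i ∈ Finset.range N, φ (i + 1) ^ (1 / (p : ℝ)) ≤ Φ := by
    refine le_trans ?_ (hΦ (N + 1))
    rw [Finset.sum_range_succ']
    have e0 := hφ0 0
    exact le_add_of_nonneg_right (by positivity)
  calc ∑ i ∈ Finset.range N,
        A * (√N * (2 * (φ i ^ (1 / (p : ℝ)) + φ (i + 1) ^ (1 / (p : ℝ))) * L))
      = A * (√N * L) * (2 * (∑ i ∈ Finset.range N, φ i ^ (1 / (p : ℝ)) +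
          ∑ i ∈ Finset.range N, φ (i + 1) ^ (1 / (p : ℝ)))) := by
        rw [← Finset.sum_add_distrib, Finset.mul_sum, Finset.mul_sum]
        exact Finset.sum_congr rfl fun i _ => by ring
    _ ≤ A * (√N * L) * (4 * Φ) := by
        have hN : 0 ≤ √(N : ℝ) * L := by positivity
        exact mul_le_mul_of_nonneg_left (by linarith) (by positivity)

end Mixing

/-! ### Measurability of the supremum norm -/

lemma enorm_curve_le {f : Curve} {S : ℝ≥0∞} (h : ∀ t, ‖f t‖ₑ ≤ S) : ‖f‖ₑ ≤ S := by
  rcases eq_or_ne S ∞ with rfl | hS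
  · exact le_top
  lift S to ℝ≥0 using hS
  rw [enorm_le_coe, ← NNReal.coe_le_coe, coe_nnnorm]
  refine (ContinuousMap.norm_le f S.coe_nonneg).2 fun t => ?_
  have := h t
  rwa [enorm_le_coe, ← NNReal.coe_le_coe] at this

lemma enorm_apply_le (f : Curve) (t : I) : ‖f t‖ₑ ≤ ‖f‖ₑ := by
  rw [enorm_le_iff_norm_le]
  exact f.norm_coe_le_norm t

/-- By continuity a countable dense set of arguments suffices. This gives measurability of the norm
although only the evaluations at single points are assumed measurable. -/
lemma enorm_eq_iSup_denseSeq (f : Curve) : ‖f‖ₑ = ⨆ i, ‖f (TopologicalSpace.denseSeq I i)‖ₑ := by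
  refine le_antisymm (enorm_curve_le fun t => ?_) (iSup_le fun i => enorm_apply_le f _)
  have hcl : IsClosed {t : I | ‖f t‖ₑ ≤ ⨆ i, ‖f (TopologicalSpace.denseSeq I i)‖ₑ} :=
    isClosed_le f.continuous.enorm continuous_const
  have : Set.range (TopologicalSpace.denseSeq I) ⊆
      {t : I | ‖f t‖ₑ ≤ ⨆ i, ‖f (TopologicalSpace.denseSeq I i)‖ₑ} := by
    rintro _ ⟨i, rfl⟩
    exact le_iSup (fun i => ‖f (TopologicalSpace.denseSeq I i)‖ₑ) i
  have h2 := hcl.closure_subset_iff.2 this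
  rw [(TopologicalSpace.denseRange_denseSeq I).closure_range] at h2
  exact h2 (Set.mem_univ t)

lemma measurable_enorm_curve {Ω : Type*} [MeasurableSpace Ω] {Z : Ω → Curve}
    (hZ : ∀ t, Measurable fun ω => Z ω t) : Measurable fun ω => ‖Z ω‖ₑ := by
  simp_rw [enorm_eq_iSup_denseSeq]
  exact Measurable.iSup fun i => (hZ _).enorm

/-! ### Chaining -/

/-- The points of `F` have pairwise distances larger than `w`. -/
def IsSep (ρ : I → I → ℝ) (w : ℝ) (F : Finset I) : Prop := ∀ t ∈ F, ∀ u ∈ F, t ≠ u → w < ρ t u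

lemma IsSep.card_le {ρ : I → I → ℝ} {w : ℝ} {F : Finset I} (h : IsSep ρ w F) :
    (F.card : ℝ≥0∞) ≤ packingNumber ρ w :=
  le_iSup₂_of_le F h le_rfl

lemma packingNumber_antitone (ρ : I → I → ℝ) : Antitone (packingNumber ρ) := fun _ _ hw =>
  iSup₂_le fun _ hF => IsSep.card_le fun t ht u hu htu => hw.trans_lt (hF t ht u hu htu)

/-- Packing numbers decrease in the radius, so an infinite one would make the integrand infinite on
a whole interval next to 0. -/
lemma packingNumber_lt_top {ρ : I → I → ℝ} {τ : ℝ} (hτ : 0 < τ) {J : ℕ} (hJ : 0 < J)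
    (h : ∫⁻ w in Set.Ioo 0 τ, packingNumber ρ w ^ (1 / (J : ℝ)) < ∞) {w : ℝ} (hw : 0 < w) :
    packingNumber ρ w < ∞ := by
  by_contra hcon
  have hinf : packingNumber ρ w = ∞ := not_lt_top_iff.1 hcon
  have hm : 0 < min w τ := lt_min hw hτ
  have h1 : ∫⁻ _ in Set.Ioo 0 (min w τ), ∞ ≤
      ∫⁻ w in Set.Ioo 0 τ, packingNumber ρ w ^ (1 / (J : ℝ)) := by
    refine le_trans (setLIntegral_mono' measurableSet_Ioo fun v hv => ?_)
      (lintegral_mono_set (Set.Ioo_subset_Ioo le_rfl (min_le_right _ _)))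
    have : packingNumber ρ v = ∞ := top_le_iff.1
      (hinf ▸ packingNumber_antitone ρ (hv.2.le.trans (min_le_left _ _)))
    rw [this, ENNReal.top_rpow_of_pos (by positivity)]
  rw [setLIntegral_const, Real.volume_Ioo, sub_zero,
    ENNReal.top_mul (by simpa using hm)] at h1
  exact absurd (h1.trans_lt h) (lt_irrefl _)

/-- A separated set of maximal cardinality is a net: a point farther than w from all its members
could be added. -/
lemma exists_net {ρ : I → I → ℝ} {w : ℝ} (hw : 0 ≤ w) (hself : ∀ t, ρ t t = 0)
    (hsymm : ∀ t u, ρ t u = ρ u t)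
    (h : packingNumber ρ w < ∞) : ∃ F : Finset I, (F.card : ℝ≥0∞) ≤ packingNumber ρ w ∧
      ∀ t, ∃ v ∈ F, ρ t v ≤ w := by
  classical
  set A : Set ℕ := {k | ∃ F, IsSep ρ w F ∧ F.card = k} with hA
  have hne : A.Nonempty := ⟨0, ∅, fun t ht => by simp at ht, rfl⟩
  have hbdd : BddAbove A := by
    obtain ⟨K, hK⟩ := ENNReal.exists_nat_gt h.ne
    refine ⟨K, ?_⟩
    rintro _ ⟨F, hF, rfl⟩
    exact_mod_cast (hF.card_le.trans hK.le)
  obtain ⟨F, hF, hcard⟩ := Nat.sSup_mem hne hbdd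
  refine ⟨F, hF.card_le, fun t => ?_⟩
  by_cases ht : t ∈ F
  · exact ⟨t, ht, by rw [hself]; exact hw⟩
  by_contra! hcon
  have hsep : IsSep ρ w (insert t F) := by
    intro a ha b hb hab
    rw [Finset.mem_insert] at ha hb
    rcases ha with rfl | ha <;> rcases hb with rfl | hb
    · exact absurd rfl hab
    · exact hcon b hb
    · rw [hsymm]; exact hcon a ha
    · exact hF a ha b hb hab
  have : (insert t F).card ≤ sSup A := le_csSup hbdd ⟨_, hsep, rfl⟩
  rw [Finset.card_insert_of_notMem ht, hcard] at this
  omega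

/-- On the interval from τ/2^{k+1} to τ/2^k the integrand is at least its value at the right end,
and the length of the interval is half of the k-th coefficient; hence the factor 2. -/
lemma tsum_packingNumber_le (ρ : I → I → ℝ) {τ : ℝ} (hτ : 0 < τ) (J : ℕ) :
    ∑' k : ℕ, ENNReal.ofReal (τ / 2 ^ k) * packingNumber ρ (τ / 2 ^ k) ^ (1 / (J : ℝ)) ≤
      2 * ∫⁻ w in Set.Ioo 0 τ, packingNumber ρ w ^ (1 / (J : ℝ)) := by
  set s : ℕ → Set ℝ := fun k => Set.Ioo (τ / 2 ^ (k + 1)) (τ / 2 ^ k) with hs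
  have hanti : ∀ k l : ℕ, k ≤ l → τ / 2 ^ l ≤ τ / 2 ^ k := fun k l hkl => by
    gcongr
    norm_num
  have hdisj : Pairwise (Function.onFun Disjoint s) := by
    have : ∀ k l, k < l → Disjoint (s k) (s l) := by
      intro k l hkl
      rw [Set.disjoint_left]
      intro x hx hx'
      have := hanti (k + 1) l hkl
      linarith [hx.1, hx'.2]
    intro k l hkl
    rcases lt_or_gt_of_ne hkl with h | h
    · exact this k l h
    · exact (this l k h).symm
  have hsub : (⋃ k, s k) ⊆ Set.Ioo 0 τ := by
    refine Set.iUnion_subset fun k x hx => ⟨lt_trans (by positivity) hx.1, hx.2.trans_le ?_⟩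
    simpa using hanti 0 k (Nat.zero_le k)
  calc _ = 2 * ∑' k : ℕ, ENNReal.ofReal (τ / 2 ^ (k + 1)) *
        packingNumber ρ (τ / 2 ^ k) ^ (1 / (J : ℝ)) := by
        rw [← ENNReal.tsum_mul_left]
        refine tsum_congr fun k => ?_
        rw [← mul_assoc, ← ENNReal.ofReal_ofNat 2, ← ENNReal.ofReal_mul (by norm_num)]
        congr 2
        rw [pow_succ]; field_simp
    _ ≤ 2 * ∑' k : ℕ, ∫⁻ w in s k, packingNumber ρ w ^ (1 / (J : ℝ)) := by
        gcongr with k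
        calc _ = ∫⁻ _ in s k, packingNumber ρ (τ / 2 ^ k) ^ (1 / (J : ℝ)) := by
              rw [setLIntegral_const, Real.volume_Ioo, mul_comm]
              congr 2
              rw [pow_succ]; field_simp; norm_num
          _ ≤ _ := setLIntegral_mono' measurableSet_Ioo fun w hw =>
              ENNReal.rpow_le_rpow (packingNumber_antitone ρ hw.2.le) (by positivity)
    _ = 2 * ∫⁻ w in ⋃ k, s k, packingNumber ρ w ^ (1 / (J : ℝ)) := by
        rw [lintegral_iUnion (fun k => measurableSet_Ioo) hdisj]
    _ ≤ _ := by
        gcongr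

section Chaining

variable {Ω : Type*} [MeasurableSpace Ω] {P : Measure Ω}

lemma eLpNorm_le_of_lintegral_pow_le {p : ℕ} (hp : p ≠ 0) {ε : Type*} [ENorm ε] {f : Ω → ε}
    {c : ℝ≥0∞} (h : ∫⁻ ω, ‖f ω‖ₑ ^ p ∂P ≤ c ^ p) : eLpNorm f p P ≤ c := by
  rw [eLpNorm_eq_lintegral_rpow_enorm_toReal (by exact_mod_cast hp) (ENNReal.natCast_ne_top p)]
  simp only [ENNReal.toReal_natCast, ENNReal.rpow_natCast, one_div]
  rw [ENNReal.rpow_inv_le_iff (by positivity), ENNReal.rpow_natCast]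
  exact h

lemma lintegral_pow_le_of_eLpNorm_le {p : ℕ} (hp : p ≠ 0) {ε : Type*} [ENorm ε] {f : Ω → ε}
    {c : ℝ≥0∞} (h : eLpNorm f p P ≤ c) : ∫⁻ ω, ‖f ω‖ₑ ^ p ∂P ≤ c ^ p := by
  rw [eLpNorm_eq_lintegral_rpow_enorm_toReal (by exact_mod_cast hp)
    (ENNReal.natCast_ne_top p)] at h
  simp only [ENNReal.toReal_natCast, ENNReal.rpow_natCast, one_div] at h
  rwa [ENNReal.rpow_inv_le_iff (by positivity), ENNReal.rpow_natCast] at h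

/-- Second moment bound for the supremum of a process with Lipschitz increments in `L^J`. -/
lemma exists_chaining_bound [IsProbabilityMeasure P] {ρ : I → I → ℝ} (hself : ∀ t, ρ t t = 0)
    (hsymm : ∀ t u, ρ t u = ρ u t) {τ : ℝ} (hτ : 0 < τ)
    {J : ℕ} (hJ : 2 ≤ J) (hent : ∫⁻ w in Set.Ioo 0 τ, packingNumber ρ w ^ (1 / (J : ℝ)) < ∞) :
    ∃ C : ℝ≥0, ∀ (Z : Ω → Curve) (Λ : ℝ≥0∞), (∀ t, Measurable fun ω => Z ω t) →
      (∀ t u, eLpNorm (fun ω => Z ω t - Z ω u) J P ≤ Λ * ENNReal.ofReal (ρ t u)) →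
      (∀ t, eLpNorm (fun ω => Z ω t) 2 P ≤ Λ) →
      (∀ᵐ ω ∂P, ∃ M : ℝ, 0 ≤ M ∧ ∀ t u, |Z ω t - Z ω u| ≤ M * ρ t u) →
      ∫⁻ ω, ‖Z ω‖ₑ ^ 2 ∂P ≤ (C * Λ) ^ 2 := by
  classical
  set W : ℝ≥0∞ := ∫⁻ w in Set.Ioo 0 τ, packingNumber ρ w ^ (1 / (J : ℝ)) with hW
  have hnet : ∀ k : ℕ, ∃ F : Finset I, (F.card : ℝ≥0∞) ≤ packingNumber ρ (τ / 2 ^ k) ∧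
      ∀ t, ∃ v ∈ F, ρ t v ≤ τ / 2 ^ k := fun k =>
    exists_net (by positivity) hself hsymm
      (packingNumber_lt_top hτ (by omega) hent (by positivity))
  choose F hFcard hFnet using hnet
  choose π hπmem hπ using hFnet
  have hCfin : ((F 0).card : ℝ≥0∞) + 4 * W ≠ ∞ := by
    have := hent.ne
    finiteness
  refine ⟨((F 0).card + 4 * W : ℝ≥0∞).toNNReal, fun Z Λ hZm hinc hpt hlip => ?_⟩
  rw [ENNReal.coe_toNNReal hCfin]
  set R : Ω → ℝ≥0∞ := ∑ v ∈ F 0, fun ω => ‖Z ω v‖ₑ with hR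
  -- The ℓ^J norm of all links between levels k+1 and k dominates each single link, and its L^J norm
  -- costs only the J-th root of the number of links. This is the integrand of the entropy integral.
  set a : ℕ → Ω → ℝ≥0∞ := fun k ω =>
    (∑ v ∈ F (k + 1), ‖Z ω v - Z ω (π k v)‖ₑ ^ J) ^ (1 / (J : ℝ)) with ha
  have hRm : Measurable R := by
    rw [hR, Finset.sum_fn]
    exact Finset.measurable_fun_sum _ fun v _ => (hZm v).enorm
  have ham : ∀ k, Measurable (a k) := fun k =>
    (Finset.measurable_fun_sum _ fun v _ =>
      (((hZm v).sub (hZm (π k v))).enorm).pow_const J).pow_const _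
  have hJ0 : J ≠ 0 := by omega
  have hJr : (0 : ℝ) < J := by positivity
  have hale : ∀ k, ∀ v ∈ F (k + 1), ∀ ω, ‖Z ω v - Z ω (π k v)‖ₑ ≤ a k ω := by
    intro k v hv ω
    simp only [ha, one_div]
    rw [ENNReal.le_rpow_inv_iff hJr, ENNReal.rpow_natCast]
    exact Finset.single_le_sum (f := fun v => ‖Z ω v - Z ω (π k v)‖ₑ ^ J)
      (fun _ _ => zero_le) hv
  have hRnorm : eLpNorm R 2 P ≤ (F 0).card * Λ := by
    refine (eLpNorm_sum_le (fun v _ => (hZm v).enorm.aestronglyMeasurable) (by norm_num)).trans ?_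
    refine (Finset.sum_le_sum (g := fun _ => Λ) fun v _ => ?_).trans
      (by rw [Finset.sum_const, nsmul_eq_mul])
    rw [eLpNorm_enorm]
    exact hpt v
  have hanorm : ∀ k, eLpNorm (a k) 2 P ≤ 2 * Λ * (ENNReal.ofReal (τ / 2 ^ (k + 1)) *
      packingNumber ρ (τ / 2 ^ (k + 1)) ^ (1 / (J : ℝ))) := by
    intro k
    have h2J : (2 : ℝ≥0∞) ≤ (J : ℝ≥0∞) := by exact_mod_cast hJ
    refine (eLpNorm_le_eLpNorm_of_exponent_le h2J (ham k).aestronglyMeasurable).trans ?_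
    refine eLpNorm_le_of_lintegral_pow_le hJ0 ?_
    have e1 : ∀ ω, ‖a k ω‖ₑ ^ J = ∑ v ∈ F (k + 1), ‖Z ω v - Z ω (π k v)‖ₑ ^ J := fun ω => by
      rw [enorm_eq_self, ha, ← ENNReal.rpow_natCast, ← ENNReal.rpow_mul, one_div,
        inv_mul_cancel₀ hJr.ne', ENNReal.rpow_one]
    simp_rw [e1]
    have hvm : ∀ v ∈ F (k + 1), Measurable fun ω => ‖Z ω v - Z ω (π k v)‖ₑ ^ J := fun v _ =>
      (((hZm v).sub (hZm (π k v))).enorm).pow_const J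
    rw [lintegral_finsetSum _ hvm]
    have e2 : 2 * Λ * (ENNReal.ofReal (τ / 2 ^ (k + 1)) *
        packingNumber ρ (τ / 2 ^ (k + 1)) ^ (1 / (J : ℝ))) = Λ * ENNReal.ofReal (τ / 2 ^ k) *
        packingNumber ρ (τ / 2 ^ (k + 1)) ^ (1 / (J : ℝ)) := by
      have : ENNReal.ofReal (τ / 2 ^ k) = 2 * ENNReal.ofReal (τ / 2 ^ (k + 1)) := by
        rw [← ENNReal.ofReal_ofNat 2, ← ENNReal.ofReal_mul (by norm_num)]
        congr 1
        rw [pow_succ]; field_simp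
      rw [this]; ring
    rw [e2, mul_pow, ← ENNReal.rpow_natCast (_ ^ (1 / (J : ℝ))), ← ENNReal.rpow_mul, one_div,
      inv_mul_cancel₀ hJr.ne', ENNReal.rpow_one, mul_comm]
    refine (Finset.sum_le_sum (g := fun _ => (Λ * ENNReal.ofReal (τ / 2 ^ k)) ^ J)
      fun v _ => ?_).trans ?_
    · refine lintegral_pow_le_of_eLpNorm_le hJ0 ((hinc v (π k v)).trans ?_)
      gcongr
      exact hπ k v
    · rw [Finset.sum_const, nsmul_eq_mul]
      gcongr
      exact hFcard (k + 1)
  set Y : ℕ → Ω → ℝ≥0∞ := fun N => R + ∑ k ∈ Finset.range N, a k with hY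
  have hsm : ∀ N, Measurable (∑ k ∈ Finset.range N, a k) := fun N => by
    rw [Finset.sum_fn]
    exact Finset.measurable_fun_sum _ fun k _ => ham k
  have hYm : ∀ N, Measurable (Y N) := fun N => hRm.add (hsm N)
  have hYmono : Monotone Y := fun N N' hNN ω => by
    simp only [hY, Pi.add_apply, Finset.sum_apply]
    gcongr
  have hchain : ∀ k, ∀ v ∈ F k, ∀ ω, ‖Z ω v‖ₑ ≤ Y k ω := by
    intro k
    induction k with
    | zero =>
      intro v hv ω
      simp only [hY, hR, Finset.range_zero, Finset.sum_empty, add_zero, Finset.sum_apply]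
      exact Finset.single_le_sum (f := fun v => ‖Z ω v‖ₑ) (fun _ _ => zero_le) hv
    | succ k ih =>
      intro v hv ω
      calc ‖Z ω v‖ₑ = ‖Z ω (π k v) + (Z ω v - Z ω (π k v))‖ₑ := by congr 1; ring
        _ ≤ ‖Z ω (π k v)‖ₑ + ‖Z ω v - Z ω (π k v)‖ₑ := enorm_add_le _ _
        _ ≤ Y k ω + a k ω := add_le_add (ih _ (hπmem k v) ω) (hale k v hv ω)
        _ = Y (k + 1) ω := by
            simp only [hY, Pi.add_apply, Finset.sum_apply, Finset.sum_range_succ, add_assoc]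
  -- The chain controls the curve only on the nets. The metric ρ is not related to the topology of
  -- the interval, so the passage to all t rests on the random Lipschitz bound for ρ, not on
  -- continuity.
  have hsup : ∀ᵐ ω ∂P, ‖Z ω‖ₑ ≤ ⨆ N, Y N ω := by
    filter_upwards [hlip] with ω ⟨M, hM0, hM⟩
    refine enorm_curve_le fun t => ?_
    have h1 : ∀ k, ‖Z ω t‖ₑ ≤ (⨆ N, Y N ω) + ENNReal.ofReal (M * (τ / 2 ^ k)) := by
      intro k
      calc ‖Z ω t‖ₑ = ‖Z ω (π k t) + (Z ω t - Z ω (π k t))‖ₑ := by congr 1; ring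
        _ ≤ ‖Z ω (π k t)‖ₑ + ‖Z ω t - Z ω (π k t)‖ₑ := enorm_add_le _ _
        _ ≤ _ := by
            refine add_le_add ((hchain k _ (hπmem k t) ω).trans (le_iSup (fun N => Y N ω) k)) ?_
            rw [Real.enorm_eq_ofReal_abs]
            refine ENNReal.ofReal_le_ofReal ((hM _ _).trans ?_)
            gcongr
            exact hπ k t
    have h2 : Tendsto (fun k : ℕ => (⨆ N, Y N ω) + ENNReal.ofReal (M * (τ / 2 ^ k))) atTop
        (𝓝 ((⨆ N, Y N ω) + ENNReal.ofReal (M * 0))) := by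
      refine tendsto_const_nhds.add (ENNReal.tendsto_ofReal (tendsto_const_nhds.mul ?_))
      exact tendsto_const_nhds.div_atTop (tendsto_pow_atTop_atTop_of_one_lt (by norm_num))
    rw [mul_zero, ENNReal.ofReal_zero, add_zero] at h2
    exact ge_of_tendsto' h2 h1
  calc ∫⁻ ω, ‖Z ω‖ₑ ^ 2 ∂P ≤ ∫⁻ ω, ⨆ N, Y N ω ^ 2 ∂P := by
        refine lintegral_mono_ae ?_
        filter_upwards [hsup] with ω hω
        rw [← ENNReal.iSup_pow_of_ne_zero two_ne_zero]
        gcongr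
    _ = ⨆ N, ∫⁻ ω, Y N ω ^ 2 ∂P := lintegral_iSup (fun N => (hYm N).pow_const 2)
        fun N N' hNN ω => by
          have := hYmono hNN ω
          dsimp only
          gcongr
    _ ≤ _ := by
        refine iSup_le fun N => ?_
        have := lintegral_pow_le_of_eLpNorm_le (P := P) (f := Y N) (p := 2) two_ne_zero
          (c := (((F 0).card : ℝ≥0∞) + 4 * W) * Λ) ?_
        · simpa only [enorm_eq_self] using this
        push_cast
        refine (eLpNorm_add_le hRm.aestronglyMeasurable
          (hsm N).aestronglyMeasurable (by norm_num)).trans ?_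
        rw [add_mul]
        refine add_le_add hRnorm ((eLpNorm_sum_le (fun k _ => (ham k).aestronglyMeasurable)
          (by norm_num)).trans ((Finset.sum_le_sum fun k _ => hanorm k).trans ?_))
        rw [← Finset.mul_sum]
        calc _ ≤ 2 * Λ * (2 * W) := by
              gcongr
              refine le_trans ?_ (tsum_packingNumber_le ρ hτ J)
              exact (ENNReal.sum_le_tsum _).trans (ENNReal.tsum_comp_le_tsum_of_injective
                (add_left_injective 1) fun k => ENNReal.ofReal (τ / 2 ^ k) *
                  packingNumber ρ (τ / 2 ^ k) ^ (1 / (J : ℝ)))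
          _ = _ := by ring

end Chaining

/-! ### Mixing properties of the rows of the array -/

section Rows

variable {Ω : Type*} {ε : ℕ → ℕ → Ω → Curve}

lemma rowSigma_mono {n a b a' b' : ℕ} (ha : a' ≤ a) (hb : b ≤ b') :
    rowSigma ε n a b ≤ rowSigma ε n a' b' := by
  refine iSup₂_le fun j hj => ?_
  rw [Finset.mem_Icc] at hj
  exact le_iSup₂_of_le j (Finset.mem_Icc.2 ⟨by omega, by omega⟩) le_rfl

lemma rowSigma_eq_bot {n a b : ℕ} (h : b < a) : rowSigma ε n a b = ⊥ := by
  refine le_bot_iff.1 (iSup₂_le fun j hj => ?_)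
  rw [Finset.mem_Icc] at hj
  omega

lemma measurable_rowSigma {n a b j : ℕ} (h1 : a ≤ j) (h2 : j ≤ b) (t : I) :
    Measurable[rowSigma ε n a b] fun ω => ε n j ω t := by
  have : MeasurableSpace.comap (fun ω => ε n j ω t) (borel ℝ) ≤ rowSigma ε n a b :=
    le_iSup₂_of_le j (Finset.mem_Icc.2 ⟨h1, h2⟩)
      (le_iSup (fun t : I => MeasurableSpace.comap (fun ω => ε n j ω t) (borel ℝ)) t)
  rw [measurable_iff_comap_le, ← (inferInstance : BorelSpace ℝ).measurable_eq] at *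
  exact this

variable {mΩ : MeasurableSpace Ω} {P : Measure Ω}

lemma rowSigma_le (h1 : CondA1 P ε) {n a b : ℕ} (ha : 1 ≤ a) (hb : b ≤ n) :
    rowSigma ε n a b ≤ mΩ := by
  refine iSup₂_le fun j hj => iSup_le fun t => ?_
  rw [Finset.mem_Icc] at hj
  have := h1.measurable n j (Finset.mem_Icc.2 ⟨by omega, by omega⟩) t
  rw [measurable_iff_comap_le, (inferInstance : BorelSpace ℝ).measurable_eq] at this
  exact this

variable [IsProbabilityMeasure P]

lemma abs_inter_sub_le (A B : Set Ω) : |P.real (A ∩ B) - P.real A * P.real B| ≤ P.real A := by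
  have e1 : P.real (A ∩ B) ≤ P.real A := measureReal_mono Set.inter_subset_left
  have e2 : P.real B ≤ 1 := measureReal_le_one
  have e3 : 0 ≤ P.real B := measureReal_nonneg
  have e4 : 0 ≤ P.real (A ∩ B) := measureReal_nonneg
  have e5 : 0 ≤ P.real A := measureReal_nonneg
  rw [abs_le]
  constructor <;> nlinarith

lemma le_one_of_mem_phiMixing {k : ℕ} {x : ℝ}
    (hx : ∃ (n i : ℕ) (A B : Set Ω), 1 ≤ i ∧ i + k ≤ n ∧
    MeasurableSet[rowSigma ε n 1 i] A ∧ MeasurableSet[rowSigma ε n (i + k) n] B ∧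
    0 < P.real A ∧ x = |P.real (A ∩ B) / P.real A - P.real B|) : x ≤ 1 := by
  obtain ⟨-, -, A, B, -, -, -, -, hpos, rfl⟩ := hx
  have := abs_inter_sub_le (P := P) A B
  rw [div_sub' hpos.ne', abs_div, abs_of_pos hpos, div_le_one hpos]
  exact this

omit [IsProbabilityMeasure P] in
lemma phiMixing_nonneg (k : ℕ) : 0 ≤ phiMixing P ε k :=
  Real.sSup_nonneg fun _ ⟨_, _, _, _, _, _, _, _, _, hx⟩ => hx ▸ abs_nonneg _

lemma phiMixing_le_one (k : ℕ) : phiMixing P ε k ≤ 1 :=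
  Real.sSup_le (fun _ hx => le_one_of_mem_phiMixing hx) zero_le_one

lemma phiBound_rowSigma {n i k : ℕ} (hi : 1 ≤ i) (hik : i + k ≤ n) :
    PhiBound (rowSigma ε n 1 i) (rowSigma ε n (i + k) n) P (phiMixing P ε k) := by
  intro A B hA hB
  rcases (measureReal_nonneg (μ := P) (s := A)).eq_or_lt with h0 | hpos
  · have e1 : P.real (A ∩ B) ≤ P.real A := measureReal_mono Set.inter_subset_left
    have e4 : 0 ≤ P.real (A ∩ B) := measureReal_nonneg
    rw [← h0] at e1 ⊢
    rw [le_antisymm e1 e4]; simp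
  · have : |P.real (A ∩ B) / P.real A - P.real B| ≤ phiMixing P ε k :=
      le_csSup ⟨1, fun _ hx => le_one_of_mem_phiMixing hx⟩
        ⟨n, i, A, B, hi, hik, hA, hB, hpos, rfl⟩
    rwa [div_sub' hpos.ne', abs_div, abs_of_pos hpos, div_le_iff₀ hpos] at this

lemma phiBound_bot_right {F : MeasurableSpace Ω} {φ : ℝ} (hφ : 0 ≤ φ) :
    PhiBound F ⊥ P φ := by
  intro A B _ hB
  have hP : 0 ≤ φ * P.real A := mul_nonneg hφ measureReal_nonneg
  rcases MeasurableSpace.measurableSet_bot_iff.1 hB with rfl | rfl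
  · simpa using hP
  · simpa using hP

omit [IsProbabilityMeasure P] in
lemma CondA4.summable {J : ℕ} (hJ : 2 ≤ J) (h4 : CondA4 P ε J) :
    Summable fun k => phiMixing P ε k ^ (1 / (J : ℝ)) := by
  refine Summable.of_nonneg_of_le (fun k => Real.rpow_nonneg (phiMixing_nonneg k) _)
    (fun k => ?_) h4
  refine le_mul_of_one_le_left (Real.rpow_nonneg (phiMixing_nonneg k) _) ?_
  have : (2 : ℝ) ≤ J := by exact_mod_cast hJ
  exact Real.one_le_rpow (by linarith [(Nat.cast_nonneg k : (0 : ℝ) ≤ k)]) (by linarith)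

/-- The coefficients are at most one and 1/2 ≥ 1/J, so these terms are the smaller ones. -/
lemma CondA4.summable_sqrt {J : ℕ} (hJ : 2 ≤ J) (h4 : CondA4 P ε J) :
    Summable fun k => phiMixing P ε k ^ (1 / ((2 : ℕ) : ℝ)) := by
  refine Summable.of_nonneg_of_le (fun k => Real.rpow_nonneg (phiMixing_nonneg k) _)
    (fun k => ?_) (h4.summable hJ)
  have : (2 : ℝ) ≤ J := by exact_mod_cast hJ
  have h0 : (0 : ℝ) < 1 / J := by positivity
  exact Real.rpow_le_rpow_of_exponent_ge' (phiMixing_nonneg k) (phiMixing_le_one k)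
    h0.le (one_div_le_one_div_of_le (by norm_num) (by push_cast; exact this))

/-- Moment inequality for sums of variables that depend on well separated blocks of a row. -/
lemma eLpNorm_sum_blocks_le (h1 : CondA1 P ε) {p : ℕ} (hp : Even p) (hp2 : 2 ≤ p)
    (hsum : Summable fun k => phiMixing P ε k ^ (1 / (p : ℝ))) {n s l : ℕ} (hs : 1 ≤ s)
    {X : ℕ → Ω → ℝ}
    (hXm : ∀ k, Measurable[rowSigma ε n (s + k * (l + 1)) (min (s + k * (l + 1) + l) n)] (X k))
    (h0 : ∀ k, ∫ ω, X k ω ∂P = 0) {L : ℝ} (hL0 : 0 ≤ L)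
    (hL : ∀ k, eLpNorm (X k) p P ≤ ENNReal.ofReal L) (N : ℕ) :
    eLpNorm (fun ω => ∑ k ∈ Finset.range N, X k ω) p P ≤
      ENNReal.ofReal ((2 ^ (p + 1) * Real.exp (2 ^ p)) * (√N * L) *
        (4 * (1 + ∑' k, phiMixing P ε k ^ (1 / (p : ℝ))))) := by
  set j : ℕ → ℕ := fun k => s + k * (l + 1) with hj
  set 𝓕 : ℕ → MeasurableSpace Ω := fun k =>
    match k with
    | 0 => ⊥
    | k + 1 => rowSigma ε n 1 (min (j k + l) n) with h𝓕
  set 𝓖 : ℕ → MeasurableSpace Ω := fun k => rowSigma ε n (j k) n with h𝓖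
  have hj1 : ∀ k, 1 ≤ j k := fun k => hs.trans (Nat.le_add_right _ _)
  have hjmono : ∀ k, j k ≤ j (k + 1) := fun k => by simp only [hj]; nlinarith
  have hFle : ∀ k, 𝓕 k ≤ mΩ := by
    intro k
    cases k with
    | zero => exact bot_le
    | succ k => exact rowSigma_le h1 le_rfl (min_le_right _ _)
  have hGle : ∀ k, 𝓖 k ≤ mΩ := fun k => rowSigma_le h1 (hj1 k) le_rfl
  have hFmono : Monotone 𝓕 := by
    refine monotone_nat_of_le_succ fun k => ?_
    cases k with
    | zero => exact bot_le
    | succ k =>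
      have := hjmono k
      exact rowSigma_mono le_rfl (by omega)
  -- At distance 0 a block is compared with a σ-field that contains it, and only the trivial bound 1
  -- is used; this is the summand 1 in the final constant.
  set φ : ℕ → ℝ := fun k => if k = 0 then 1 else phiMixing P ε k with hφ
  have hφ0 : ∀ k, 0 ≤ φ k := fun k => by
    simp only [hφ]; split_ifs
    · exact zero_le_one
    · exact phiMixing_nonneg k
  have hφ1 : ∀ k, φ k ≤ 1 := fun k => by
    simp only [hφ]; split_ifs
    · exact le_rfl
    · exact phiMixing_le_one k
  have hmix : ∀ i k, PhiBound (𝓕 (k + 1 - i)) (𝓖 k) P (φ i) ∨ k < i := by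
    intro i k
    rcases lt_or_ge k i with hki | hik
    · exact Or.inr hki
    left
    rcases lt_or_ge n (j k) with hn | hn
    · simp only [h𝓖]
      rw [rowSigma_eq_bot hn]
      exact phiBound_bot_right (hφ0 i)
    obtain ⟨q, rfl⟩ : ∃ q, k = q + i := ⟨k - i, by omega⟩
    rw [show q + i + 1 - i = q + 1 by omega]
    change PhiBound (rowSigma ε n 1 (min (j q + l) n)) (rowSigma ε n (j (q + i)) n) P (φ i)
    rcases Nat.eq_zero_or_pos i with rfl | hi
    · intro A B hA hB
      simp only [hφ, if_true, one_mul]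
      exact abs_inter_sub_le (P := P) A B
    -- Blocks that are i steps apart are separated by i(l+1) - l ≥ i time points when i ≥ 1, so the
    -- constant does not depend on the block length l + 1.
    · have hgap : j q + l + i ≤ j (q + i) := by
        simp only [hj]; nlinarith
      have hb := phiBound_rowSigma (P := P) (ε := ε) (n := n) (i := j q + l) (k := i)
        ((hj1 q).trans (Nat.le_add_right _ _)) (by omega)
      simp only [hφ, hi.ne', if_false]
      exact hb.mono (rowSigma_mono le_rfl (min_le_left _ _)) (rowSigma_mono hgap le_rfl) le_rfl
  have hXF : ∀ k, Measurable[𝓕 (k + 1)] (X k) := fun k =>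
    (hXm k).mono (rowSigma_mono (hj1 k) le_rfl) le_rfl
  have hXG : ∀ k, Measurable[𝓖 k] (X k) := fun k =>
    (hXm k).mono (rowSigma_mono le_rfl (min_le_right _ _)) le_rfl
  have hX : ∀ k, MemLp (X k) p P := fun k =>
    ⟨((hXG k).mono (hGle k) le_rfl).aestronglyMeasurable,
      (hL k).trans_lt ENNReal.ofReal_lt_top⟩
  refine eLpNorm_sum_le_of_mixing hp hp2 hFle hGle hFmono rfl hφ0 hφ1 hmix hXF hXG hX h0 hL0 hL
    (fun N => ?_) N
  have hnn : ∀ k, 0 ≤ phiMixing P ε k ^ (1 / (p : ℝ)) := fun k =>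
    Real.rpow_nonneg (phiMixing_nonneg k) _
  calc ∑ i ∈ Finset.range N, φ i ^ (1 / (p : ℝ))
      ≤ ∑ i ∈ Finset.range N, ((if i = 0 then 1 else 0) + phiMixing P ε i ^ (1 / (p : ℝ))) := by
        refine Finset.sum_le_sum fun i _ => ?_
        simp only [hφ]
        split_ifs
        · rw [Real.one_rpow]; exact le_add_of_nonneg_right (hnn i)
        · rw [zero_add]
    _ ≤ _ := by
        rw [Finset.sum_add_distrib]
        refine add_le_add ?_ (hsum.sum_le_tsum _ fun i _ => hnn i)
        rw [Finset.sum_ite_eq']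
        split_ifs <;> norm_num

end Rows

/-! ### Supremum norms of sums over blocks -/

section Blocks

variable {Ω : Type*} {mΩ : MeasurableSpace Ω} {P : Measure Ω} [IsProbabilityMeasure P]
  {ε : ℕ → ℕ → Ω → Curve}

/-- Uniform second moment bound for the supremum of sums of curves that depend on well separated
blocks of a row. -/
lemma exists_sum_blocks_bound (h1 : CondA1 P ε) {J : ℕ} (hJ2 : Even J) (hJ : 2 ≤ J)
    (h4 : CondA4 P ε J) {ρ : I → I → ℝ} (hself : ∀ t, ρ t t = 0) (hsymm : ∀ t u, ρ t u = ρ u t) {τ : ℝ} (hτ : 0 < τ)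
    (hent : ∫⁻ w in Set.Ioo 0 τ, packingNumber ρ w ^ (1 / (J : ℝ)) < ∞) (K : ℝ≥0) :
    ∃ C : ℝ≥0, ∀ (n s l N : ℕ) (Y : ℕ → Ω → Curve), 1 ≤ s →
      (∀ k t, Measurable[rowSigma ε n (s + k * (l + 1)) (min (s + k * (l + 1) + l) n)]
        fun ω => Y k ω t) →
      (∀ k t, ∫ ω, Y k ω t ∂P = 0) →
      (∀ k t, eLpNorm (fun ω => Y k ω t) 2 P ≤ K) →
      (∀ k t u, eLpNorm (fun ω => Y k ω t - Y k ω u) J P ≤ K * ENNReal.ofReal (ρ t u)) →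
      (∀ k, ∀ᵐ ω ∂P, ∃ M : ℝ, 0 ≤ M ∧ ∀ t u, |Y k ω t - Y k ω u| ≤ M * ρ t u) →
      ∫⁻ ω, ‖∑ k ∈ Finset.range N, Y k ω‖ₑ ^ 2 ∂P ≤ C * N := by
  obtain ⟨C₀, hC₀⟩ := exists_chaining_bound (Ω := Ω) (P := P) hself hsymm hτ hJ hent
  set A : ℕ → ℝ := fun p => (2 ^ (p + 1) * Real.exp (2 ^ p)) *
    (4 * (1 + ∑' k, phiMixing P ε k ^ (1 / (p : ℝ)))) with hA
  have hA0 : ∀ p, 0 ≤ A p := fun p => by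
    have : 0 ≤ ∑' k, phiMixing P ε k ^ (1 / (p : ℝ)) :=
      tsum_nonneg fun k => Real.rpow_nonneg (phiMixing_nonneg k) _
    positivity
  -- One constant for both exponents: chaining needs the increments in L^J and the values at single
  -- points in L².
  set B : ℝ≥0 := ⟨A 2 + A J, add_nonneg (hA0 2) (hA0 J)⟩ with hB
  have hJE : (1 : ℝ≥0∞) ≤ J := by exact_mod_cast (show 1 ≤ J by omega)
  refine ⟨(C₀ * (B * K)) ^ 2, fun n s l N Y hs hYm hY0 hY2 hYJ hlip => ?_⟩
  have hYm' : ∀ k t, Measurable fun ω => Y k ω t := fun k t =>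
    (hYm k t).mono (rowSigma_le h1 (by omega) (min_le_right _ _)) le_rfl
  have hmem2 : ∀ k t, Integrable (fun ω => Y k ω t) P := fun k t =>
    MemLp.integrable (q := 2) (by norm_num) ⟨(hYm' k t).aestronglyMeasurable,
      (hY2 k t).trans_lt ENNReal.coe_lt_top⟩
  have hsq : (C₀ * (B * K) : ℝ≥0∞) ^ 2 * N = (C₀ * (ENNReal.ofReal √N * B * K)) ^ 2 := by
    have : ENNReal.ofReal √N ^ 2 = N := by
      rw [← ENNReal.ofReal_pow (Real.sqrt_nonneg _), Real.sq_sqrt (Nat.cast_nonneg N),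
        ENNReal.ofReal_natCast]
    calc _ = (C₀ * (B * K) : ℝ≥0∞) ^ 2 * ENNReal.ofReal √N ^ 2 := by rw [this]
      _ = _ := by ring
  push_cast
  rw [hsq]
  have hbound : ∀ p : ℕ, Even p → 2 ≤ p → A p ≤ B →
      (Summable fun k => phiMixing P ε k ^ (1 / (p : ℝ))) → ∀ (X : ℕ → Ω → ℝ) (L : ℝ≥0),
      (∀ k, Measurable[rowSigma ε n (s + k * (l + 1)) (min (s + k * (l + 1) + l) n)] (X k)) →
      (∀ k, ∫ ω, X k ω ∂P = 0) → (∀ k, eLpNorm (X k) p P ≤ L) →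
      eLpNorm (fun ω => ∑ k ∈ Finset.range N, X k ω) p P ≤ ENNReal.ofReal √N * B * L := by
    intro p hp hp2 hAB hsum X L hXm hX0 hXL
    refine (eLpNorm_sum_blocks_le h1 hp hp2 hsum hs hXm hX0 L.2
      (fun k => (hXL k).trans (by simp)) N).trans ?_
    have : ENNReal.ofReal √N * B * L = ENNReal.ofReal (√N * B * L) := by
      rw [ENNReal.ofReal_mul (by positivity), ENNReal.ofReal_mul (by positivity)]
      simp
    rw [this]
    refine ENNReal.ofReal_le_ofReal ?_
    calc _ = √N * A p * L := by
          change _ * (√N * (L : ℝ)) * _ = _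
          simp only [hA]; ring
      _ ≤ √N * B * L := by gcongr
  refine hC₀ _ _ (fun t => ?_) (fun t u => ?_) (fun t => ?_) ?_
  · simp only [ContinuousMap.coe_sum, Finset.sum_apply]
    exact Finset.measurable_fun_sum _ fun k _ => hYm' k t
  · simp only [ContinuousMap.coe_sum, Finset.sum_apply, ← Finset.sum_sub_distrib]
    have := hbound J hJ2 hJ (le_add_of_nonneg_left (hA0 2)) (h4.summable hJ)
      (fun k ω => Y k ω t - Y k ω u) (K * (ρ t u).toNNReal)
      (fun k => (hYm k t).sub (hYm k u))
      (fun k => by rw [integral_sub (hmem2 k t) (hmem2 k u), hY0, hY0, sub_zero])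
      (fun k => (hYJ k t u).trans (by rw [ENNReal.coe_mul]; rfl))
    refine this.trans (le_of_eq ?_)
    rw [ENNReal.coe_mul, mul_assoc, mul_assoc, mul_assoc]
    rfl
  · simp only [ContinuousMap.coe_sum, Finset.sum_apply]
    exact hbound 2 even_two le_rfl (le_add_of_nonneg_right (hA0 J)) (h4.summable_sqrt hJ)
      (fun k ω => Y k ω t) K (fun k => hYm k t) (fun k => hY0 k t) (fun k => hY2 k t)
  · filter_upwards [ae_all_iff.2 hlip] with ω hω
    choose M hM0 hM using hω
    refine ⟨∑ k ∈ Finset.range N, M k, Finset.sum_nonneg fun k _ => hM0 k, fun t u => ?_⟩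
    simp only [ContinuousMap.coe_sum, Finset.sum_apply, ← Finset.sum_sub_distrib]
    rw [Finset.sum_mul]
    exact (Finset.abs_sum_le_sum_abs _ _).trans (Finset.sum_le_sum fun k _ => hM k t u)

end Blocks

/-! ### Second moments of partial sums -/

section Moments

variable {Ω : Type*} {mΩ : MeasurableSpace Ω} {P : Measure Ω}

/-- Demanding K ≥ 1 + c gives c ≤ K ≤ K^p, which avoids p-th roots in the constants. -/
lemma eLpNorm_le_coe_of_lintegral_pow_le {p : ℕ} (hp : p ≠ 0) {E : Type*} [ENorm E] {f : Ω → E}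
    {c K : ℝ≥0} (h : ∫⁻ ω, ‖f ω‖ₑ ^ p ∂P ≤ c) (hK : 1 + c ≤ K) : eLpNorm f p P ≤ K := by
  refine eLpNorm_le_of_lintegral_pow_le hp (h.trans ?_)
  have h1 : (1 : ℝ≥0) ≤ K := le_trans (by simp) hK
  have h2 : c ≤ K := le_trans (by simp) hK
  exact_mod_cast h2.trans (le_self_pow₀ h1 hp)

/-- Moment bound for the increments of a random curve with a random Lipschitz constant. -/
lemma eLpNorm_le_of_ae_le_mul {p : ℕ} (hp : p ≠ 0) {f : Ω → ℝ} {L : Ω → ℝ≥0∞} {c K : ℝ≥0}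
    {d : ℝ≥0∞} (hd : d ≠ ∞) (hL : ∫⁻ ω, L ω ^ p ∂P ≤ c) (hK : 1 + c ≤ K)
    (h : ∀ᵐ ω ∂P, ‖f ω‖ₑ ≤ L ω * d) : eLpNorm f p P ≤ K * d := by
  refine eLpNorm_le_of_lintegral_pow_le hp ?_
  have h1 : (1 : ℝ≥0) ≤ K := le_trans (by simp) hK
  have h2 : c ≤ K := le_trans (by simp) hK
  calc ∫⁻ ω, ‖f ω‖ₑ ^ p ∂P ≤ ∫⁻ ω, L ω ^ p * d ^ p ∂P := by
        refine lintegral_mono_ae ?_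
        filter_upwards [h] with ω hω
        rw [← mul_pow]
        gcongr
    _ = (∫⁻ ω, L ω ^ p ∂P) * d ^ p := lintegral_mul_const' _ _ (ENNReal.pow_ne_top hd)
    _ ≤ K ^ p * d ^ p := by
        gcongr
        exact hL.trans (by exact_mod_cast h2.trans (le_self_pow₀ h1 hp))
    _ = _ := (mul_pow _ _ _).symm

lemma enorm_integral_le_eLpNorm [IsProbabilityMeasure P] {p : ℝ≥0∞} (hp : 1 ≤ p) {f : Ω → ℝ}
    (hf : AEStronglyMeasurable f P) : ‖∫ ω, f ω ∂P‖ₑ ≤ eLpNorm f p P := by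
  refine (enorm_integral_le_lintegral_enorm _).trans ?_
  rw [← eLpNorm_one_eq_lintegral_enorm]
  exact eLpNorm_le_eLpNorm_of_exponent_le hp hf

lemma eLpNorm_sub_integral_le [IsProbabilityMeasure P] {p : ℝ≥0∞} (hp : 1 ≤ p) {f : Ω → ℝ}
    (hf : AEStronglyMeasurable f P) :
    eLpNorm (fun ω => f ω - ∫ ω, f ω ∂P) p P ≤ 2 * eLpNorm f p P := by
  refine (eLpNorm_sub_le hf aestronglyMeasurable_const hp).trans ?_
  rw [two_mul]
  gcongr
  rw [eLpNorm_const _ (by positivity) (NeZero.ne P), measure_univ, ENNReal.one_rpow, mul_one]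
  exact enorm_integral_le_eLpNorm hp hf

end Moments

section Array

variable {Ω : Type*} {mΩ : MeasurableSpace Ω} {P : Measure Ω} [IsProbabilityMeasure P]
  {ε : ℕ → ℕ → Ω → Curve}

omit [IsProbabilityMeasure P] in
lemma CondA1.exists_eLpNorm_le (h1 : CondA1 P ε) : ∃ K : ℝ≥0, ∀ n, ∀ j ∈ Finset.Icc 1 n,
    eLpNorm (fun ω => ‖ε n j ω‖ₑ) 4 P ≤ K := by
  obtain ⟨C, hC⟩ := h1.moment
  exact ⟨1 + C, fun n j hj => eLpNorm_le_coe_of_lintegral_pow_le (p := 4) (by norm_num)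
    (by simpa using hC n j hj) le_rfl⟩

omit [IsProbabilityMeasure P] in
lemma CondA1.measurable_enorm (h1 : CondA1 P ε) {n j : ℕ} (hj : j ∈ Finset.Icc 1 n) :
    Measurable fun ω => ‖ε n j ω‖ₑ :=
  measurable_enorm_curve (h1.measurable n j hj)

omit [IsProbabilityMeasure P] in
lemma CondA1.eLpNorm_apply_le {n j : ℕ} (t : I) (p : ℝ≥0∞) :
    eLpNorm (fun ω => ε n j ω t) p P ≤ eLpNorm (fun ω => ‖ε n j ω‖ₑ) p P :=
  eLpNorm_mono_enorm fun ω => by rw [enorm_eq_self]; exact enorm_apply_le _ t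

omit [IsProbabilityMeasure P] in
lemma CondA1.memLp (h1 : CondA1 P ε) {n j : ℕ} (hj : j ∈ Finset.Icc 1 n) (t : I) :
    MemLp (fun ω => ε n j ω t) 4 P := by
  obtain ⟨K, hK⟩ := h1.exists_eLpNorm_le
  exact ⟨(h1.measurable n j hj t).aestronglyMeasurable,
    ((CondA1.eLpNorm_apply_le t 4).trans (hK n j hj)).trans_lt ENNReal.coe_lt_top⟩

lemma CondA1.exists_eLpNorm_two_le (h1 : CondA1 P ε) : ∃ K : ℝ≥0, ∀ n, ∀ j ∈ Finset.Icc 1 n,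
    eLpNorm (fun ω => ‖ε n j ω‖ₑ) 2 P ≤ K := by
  obtain ⟨K, hK⟩ := h1.exists_eLpNorm_le
  refine ⟨K, fun n j hj => (eLpNorm_le_eLpNorm_of_exponent_le (by norm_num)
    (h1.measurable_enorm hj).aestronglyMeasurable).trans (hK n j hj)⟩

/-- The second moment of the supremum norm of a partial sum is at most proportional to the number
of summands. -/
lemma exists_lintegral_sum_sq_le (h1 : CondA1 P ε) {J : ℕ} (hJ2 : Even J) (hJ : 2 ≤ J)
    (h3 : CondA3 P ε J) (h4 : CondA4 P ε J) : ∃ C : ℝ≥0, ∀ n a b, 1 ≤ a → b ≤ n + 1 →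
      ∫⁻ ω, ‖∑ j ∈ Finset.Ico a b, ε n j ω‖ₑ ^ 2 ∂P ≤ C * (b - a : ℕ) := by
  obtain ⟨ρ, M, τ, C, hpos, hzero, hsymm, -, hτ, hent, hM⟩ := h3
  obtain ⟨K, hK⟩ := h1.exists_eLpNorm_two_le
  obtain ⟨D, hD⟩ := exists_sum_blocks_bound h1 hJ2 hJ h4 (fun t => (hzero t t).2 rfl) hsymm
    hτ hent (K + (1 + C))
  refine ⟨D, fun n a b ha hb => ?_⟩
  set Y : ℕ → Ω → Curve := fun k ω => if a + k ≤ n then ε n (a + k) ω else 0 with hY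
  have key : ∀ k, a + k ≤ n → a + k ∈ Finset.Icc 1 n := fun k hk =>
    Finset.mem_Icc.2 ⟨by omega, hk⟩
  -- Here l = 0, so the blocks are single time points.
  have := hD n a 0 (b - a) Y ha (fun k t => ?_) (fun k t => ?_) (fun k t => ?_) (fun k t u => ?_)
    (fun k => ?_)
  · have e : ∀ ω, ∑ j ∈ Finset.Ico a b, ε n j ω = ∑ k ∈ Finset.range (b - a), Y k ω := fun ω => by
      rw [Finset.sum_Ico_eq_sum_range]
      refine Finset.sum_congr rfl fun k hk => ?_
      rw [Finset.mem_range] at hk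
      simp only [hY]
      rw [if_pos (by omega)]
    simp_rw [e]
    exact this
  · simp only [hY]
    split_ifs with h
    · exact measurable_rowSigma (by omega) (by omega) t
    · exact measurable_const
  · simp only [hY]
    split_ifs with h
    · exact h1.centred n _ (key k h) t
    · simp
  · simp only [hY]
    split_ifs with h
    · refine (CondA1.eLpNorm_apply_le t 2).trans ((hK n _ (key k h)).trans ?_)
      exact_mod_cast le_add_of_nonneg_right zero_le
    · simp
  · simp only [hY]
    split_ifs with h
    · obtain ⟨-, hl, hm, -⟩ := hM n _ (key k h)
      refine eLpNorm_le_of_ae_le_mul (by omega) ENNReal.ofReal_ne_top hm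
        (le_add_of_nonneg_left zero_le) ?_
      filter_upwards [hl] with ω hω
      rw [← ENNReal.ofReal_coe_nnreal, ← ENNReal.ofReal_mul (NNReal.coe_nonneg _),
        Real.enorm_eq_ofReal_abs]
      exact ENNReal.ofReal_le_ofReal (hω t u)
    · simp
  · simp only [hY]
    split_ifs with h
    · obtain ⟨-, hl, -, -⟩ := hM n _ (key k h)
      filter_upwards [hl] with ω hω
      exact ⟨M n (a + k) ω, NNReal.coe_nonneg _, hω⟩
    · exact Eventually.of_forall fun ω => ⟨0, le_rfl, fun t u => by simp⟩

end Array

/-! ### The autocovariances -/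

section Covariance

variable {Ω : Type*} {F G mΩ : MeasurableSpace Ω} {P : Measure Ω} [IsProbabilityMeasure P]

omit [IsProbabilityMeasure P] in
lemma enorm_integral_mul_le {f g : Ω → ℝ} (hf : AEStronglyMeasurable f P)
    (hg : AEStronglyMeasurable g P) :
    ‖∫ ω, f ω * g ω ∂P‖ₑ ≤ eLpNorm f 2 P * eLpNorm g 2 P := by
  have h := eLpNorm_smul_le_mul_eLpNorm (p := 2) (q := 2) (r := 1) hg hf
  rw [eLpNorm_one_eq_lintegral_enorm] at h
  exact (enorm_integral_le_lintegral_enorm _).trans h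

/-- Covariance inequality for `φ`-mixing σ-fields. -/
lemma PhiBound.enorm_integral_mul_le {φ : ℝ} (h : PhiBound F G P φ) (hF : F ≤ mΩ) (hG : G ≤ mΩ)
    (hφ0 : 0 ≤ φ) (hφ1 : φ ≤ 1) {X Y : Ω → ℝ} (hX : Measurable[F] X) (hY : Measurable[G] Y)
    (hX2 : MemLp X 2 P) (hY2 : MemLp Y 2 P) (hY0 : ∫ ω, Y ω ∂P = 0) :
    ‖∫ ω, X ω * Y ω ∂P‖ₑ ≤
      eLpNorm X 2 P * (ENNReal.ofReal (2 * φ ^ (1 / ((2 : ℕ) : ℝ))) * eLpNorm Y 2 P) := by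
  have hmix := h.eLpNorm_condExp_sub_le (p := 2) hF hG hφ0 hφ1 le_rfl hY hY2
  simp only [hY0, sub_zero] at hmix
  have hXY : Integrable (X * Y) P := hX2.integrable_mul hY2
  have e : ∫ ω, X ω * Y ω ∂P = ∫ ω, X ω * (P[Y|F]) ω ∂P := by
    rw [show (fun ω => X ω * Y ω) = X * Y from rfl, ← integral_condExp hF]
    exact integral_congr_ae (condExp_mul_of_stronglyMeasurable_left hX.stronglyMeasurable hXY
      (hY2.integrable (by norm_num)))
  rw [e]
  exact (FunctionalTS.enorm_integral_mul_le hX2.1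
    (stronglyMeasurable_condExp.mono hF).aestronglyMeasurable).trans (by gcongr; exact hmix)

end Covariance

section Autocov

variable {Ω : Type*} {mΩ : MeasurableSpace Ω} {P : Measure Ω} [IsProbabilityMeasure P]
  {ε : ℕ → ℕ → Ω → Curve} {γ : ℤ → I → I → ℝ}

lemma integrable_enorm_mul (h1 : CondA1 P ε) {n i j : ℕ} (hi : i ∈ Finset.Icc 1 n)
    (hj : j ∈ Finset.Icc 1 n) : Integrable (fun ω => ‖ε n i ω‖ * ‖ε n j ω‖) P := by
  obtain ⟨K, hK⟩ := h1.exists_eLpNorm_two_le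
  have h : ∀ k ∈ Finset.Icc 1 n, MemLp (fun ω => ‖ε n k ω‖) 2 P := fun k hk => by
    refine ⟨?_, lt_of_le_of_lt (eLpNorm_mono_enorm fun ω => ?_)
      ((hK n k hk).trans_lt ENNReal.coe_lt_top)⟩
    · have := (h1.measurable_enorm hk).ennreal_toReal
      simpa using this.aestronglyMeasurable
    · simp
  exact (h i hi).integrable_mul (h j hj)

omit [IsProbabilityMeasure P] in
lemma CondA2.apply_natCast (h2 : CondA2 P ε γ) (l : ℕ) (t : I) :
    γ l t t = ∫ ω, ε (l + 1) 1 ω t * ε (l + 1) (l + 1) ω t ∂P := by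
  rw [h2 (l + 1) 1 (by simp) (l + 1) (by simp)]
  congr 1
  push_cast
  ring

omit [IsProbabilityMeasure P] in
lemma CondA2.apply_neg (h2 : CondA2 P ε γ) (l : ℕ) (t : I) : γ (-l) t t = γ l t t := by
  have h := h2 (l + 1) (l + 1) (by simp) 1 (by simp) t t
  rw [show ((1 : ℕ) : ℤ) - ((l + 1 : ℕ) : ℤ) = -l by push_cast; ring] at h
  rw [← h, h2.apply_natCast]
  exact integral_congr_ae (Eventually.of_forall fun ω => mul_comm _ _)

omit [IsProbabilityMeasure P] in
lemma CondA2.apply_natAbs (h2 : CondA2 P ε γ) (h : ℤ) (t : I) : γ h.natAbs t t = γ h t t := by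
  rcases Int.natAbs_eq h with e | e
  · rw [← e]
  · conv_rhs => rw [e]
    rw [h2.apply_neg]

/-- The autocovariance functions on the diagonal are continuous. -/
lemma exists_autocov_curve (h1 : CondA1 P ε) (h2 : CondA2 P ε γ) :
    ∃ Γ : ℕ → Curve, ∀ l t, Γ l t = γ l t t := by
  refine ⟨fun l => ⟨fun t => γ l t t, ?_⟩, fun l t => rfl⟩
  simp_rw [h2.apply_natCast]
  have m1 : 1 ∈ Finset.Icc 1 (l + 1) := by simp
  have m2 : l + 1 ∈ Finset.Icc 1 (l + 1) := by simp
  refine continuous_of_dominated (fun t => ((h1.measurable _ _ m1 t).mul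
    (h1.measurable _ _ m2 t)).aestronglyMeasurable) (fun t => Eventually.of_forall fun ω => ?_)
    (integrable_enorm_mul h1 m1 m2)
    (Eventually.of_forall fun ω => (ε _ _ ω).continuous.mul (ε _ _ ω).continuous)
  rw [norm_mul]
  gcongr <;> exact ContinuousMap.norm_coe_le_norm _ t

/-- Lag l is realized between the first and the last time point of row l + 1, to which the
covariance inequality applies at distance l. The constant is free of t because second moments are
bounded by those of the supremum norm. -/
lemma exists_abs_autocov_le (h1 : CondA1 P ε) (h2 : CondA2 P ε γ) : ∃ C : ℝ≥0, ∀ (l : ℕ) t,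
    |γ l t t| ≤ C * phiMixing P ε l ^ (1 / ((2 : ℕ) : ℝ)) := by
  obtain ⟨K, hK⟩ := h1.exists_eLpNorm_two_le
  refine ⟨2 * K * K, fun l t => ?_⟩
  have m1 : 1 ∈ Finset.Icc 1 (l + 1) := by simp
  have m2 : l + 1 ∈ Finset.Icc 1 (l + 1) := by simp
  have hφ0 : 0 ≤ phiMixing P ε l := phiMixing_nonneg l
  have hb := (phiBound_rowSigma (i := 1) (k := l) le_rfl
    (by omega : 1 + l ≤ l + 1)).enorm_integral_mul_le (rowSigma_le h1 le_rfl (by omega))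
    (rowSigma_le h1 (by omega) le_rfl) hφ0 (phiMixing_le_one l)
    (measurable_rowSigma le_rfl le_rfl t) (measurable_rowSigma (by omega : 1 + l ≤ l + 1) le_rfl t)
    ((h1.memLp m1 t).mono_exponent (by norm_num)) ((h1.memLp m2 t).mono_exponent (by norm_num))
    (h1.centred _ _ m2 t)
  rw [← h2.apply_natCast] at hb
  replace hb : ‖γ l t t‖ₑ ≤
      ENNReal.ofReal ((2 * K * K : ℝ≥0) * phiMixing P ε l ^ (1 / ((2 : ℕ) : ℝ))) := by
    refine hb.trans ?_
    have a1 : eLpNorm (fun ω => ε (l + 1) 1 ω t) 2 P ≤ K :=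
      (CondA1.eLpNorm_apply_le t 2).trans (hK _ _ m1)
    have a2 : eLpNorm (fun ω => ε (l + 1) (l + 1) ω t) 2 P ≤ K :=
      (CondA1.eLpNorm_apply_le t 2).trans (hK _ _ m2)
    calc _ ≤ (K : ℝ≥0∞) * (ENNReal.ofReal (2 * phiMixing P ε l ^ (1 / ((2 : ℕ) : ℝ))) * K) := by
          gcongr
      _ = ENNReal.ofReal (K * ((2 * phiMixing P ε l ^ (1 / ((2 : ℕ) : ℝ))) * K)) := by
          rw [ENNReal.ofReal_mul K.coe_nonneg,
            ENNReal.ofReal_mul (mul_nonneg zero_le_two (Real.rpow_nonneg hφ0 _)),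
            ENNReal.ofReal_coe_nnreal]
      _ = _ := by
          congr 1
          push_cast
          ring
  rw [Real.enorm_eq_ofReal_abs] at hb
  exact (ENNReal.ofReal_le_ofReal_iff (by positivity)).1 hb

/-- The autocovariance curves are absolutely summable. -/
lemma summable_norm_autocov (h1 : CondA1 P ε) (h2 : CondA2 P ε γ) {J : ℕ} (hJ : 2 ≤ J)
    (h4 : CondA4 P ε J) {Γ : ℕ → Curve} (hΓ : ∀ l t, Γ l t = γ l t t) :
    Summable fun l => ‖Γ l‖ := by
  obtain ⟨C, hC⟩ := exists_abs_autocov_le h1 h2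
  refine Summable.of_nonneg_of_le (fun _ => norm_nonneg _) (fun l => ?_)
    ((h4.summable_sqrt hJ).mul_left (C : ℝ))
  refine (ContinuousMap.norm_le _ (mul_nonneg C.2
    (Real.rpow_nonneg (phiMixing_nonneg l) _))).2 fun t => ?_
  rw [hΓ]
  exact hC l t

lemma summable_norm_natAbs {Γ : ℕ → Curve} (h : Summable fun l => ‖Γ l‖) :
    Summable fun l : ℤ => ‖Γ l.natAbs‖ :=
  Summable.of_nat_of_neg (by simpa using h) (by simpa using h)

end Autocov

/-! ### Empirical autocovariances of the errors -/

/-- Splitting by residue classes modulo q. With q = l + 1, lag-l products in the same class involve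
disjoint blocks of time points. -/
lemma sum_range_mul_eq {M : Type*} [AddCommMonoid M] (f : ℕ → M) (N q : ℕ) :
    ∑ i ∈ Finset.range (N * q), f i =
      ∑ r ∈ Finset.range q, ∑ k ∈ Finset.range N, f (r + k * q) := by
  induction N with
  | zero => simp
  | succ N ih =>
    rw [add_mul, one_mul, Finset.sum_range_add, ih, ← Finset.sum_add_distrib]
    refine Finset.sum_congr rfl fun r _ => ?_
    rw [Finset.sum_range_succ, add_comm r (N * q)]

lemma enorm_sum_curve_le {ι : Type*} (s : Finset ι) (f : ι → Curve) :
    ‖∑ i ∈ s, f i‖ₑ ≤ ∑ i ∈ s, ‖f i‖ₑ := by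
  simp only [enorm_eq_nnnorm]
  exact_mod_cast nnnorm_sum_le s f

lemma mul_sq_le_pow_four_add (a b : ℝ≥0∞) : (a * b) ^ 2 ≤ a ^ 4 + b ^ 4 := by
  rcases le_total a b with h | h
  · calc (a * b) ^ 2 ≤ (b * b) ^ 2 := by gcongr
      _ = b ^ 4 := by ring
      _ ≤ _ := le_add_self
  · calc (a * b) ^ 2 ≤ (a * a) ^ 2 := by gcongr
      _ = a ^ 4 := by ring
      _ ≤ _ := le_self_add

section Products

variable {Ω : Type*} {mΩ : MeasurableSpace Ω} {P : Measure Ω} [IsProbabilityMeasure P]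
  {ε : ℕ → ℕ → Ω → Curve} {γ : ℤ → I → I → ℝ}

lemma lintegral_le_of_lintegral_sq_le {f : Ω → ℝ≥0∞} (hf : Measurable f) {c : ℝ≥0∞}
    (h : ∫⁻ ω, f ω ^ 2 ∂P ≤ c ^ 2) : ∫⁻ ω, f ω ∂P ≤ c := by
  have h2 : eLpNorm f 2 P ≤ c :=
    eLpNorm_le_of_lintegral_pow_le (p := 2) (by norm_num) (by simpa only [enorm_eq_self] using h)
  have h1 := eLpNorm_le_eLpNorm_of_exponent_le (p := 1) (q := 2) (by norm_num)
    (hf.aestronglyMeasurable (μ := P))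
  rw [eLpNorm_one_eq_lintegral_enorm] at h1
  simp only [enorm_eq_self] at h1
  exact h1.trans h2

omit [IsProbabilityMeasure P] in
lemma measurable_mul_apply (h1 : CondA1 P ε) {n i j : ℕ} (hi : i ∈ Finset.Icc 1 n)
    (hj : j ∈ Finset.Icc 1 n) (t : I) : Measurable fun ω => (ε n i ω * ε n j ω) t :=
  (h1.measurable n i hi t).mul (h1.measurable n j hj t)

lemma integrable_mul_apply (h1 : CondA1 P ε) {n i j : ℕ} (hi : i ∈ Finset.Icc 1 n)
    (hj : j ∈ Finset.Icc 1 n) (t : I) : Integrable (fun ω => (ε n i ω * ε n j ω) t) P :=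
  ((h1.memLp hi t).mono_exponent (q := 4) (p := 2) (by norm_num)).integrable_mul
    ((h1.memLp hj t).mono_exponent (q := 4) (p := 2) (by norm_num))

omit [IsProbabilityMeasure P] in
lemma CondA1.exists_eLpNorm_mul_le (h1 : CondA1 P ε) : ∃ K : ℝ≥0, ∀ n, ∀ i ∈ Finset.Icc 1 n,
    ∀ j ∈ Finset.Icc 1 n, ∀ t, eLpNorm (fun ω => (ε n i ω * ε n j ω) t) 2 P ≤ K := by
  obtain ⟨C, hC⟩ := h1.moment
  refine ⟨1 + (C + C), fun n i hi j hj t => eLpNorm_le_coe_of_lintegral_pow_le (p := 2)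
    (by norm_num) (c := C + C) ?_ le_rfl⟩
  calc ∫⁻ ω, ‖(ε n i ω * ε n j ω) t‖ₑ ^ 2 ∂P ≤ ∫⁻ ω, (‖ε n i ω‖ₑ ^ 4 + ‖ε n j ω‖ₑ ^ 4) ∂P := by
        refine lintegral_mono fun ω => le_trans ?_ (mul_sq_le_pow_four_add _ _)
        rw [ContinuousMap.mul_apply, enorm_mul]
        gcongr <;> exact enorm_apply_le _ t
    _ = ∫⁻ ω, ‖ε n i ω‖ₑ ^ 4 ∂P + ∫⁻ ω, ‖ε n j ω‖ₑ ^ 4 ∂P :=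
        lintegral_add_left ((h1.measurable_enorm hi).pow_const 4) _
    _ ≤ _ := by
        push_cast
        exact add_le_add (hC n i hi) (hC n j hj)

omit [IsProbabilityMeasure P] in
/-- The increments of the product of two errors. -/
lemma eLpNorm_mul_sub_mul_le (h1 : CondA1 P ε) {J : ℕ} (hJ : 2 ≤ J) {ρ : I → I → ℝ}
    {M : ℕ → ℕ → Ω → ℝ≥0} {C : ℝ≥0}
    (hM : ∀ n, ∀ j ∈ Finset.Icc 1 n, Measurable (M n j) ∧
      (∀ᵐ ω ∂P, ∀ t u, |ε n j ω t - ε n j ω u| ≤ M n j ω * ρ t u) ∧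
      ∫⁻ ω, (M n j ω : ℝ≥0∞) ^ J ∂P ≤ C ∧
      ∀ i ∈ Finset.Icc 1 n, ∫⁻ ω, (‖ε n i ω‖ₑ * (M n j ω : ℝ≥0∞)) ^ J ∂P ≤ C)
    {n i j : ℕ} (hi : i ∈ Finset.Icc 1 n) (hj : j ∈ Finset.Icc 1 n) (t u : I) :
    eLpNorm (fun ω => (ε n i ω * ε n j ω) t - (ε n i ω * ε n j ω) u) J P ≤
      (2 * (1 + C) : ℝ≥0) * ENNReal.ofReal (ρ t u) := by
  have hJ1 : (1 : ℝ≥0∞) ≤ J := by exact_mod_cast (by omega : 1 ≤ J)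
  have key : ∀ a ∈ Finset.Icc 1 n, ∀ b ∈ Finset.Icc 1 n, ∀ v : I,
      eLpNorm (fun ω => ε n a ω v * (ε n b ω t - ε n b ω u)) J P ≤
        (1 + C : ℝ≥0) * ENNReal.ofReal (ρ t u) := by
    intro a ha b hb v
    obtain ⟨-, hl, -, hm⟩ := hM n b hb
    refine eLpNorm_le_of_ae_le_mul (by omega) ENNReal.ofReal_ne_top (hm a ha) le_rfl ?_
    filter_upwards [hl] with ω hω
    rw [enorm_mul, mul_assoc]
    gcongr
    · exact enorm_apply_le _ v
    · rw [← ENNReal.ofReal_coe_nnreal, ← ENNReal.ofReal_mul (NNReal.coe_nonneg _),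
        Real.enorm_eq_ofReal_abs]
      exact ENNReal.ofReal_le_ofReal (hω t u)
  -- Product rule for increments: each term is a value of one error times an increment of the other,
  -- which is what the moment bound for ‖ε‖ M covers.
  have e : (fun ω => (ε n i ω * ε n j ω) t - (ε n i ω * ε n j ω) u) =
      (fun ω => ε n i ω t * (ε n j ω t - ε n j ω u)) +
        fun ω => ε n j ω u * (ε n i ω t - ε n i ω u) := by
    funext ω
    simp only [ContinuousMap.mul_apply, Pi.add_apply]
    ring
  rw [e]
  have mi := h1.measurable n i hi
  have mj := h1.measurable n j hj
  refine (eLpNorm_add_le ((mi t).mul ((mj t).sub (mj u))).aestronglyMeasurable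
    ((mj u).mul ((mi t).sub (mi u))).aestronglyMeasurable hJ1).trans ?_
  refine (add_le_add (key i hi j hj t) (key j hj i hi u)).trans (le_of_eq ?_)
  push_cast
  ring

/-- The mean deviation of the empirical lag `l` autocovariance of the errors. -/
lemma exists_lintegral_sum_mul_le (h1 : CondA1 P ε) (h2 : CondA2 P ε γ) {J : ℕ} (hJ2 : Even J)
    (hJ : 2 ≤ J) (h3 : CondA3 P ε J) (h4 : CondA4 P ε J) {Γ : ℕ → Curve}
    (hΓ : ∀ l t, Γ l t = γ l t t) : ∃ C : ℝ≥0, ∀ n l, l < n →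
      ∫⁻ ω, ‖∑ j ∈ Finset.range (n - l), (ε n (1 + j) ω * ε n (1 + j + l) ω - Γ l)‖ₑ ∂P ≤
        C * ENNReal.ofReal √(n * (l + 1)) := by
  obtain ⟨ρ, M, τ, C, hpos, hzero, hsymm, -, hτ, hent, hM⟩ := h3
  obtain ⟨K, hK⟩ := h1.exists_eLpNorm_mul_le
  set K' : ℝ≥0 := 2 * K + 2 * (2 * (1 + C)) with hK'
  obtain ⟨D, hD⟩ := exists_sum_blocks_bound h1 hJ2 hJ h4 (fun t => (hzero t t).2 rfl) hsymm
    hτ hent K'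
  have hJ1 : (1 : ℝ≥0∞) ≤ J := by exact_mod_cast (by omega : 1 ≤ J)
  refine ⟨NNReal.sqrt (2 * D), fun n l hln => ?_⟩
  set W : ℕ → Ω → Curve := fun j ω =>
    if 1 ≤ j ∧ j + l ≤ n then ε n j ω * ε n (j + l) ω - Γ l else 0 with hW
  have m1 : ∀ {j}, 1 ≤ j ∧ j + l ≤ n → j ∈ Finset.Icc 1 n := fun h =>
    Finset.mem_Icc.2 ⟨h.1, by omega⟩
  have m2 : ∀ {j}, 1 ≤ j ∧ j + l ≤ n → j + l ∈ Finset.Icc 1 n := fun h =>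
    Finset.mem_Icc.2 ⟨by omega, h.2⟩
  have hmean : ∀ {j}, 1 ≤ j ∧ j + l ≤ n → ∀ t, ∫ ω, (ε n j ω * ε n (j + l) ω) t ∂P = Γ l t := by
    intro j h t
    rw [hΓ]
    have := h2 n j (m1 h) (j + l) (m2 h) t t
    rw [show ((j + l : ℕ) : ℤ) - (j : ℤ) = l by push_cast; ring] at this
    exact this
  have hWm : ∀ j t, Measurable[rowSigma ε n j (min (j + l) n)] fun ω => W j ω t := by
    intro j t
    simp only [hW]
    split_ifs with h
    · exact ((measurable_rowSigma le_rfl (by omega) t).mul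
        (measurable_rowSigma (by omega) (by omega) t)).sub_const _
    · exact measurable_const
  have hWm' : ∀ j t, Measurable fun ω => W j ω t := by
    intro j t
    simp only [hW]
    split_ifs with h
    · exact (measurable_mul_apply h1 (m1 h) (m2 h) t).sub_const _
    · exact measurable_const
  have hW0 : ∀ j t, ∫ ω, W j ω t ∂P = 0 := by
    intro j t
    simp only [hW]
    split_ifs with h
    · simp only [ContinuousMap.sub_apply]
      rw [integral_sub (integrable_mul_apply h1 (m1 h) (m2 h) t) (integrable_const _), hmean h t]
      simp
    · simp
  have hW2 : ∀ j t, eLpNorm (fun ω => W j ω t) 2 P ≤ K' := by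
    intro j t
    simp only [hW]
    split_ifs with h
    · simp only [ContinuousMap.sub_apply]
      rw [← hmean h t]
      refine (eLpNorm_sub_integral_le (by norm_num)
        (measurable_mul_apply h1 (m1 h) (m2 h) t).aestronglyMeasurable).trans ?_
      calc _ ≤ 2 * (K : ℝ≥0∞) := by gcongr; exact hK n _ (m1 h) _ (m2 h) t
        _ ≤ K' := by
          simp only [hK']
          push_cast
          exact le_self_add
    · simp
  have hWJ : ∀ j t u, eLpNorm (fun ω => W j ω t - W j ω u) J P ≤
      K' * ENNReal.ofReal (ρ t u) := by
    intro j t u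
    simp only [hW]
    split_ifs with h
    · simp only [ContinuousMap.sub_apply]
      have e : ∀ ω, (ε n j ω * ε n (j + l) ω) t - Γ l t - ((ε n j ω * ε n (j + l) ω) u - Γ l u) =
          ((ε n j ω * ε n (j + l) ω) t - (ε n j ω * ε n (j + l) ω) u) -
          ∫ ω, ((ε n j ω * ε n (j + l) ω) t - (ε n j ω * ε n (j + l) ω) u) ∂P := by
        intro ω
        rw [integral_sub (integrable_mul_apply h1 (m1 h) (m2 h) t)
          (integrable_mul_apply h1 (m1 h) (m2 h) u), hmean h t, hmean h u]
        ring
      simp_rw [e]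
      refine (eLpNorm_sub_integral_le hJ1 ((measurable_mul_apply h1 (m1 h) (m2 h) t).sub
        (measurable_mul_apply h1 (m1 h) (m2 h) u)).aestronglyMeasurable).trans ?_
      calc _ ≤ 2 * ((2 * (1 + C) : ℝ≥0) * ENNReal.ofReal (ρ t u)) := by
            gcongr
            exact eLpNorm_mul_sub_mul_le h1 hJ hM (m1 h) (m2 h) t u
        _ ≤ K' * ENNReal.ofReal (ρ t u) := by
            rw [← mul_assoc]
            gcongr
            simp only [hK']
            push_cast
            exact le_add_self
    · simp
  have hWl : ∀ j, ∀ᵐ ω ∂P, ∃ L : ℝ, 0 ≤ L ∧ ∀ t u, |W j ω t - W j ω u| ≤ L * ρ t u := by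
    intro j
    simp only [hW]
    split_ifs with h
    · obtain ⟨-, hl1, -, -⟩ := hM n _ (m1 h)
      obtain ⟨-, hl2, -, -⟩ := hM n _ (m2 h)
      -- The mean curve inherits a ρ-Lipschitz bound from the L^J bound for the increments of the
      -- products, so the centred products remain Lipschitz.
      have hΓl : ∀ t u, |Γ l t - Γ l u| ≤ (2 * (1 + C) : ℝ≥0) * ρ t u := by
        intro t u
        have h' := (enorm_integral_le_eLpNorm hJ1 ((measurable_mul_apply h1 (m1 h) (m2 h) t).sub
          (measurable_mul_apply h1 (m1 h) (m2 h) u)).aestronglyMeasurable).trans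
          (eLpNorm_mul_sub_mul_le h1 hJ hM (m1 h) (m2 h) t u)
        simp only [Pi.sub_apply] at h'
        rw [integral_sub (integrable_mul_apply h1 (m1 h) (m2 h) t)
          (integrable_mul_apply h1 (m1 h) (m2 h) u), hmean h t, hmean h u,
          ← ENNReal.ofReal_coe_nnreal, ← ENNReal.ofReal_mul (NNReal.coe_nonneg _),
          Real.enorm_eq_ofReal_abs] at h'
        exact (ENNReal.ofReal_le_ofReal_iff (mul_nonneg (NNReal.coe_nonneg _) (hpos t u))).1 h'
      filter_upwards [hl1, hl2] with ω hω1 hω2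
      refine ⟨‖ε n j ω‖ * M n (j + l) ω + ‖ε n (j + l) ω‖ * M n j ω + (2 * (1 + C) : ℝ≥0),
        by positivity, fun t u => ?_⟩
      have e : (ε n j ω * ε n (j + l) ω - Γ l) t - (ε n j ω * ε n (j + l) ω - Γ l) u =
          ε n j ω t * (ε n (j + l) ω t - ε n (j + l) ω u) +
          ε n (j + l) ω u * (ε n j ω t - ε n j ω u) - (Γ l t - Γ l u) := by
        simp only [ContinuousMap.mul_apply, ContinuousMap.sub_apply]
        ring
      rw [e]
      refine (abs_sub _ _).trans ((add_le_add_left (abs_add_le _ _) _).trans ?_)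
      rw [abs_mul, abs_mul, add_mul, add_mul, mul_assoc, mul_assoc]
      gcongr
      · exact (ε n j ω).norm_coe_le_norm t
      · exact hω2 t u
      · exact (ε n (j + l) ω).norm_coe_le_norm u
      · exact hω1 t u
      · exact hΓl t u
    · exact Eventually.of_forall fun ω => ⟨0, le_rfl, fun t u => by simp⟩
  -- The length of each residue class, rounded up; terms beyond the row are zero. Since l < n, it is
  -- at most 2n/(l+1).
  set N := n / (l + 1) + 1 with hN
  have hNn : n ≤ N * (l + 1) := by
    have := Nat.div_add_mod n (l + 1)
    have h' : n % (l + 1) < l + 1 := Nat.mod_lt n (Nat.succ_pos l)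
    rw [hN, add_mul, one_mul, mul_comm]
    omega
  have hsum : ∀ ω, ∑ j ∈ Finset.range (n - l), (ε n (1 + j) ω * ε n (1 + j + l) ω - Γ l) =
      ∑ r ∈ Finset.range (l + 1), ∑ k ∈ Finset.range N, W (1 + r + k * (l + 1)) ω := by
    intro ω
    have h := sum_range_mul_eq (fun i => W (1 + i) ω) N (l + 1)
    simp only [← add_assoc] at h
    rw [← h, ← Finset.sum_subset (Finset.range_subset_range.2 (by omega : n - l ≤ N * (l + 1)))]
    · refine Finset.sum_congr rfl fun j hj => ?_
      rw [Finset.mem_range] at hj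
      simp only [hW]
      rw [if_pos ⟨by omega, by omega⟩]
    · intro j _ hj
      rw [Finset.mem_range] at hj
      simp only [hW]
      rw [if_neg (by omega)]
  have hc : (D : ℝ≥0∞) * N ≤ (NNReal.sqrt (2 * D) * ENNReal.ofReal √(n / (l + 1))) ^ 2 := by
    rw [mul_pow, ← ENNReal.ofReal_pow (Real.sqrt_nonneg _), Real.sq_sqrt (by positivity)]
    have e : ((NNReal.sqrt (2 * D) : ℝ≥0) : ℝ≥0∞) ^ 2 = 2 * D := by
      rw [← ENNReal.coe_pow, NNReal.sq_sqrt]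
      push_cast; rfl
    rw [e, mul_comm 2 (D : ℝ≥0∞), mul_assoc]
    gcongr
    rw [← ENNReal.ofReal_natCast, ← ENNReal.ofReal_ofNat, ← ENNReal.ofReal_mul (by norm_num)]
    refine ENNReal.ofReal_le_ofReal ?_
    rw [hN]
    push_cast
    have a1 : ((n / (l + 1) : ℕ) : ℝ) ≤ (n : ℝ) / ((l + 1 : ℕ) : ℝ) := Nat.cast_div_le
    push_cast at a1
    have a2 : (1 : ℝ) ≤ n / (l + 1) := by
      rw [le_div_iff₀ (by positivity), one_mul]
      exact_mod_cast hln
    linarith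
  calc ∫⁻ ω, ‖∑ j ∈ Finset.range (n - l), (ε n (1 + j) ω * ε n (1 + j + l) ω - Γ l)‖ₑ ∂P
      ≤ ∫⁻ ω, ∑ r ∈ Finset.range (l + 1),
          ‖∑ k ∈ Finset.range N, W (1 + r + k * (l + 1)) ω‖ₑ ∂P := by
        refine lintegral_mono fun ω => ?_
        rw [hsum]
        exact enorm_sum_curve_le _ _
    _ = ∑ r ∈ Finset.range (l + 1),
          ∫⁻ ω, ‖∑ k ∈ Finset.range N, W (1 + r + k * (l + 1)) ω‖ₑ ∂P := by
        refine lintegral_finsetSum _ fun r _ => measurable_enorm_curve fun t => ?_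
        simp only [ContinuousMap.coe_sum, Finset.sum_apply]
        exact Finset.measurable_fun_sum _ fun k _ => hWm' _ t
    -- Only the triangle inequality is used between the classes: l + 1 of them, each of order
    -- √(n/(l+1)), give √(n(l+1)).
    _ ≤ ∑ r ∈ Finset.range (l + 1), NNReal.sqrt (2 * D) * ENNReal.ofReal √(n / (l + 1)) := by
        refine Finset.sum_le_sum fun r _ => lintegral_le_of_lintegral_sq_le
          (measurable_enorm_curve fun t => ?_) (le_trans ?_ hc)
        · simp only [ContinuousMap.coe_sum, Finset.sum_apply]
          exact Finset.measurable_fun_sum _ fun k _ => hWm' _ t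
        · exact hD n (1 + r) l N (fun k => W (1 + r + k * (l + 1))) (by omega)
            (fun k t => hWm _ t) (fun k t => hW0 _ t) (fun k t => hW2 _ t)
            (fun k t u => hWJ _ t u) (fun k => hWl _)
    _ = _ := by
        rw [Finset.sum_const, Finset.card_range, nsmul_eq_mul, mul_left_comm]
        congr 1
        rw [← ENNReal.ofReal_natCast, ← ENNReal.ofReal_mul (by positivity)]
        congr 1
        push_cast
        rw [← Real.sqrt_sq (by positivity : (0 : ℝ) ≤ l + 1), ← Real.sqrt_mul (by positivity),
          Real.sqrt_sq (by positivity)]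
        congr 1
        field_simp

end Products

/-! ### A maximal inequality of Rademacher–Menshov type -/

/-- The sum of the squared norms of the sums of `w` over all dyadic blocks in
`a, …, a + 2 ^ K - 1`. -/
def dyadicSum (w : ℕ → Curve) : ℕ → ℕ → ℝ≥0∞
  | 0, a => ‖w a‖ₑ ^ 2
  | K + 1, a => dyadicSum w K a + dyadicSum w K (a + 2 ^ K) +
      ‖∑ j ∈ Finset.Ico a (a + 2 ^ K), w j‖ₑ ^ 2

/-- Cauchy–Schwarz with weights 1 and K + 1: one more block increases the factor by one. -/
lemma add_sq_le_of_sq_le {b x R : ℝ≥0∞} {K : ℕ} (h : x ^ 2 ≤ (K + 1 : ℕ) * R) :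
    (b + x) ^ 2 ≤ (K + 2 : ℕ) * (R + b ^ 2) := by
  rcases eq_or_ne b ∞ with rfl | hb
  · simp
  rcases eq_or_ne R ∞ with rfl | hR
  · simp
  have hx : x ≠ ∞ := by
    rintro rfl
    have : (K + 1 : ℕ) * R ≠ ∞ := ENNReal.mul_ne_top (ENNReal.natCast_ne_top _) hR
    simp only [ne_eq, OfNat.ofNat_ne_zero, not_false_eq_true, ENNReal.top_pow, top_le_iff] at h
    exact this h
  lift b to ℝ≥0 using hb
  lift R to ℝ≥0 using hR
  lift x to ℝ≥0 using hx
  have h' : (x : ℝ) ^ 2 ≤ (K + 1 : ℕ) * R := by exact_mod_cast h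
  have : ((b : ℝ) + x) ^ 2 ≤ (K + 2 : ℕ) * (R + b ^ 2) := by
    push_cast at h' ⊢
    have hK : (0 : ℝ) < K + 1 := by positivity
    have h2 : (K + 1 : ℝ) * ((b : ℝ) + x) ^ 2 ≤ (K + 1) * ((K + 2) * (R + b ^ 2)) := by
      nlinarith [sq_nonneg ((x : ℝ) - (K + 1) * b)]
    exact le_of_mul_le_mul_left h2 hK
  exact_mod_cast this

lemma enorm_curve_add_le (f g : Curve) : ‖f + g‖ₑ ≤ ‖f‖ₑ + ‖g‖ₑ := by
  simp only [enorm_eq_nnnorm]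
  exact_mod_cast nnnorm_add_le f g

/-- A prefix of length at most 2^K is a union of at most K + 1 dyadic blocks, one per level, and
Cauchy–Schwarz yields the factor K + 1. If the prefix passes the midpoint, it consists of the whole
left half and a prefix of the right half; so of the blocks longer than one point only left halves
are needed. -/
lemma enorm_sum_sq_le_dyadicSum (w : ℕ → Curve) (K a h : ℕ) (hh : h ≤ 2 ^ K) :
    ‖∑ j ∈ Finset.Ico a (a + h), w j‖ₑ ^ 2 ≤ (K + 1 : ℕ) * dyadicSum w K a := by
  induction K generalizing a h with
  | zero =>
    rw [pow_zero] at hh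
    interval_cases h
    · simp [enorm_eq_nnnorm]
    · simp [dyadicSum]
  | succ K ih =>
    rcases le_total h (2 ^ K) with h1 | h1
    · refine (ih a h h1).trans ?_
      rw [dyadicSum]
      gcongr
      · exact Nat.le_succ _
      · exact le_self_add.trans le_self_add
    · obtain ⟨g, rfl⟩ := Nat.exists_eq_add_of_le h1
      rw [pow_succ] at hh
      have h2 := ih (a + 2 ^ K) g (by omega)
      rw [← Finset.sum_Ico_consecutive w (Nat.le_add_right a (2 ^ K)) (by omega), dyadicSum,
        ← add_assoc]
      refine (pow_le_pow_left₀ bot_le (enorm_curve_add_le _ _) 2).trans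
        ((add_sq_le_of_sq_le h2).trans ?_)
      gcongr
      exact le_add_self

section Maximal

variable {Ω : Type*} {mΩ : MeasurableSpace Ω} {P : Measure Ω} {v : ℕ → Ω → Curve} {C : ℝ≥0}

lemma measurable_enorm_sum (hv : ∀ j t, Measurable fun ω => v j ω t) (s : Finset ℕ) :
    Measurable fun ω => ‖∑ j ∈ s, v j ω‖ₑ := by
  refine measurable_enorm_curve fun t => ?_
  simp only [ContinuousMap.coe_sum, Finset.sum_apply]
  exact Finset.measurable_fun_sum _ fun k _ => hv k t

lemma measurable_dyadicSum (hv : ∀ j t, Measurable fun ω => v j ω t) (K a : ℕ) :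
    Measurable fun ω => dyadicSum (fun j => v j ω) K a := by
  induction K generalizing a with
  | zero => exact (measurable_enorm_curve (hv a)).pow_const 2
  | succ K ih =>
    exact ((ih _).add (ih _)).add ((measurable_enorm_sum hv _).pow_const 2)

/-- Each of the K + 1 levels consists of disjoint blocks of total length at most 2^K. -/
lemma lintegral_dyadicSum_le (hv : ∀ j t, Measurable fun ω => v j ω t)
    (hC : ∀ i j, ∫⁻ ω, ‖∑ l ∈ Finset.Ico i j, v l ω‖ₑ ^ 2 ∂P ≤ C * (j - i : ℕ)) (K a : ℕ) :
    ∫⁻ ω, dyadicSum (fun j => v j ω) K a ∂P ≤ C * ((K + 1) * 2 ^ K : ℕ) := by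
  induction K generalizing a with
  | zero => simpa [dyadicSum] using hC a (a + 1)
  | succ K ih =>
    simp only [dyadicSum]
    rw [lintegral_add_right _ ((measurable_enorm_sum hv _).pow_const 2),
      lintegral_add_left (measurable_dyadicSum hv _ _)]
    refine (add_le_add (add_le_add (ih _) (ih _)) (hC _ _)).trans ?_
    rw [Nat.add_sub_cancel_left, ← mul_add, ← mul_add]
    gcongr
    norm_cast
    rw [pow_succ]
    nlinarith [Nat.pos_of_ne_zero (pow_ne_zero K two_ne_zero)]

/-- The probability that one of the first `2 ^ K` partial sums is larger than `x`. -/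
lemma measure_exists_norm_sum_gt_le (hv : ∀ j t, Measurable fun ω => v j ω t)
    (hC : ∀ i j, ∫⁻ ω, ‖∑ l ∈ Finset.Ico i j, v l ω‖ₑ ^ 2 ∂P ≤ C * (j - i : ℕ)) (K : ℕ)
    {x : ℝ} (hx : 0 < x) :
    P {ω | ∃ h ≤ 2 ^ K, x < ‖∑ j ∈ Finset.range h, v j ω‖} ≤
      ENNReal.ofReal (C * (K + 1) ^ 2 * 2 ^ K / x ^ 2) := by
  have hsub : {ω | ∃ h ≤ 2 ^ K, x < ‖∑ j ∈ Finset.range h, v j ω‖} ⊆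
      {ω | ENNReal.ofReal (x ^ 2) ≤ (K + 1 : ℕ) * dyadicSum (fun j => v j ω) K 0} := by
    rintro ω ⟨h, hh, hxh⟩
    refine le_trans ?_ (enorm_sum_sq_le_dyadicSum (fun j => v j ω) K 0 h hh)
    rw [zero_add, ← Finset.range_eq_Ico, ← ofReal_norm,
      ← ENNReal.ofReal_pow (norm_nonneg _)]
    exact ENNReal.ofReal_le_ofReal (pow_le_pow_left₀ hx.le hxh.le 2)
  refine (measure_mono hsub).trans ((meas_ge_le_lintegral_div
    ((measurable_dyadicSum hv K 0).const_mul _).aemeasurable (by positivity)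
    ENNReal.ofReal_ne_top).trans ?_)
  rw [ENNReal.ofReal_div_of_pos (by positivity)]
  gcongr
  rw [lintegral_const_mul _ (measurable_dyadicSum hv K 0)]
  refine (mul_le_mul_right (lintegral_dyadicSum_le hv hC K 0) _).trans (le_of_eq ?_)
  rw [← ENNReal.ofReal_coe_nnreal, ← ENNReal.ofReal_natCast, ← ENNReal.ofReal_natCast,
    ← ENNReal.ofReal_mul (NNReal.coe_nonneg _), ← ENNReal.ofReal_mul (Nat.cast_nonneg _)]
  congr 1
  push_cast
  ring

/-- The partial sums are of the order `√h`, up to a logarithmic factor. -/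
lemma measure_exists_norm_sum_gt_sqrt_le (hv : ∀ j t, Measurable fun ω => v j ω t)
    (hC : ∀ i j, ∫⁻ ω, ‖∑ l ∈ Finset.Ico i j, v l ω‖ₑ ^ 2 ∂P ≤ C * (j - i : ℕ)) (n : ℕ)
    {a : ℝ} (ha : 0 < a) :
    P {ω | ∃ h ≤ n, a * √h < ‖∑ j ∈ Finset.range h, v j ω‖} ≤
      ENNReal.ofReal (2 * C * (Nat.log 2 n + 2) ^ 3 / a ^ 2) := by
  set L := Nat.log 2 n
  -- Peeling: lengths between 2^k and 2^{k+1} are treated together, with the envelope replaced by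
  -- its value at 2^k. Each scale costs O((log n)²/a²), and there are O(log n) scales.
  have hsub : {ω | ∃ h ≤ n, a * √h < ‖∑ j ∈ Finset.range h, v j ω‖} ⊆
      ⋃ k ∈ Finset.range (L + 1), {ω | ∃ h ≤ 2 ^ (k + 1),
        a * √(2 ^ k) < ‖∑ j ∈ Finset.range h, v j ω‖} := by
    rintro ω ⟨h, hh, hah⟩
    have h0 : h ≠ 0 := by
      rintro rfl
      simp at hah
    simp only [Set.mem_iUnion, Finset.mem_range]
    refine ⟨Nat.log 2 h, Nat.lt_succ_of_le (Nat.log_mono_right hh), h,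
      (Nat.lt_pow_succ_log_self one_lt_two h).le, lt_of_le_of_lt ?_ hah⟩
    gcongr
    exact_mod_cast Nat.pow_log_le_self 2 h0
  refine (measure_mono hsub).trans ((measure_biUnion_finset_le _ _).trans ?_)
  calc _ ≤ ∑ k ∈ Finset.range (L + 1), ENNReal.ofReal (2 * C * (L + 2) ^ 2 / a ^ 2) := by
        refine Finset.sum_le_sum fun k hk => (measure_exists_norm_sum_gt_le hv hC (k + 1)
          (mul_pos ha (Real.sqrt_pos.2 (by positivity)))).trans (ENNReal.ofReal_le_ofReal ?_)
        rw [Finset.mem_range, Nat.lt_succ_iff] at hk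
        rw [mul_pow, Real.sq_sqrt (by positivity), pow_succ 2 k]
        have hk' : (k : ℝ) ≤ L := by exact_mod_cast hk
        calc _ = 2 * C * (k + 2) ^ 2 / a ^ 2 := by
              push_cast
              field_simp
              ring
          _ ≤ _ := by gcongr
    _ = ENNReal.ofReal ((L + 1 : ℕ) * (2 * C * (L + 2) ^ 2 / a ^ 2)) := by
        rw [Finset.sum_const, Finset.card_range, nsmul_eq_mul, ENNReal.ofReal_mul (by positivity),
          ENNReal.ofReal_natCast]
    _ ≤ _ := by
        refine ENNReal.ofReal_le_ofReal ?_
        calc _ ≤ ((L : ℝ) + 2) * (2 * C * (L + 2) ^ 2 / a ^ 2) := by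
              gcongr
              push_cast
              linarith
          _ = _ := by ring

lemma summable_dyadic : Summable fun k : ℕ => ((k : ℝ) + 2) ^ 2 / 2 ^ k := by
  have h := summable_pow_mul_geometric_of_norm_lt_one (R := ℝ) 2
    (r := 1 / 2) (by rw [Real.norm_eq_abs, abs_of_pos] <;> norm_num)
  have h2 := ((summable_nat_add_iff 2).2 h).mul_left 4
  refine h2.congr fun k => ?_
  push_cast
  rw [pow_add, one_div, inv_pow]
  field_simp
  ring

/-- The long partial sums are small compared to their length. -/
lemma measure_exists_norm_sum_gt_mul_le (hv : ∀ j t, Measurable fun ω => v j ω t)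
    (hC : ∀ i j, ∫⁻ ω, ‖∑ l ∈ Finset.Ico i j, v l ω‖ₑ ^ 2 ∂P ≤ C * (j - i : ℕ)) (k₀ : ℕ)
    {η : ℝ} (hη : 0 < η) :
    P {ω | ∃ h ≥ 2 ^ k₀, η * h < ‖∑ j ∈ Finset.range h, v j ω‖} ≤
      ENNReal.ofReal (2 * C / η ^ 2 * ∑' k : ℕ, (((k + k₀ : ℕ) : ℝ) + 2) ^ 2 / 2 ^ (k + k₀)) := by
  -- Peeling again: with a linear envelope the cost of scale k is of order (k+2)²/2^k, so the union
  -- over all scales beyond k₀ is the tail of a convergent series.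
  have hsub : {ω | ∃ h ≥ 2 ^ k₀, η * h < ‖∑ j ∈ Finset.range h, v j ω‖} ⊆
      ⋃ k : ℕ, {ω | ∃ h ≤ 2 ^ (k + k₀ + 1),
        η * 2 ^ (k + k₀) < ‖∑ j ∈ Finset.range h, v j ω‖} := by
    rintro ω ⟨h, hh, hah⟩
    have h0 : h ≠ 0 := by
      rintro rfl
      simp at hah
    have hk : k₀ ≤ Nat.log 2 h := Nat.le_log_of_pow_le one_lt_two hh
    simp only [Set.mem_iUnion]
    refine ⟨Nat.log 2 h - k₀, h, ?_, ?_⟩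
    · rw [Nat.sub_add_cancel hk]
      exact (Nat.lt_pow_succ_log_self one_lt_two h).le
    · rw [Nat.sub_add_cancel hk]
      refine lt_of_le_of_lt ?_ hah
      gcongr
      exact_mod_cast Nat.pow_log_le_self 2 h0
  have hs := ((summable_nat_add_iff k₀).2 summable_dyadic).mul_left (2 * C / η ^ 2)
  refine (measure_mono hsub).trans ((measure_iUnion_le _).trans ?_)
  rw [← tsum_mul_left, ENNReal.ofReal_tsum_of_nonneg (fun k => by positivity) hs]
  refine ENNReal.tsum_le_tsum fun k => (measure_exists_norm_sum_gt_le hv hC (k + k₀ + 1)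
    (by positivity)).trans (ENNReal.ofReal_le_ofReal (le_of_eq ?_))
  push_cast
  rw [pow_succ 2 (k + k₀)]
  field_simp
  ring

end Maximal

/-! ### Uniform bounds for the partial sums of a row -/

section RowSums

variable {Ω : Type*} {mΩ : MeasurableSpace Ω} {P : Measure Ω} [IsProbabilityMeasure P]
  {ε : ℕ → ℕ → Ω → Curve}

/-- The fluctuation of the partial sums of a row around the time `t`. -/
lemma exists_measure_partial_sum_gt_le (h1 : CondA1 P ε) {J : ℕ} (hJ2 : Even J) (hJ : 2 ≤ J)
    (h3 : CondA3 P ε J) (h4 : CondA4 P ε J) : ∃ C : ℝ≥0, ∀ n t : ℕ, 1 ≤ t → t ≤ n + 1 →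
      ∀ (a η : ℝ) (k₀ : ℕ), 0 < a → 0 < η →
      P {ω | ∃ b : ℕ, 1 ≤ b ∧ b ≤ n + 1 ∧
        (a * √|(b : ℝ) - t| < ‖∑ j ∈ Finset.range b, ε n j ω - ∑ j ∈ Finset.range t, ε n j ω‖ ∨
        (2 ^ k₀ : ℝ) ≤ |(b : ℝ) - t| ∧ η * |(b : ℝ) - t| <
          ‖∑ j ∈ Finset.range b, ε n j ω - ∑ j ∈ Finset.range t, ε n j ω‖)} ≤
      2 * (ENNReal.ofReal (2 * C * (Nat.log 2 (n + 1) + 2) ^ 3 / a ^ 2) + ENNReal.ofReal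
        (2 * C / η ^ 2 * ∑' k : ℕ, (((k + k₀ : ℕ) : ℝ) + 2) ^ 2 / 2 ^ (k + k₀))) := by
  obtain ⟨C, hC⟩ := exists_lintegral_sum_sq_le h1 hJ2 hJ h3 h4
  refine ⟨C, fun n t ht1 htn a η k₀ ha hη => ?_⟩
  -- The row is extended by zero, since the maximal inequalities ask for bounds over all index
  -- ranges.
  set e : ℕ → Ω → Curve := fun j ω => if 1 ≤ j ∧ j ≤ n then ε n j ω else 0 with he
  have hem : ∀ j t, Measurable fun ω => e j ω t := by
    intro j t
    simp only [he]
    split_ifs with h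
    · exact h1.measurable n j (Finset.mem_Icc.2 h) t
    · exact measurable_const
  have heC : ∀ i j, ∫⁻ ω, ‖∑ l ∈ Finset.Ico i j, e l ω‖ₑ ^ 2 ∂P ≤ C * (j - i : ℕ) := by
    intro i j
    have hs : ∀ ω, ∑ l ∈ Finset.Ico i j, e l ω =
        ∑ l ∈ Finset.Ico (max i 1) (min j (n + 1)), ε n l ω := by
      intro ω
      simp only [he]
      rw [← Finset.sum_filter]
      refine Finset.sum_congr ?_ fun _ _ => rfl
      ext l
      simp only [Finset.mem_filter, Finset.mem_Ico]
      omega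
    simp_rw [hs]
    refine (hC n _ _ (le_max_right _ _) (min_le_right _ _)).trans ?_
    gcongr
    · exact min_le_left _ _
    · exact le_max_left _ _
  set vf : ℕ → Ω → Curve := fun i => e (t + i) with hvf
  -- The row read backwards from t. For i ≥ t the truncated index is 0, where the extended row
  -- vanishes.
  set vb : ℕ → Ω → Curve := fun i => e (t - 1 - i) with hvb
  have hf : ∀ i j, ∫⁻ ω, ‖∑ l ∈ Finset.Ico i j, vf l ω‖ₑ ^ 2 ∂P ≤ C * (j - i : ℕ) := by
    intro i j
    have hs : ∀ ω, ∑ l ∈ Finset.Ico i j, vf l ω = ∑ l ∈ Finset.Ico (t + i) (t + j), e l ω := by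
      intro ω
      rw [Finset.sum_Ico_eq_sum_range, Finset.sum_Ico_eq_sum_range, Nat.add_sub_add_left]
      simp only [hvf, add_assoc]
    simp_rw [hs]
    refine (heC _ _).trans (le_of_eq ?_)
    rw [Nat.add_sub_add_left]
  have hb : ∀ i j, ∫⁻ ω, ‖∑ l ∈ Finset.Ico i j, vb l ω‖ₑ ^ 2 ∂P ≤ C * (j - i : ℕ) := by
    intro i j
    have hs : ∀ ω, ∑ l ∈ Finset.Ico i j, vb l ω =
        ∑ l ∈ Finset.Ico (t - min j t) (t - i), e l ω := by
      intro ω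
      rw [← Finset.sum_subset (Finset.Ico_subset_Ico_right (min_le_left j t))]
      · rw [Finset.sum_Ico_eq_sum_range, Finset.sum_Ico_eq_sum_range,
          show t - i - (t - min j t) = min j t - i by omega, ← Finset.sum_range_reflect]
        refine Finset.sum_congr rfl fun l hl => ?_
        rw [Finset.mem_range] at hl
        simp only [hvb]
        congr 2
        omega
      · intro l hl hl'
        rw [Finset.mem_Ico] at hl hl'
        simp only [hvb, he]
        rw [if_neg (by omega)]
    simp_rw [hs]
    refine (heC _ _).trans ?_
    exact mul_le_mul_right (Nat.cast_le.2 (by omega)) _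
  have hsub : {ω | ∃ b : ℕ, 1 ≤ b ∧ b ≤ n + 1 ∧
        (a * √|(b : ℝ) - t| < ‖∑ j ∈ Finset.range b, ε n j ω - ∑ j ∈ Finset.range t, ε n j ω‖ ∨
        (2 ^ k₀ : ℝ) ≤ |(b : ℝ) - t| ∧ η * |(b : ℝ) - t| <
          ‖∑ j ∈ Finset.range b, ε n j ω - ∑ j ∈ Finset.range t, ε n j ω‖)} ⊆
      ({ω | ∃ h ≤ n + 1, a * √h < ‖∑ j ∈ Finset.range h, vf j ω‖} ∪
        {ω | ∃ h ≥ 2 ^ k₀, η * h < ‖∑ j ∈ Finset.range h, vf j ω‖}) ∪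
      ({ω | ∃ h ≤ n + 1, a * √h < ‖∑ j ∈ Finset.range h, vb j ω‖} ∪
        {ω | ∃ h ≥ 2 ^ k₀, η * h < ‖∑ j ∈ Finset.range h, vb j ω‖}) := by
    rintro ω ⟨b, hb1, hbn, hω⟩
    rcases le_total t b with htb | hbt
    · left
      have hs : ∑ j ∈ Finset.range b, ε n j ω - ∑ j ∈ Finset.range t, ε n j ω =
          ∑ j ∈ Finset.range (b - t), vf j ω := by
        rw [← Finset.sum_Ico_eq_sub _ htb, Finset.sum_Ico_eq_sum_range]
        refine Finset.sum_congr rfl fun l hl => ?_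
        rw [Finset.mem_range] at hl
        simp only [hvf, he]
        rw [if_pos (by omega)]
      have ha : |(b : ℝ) - t| = (b - t : ℕ) := by
        rw [Nat.cast_sub htb, abs_of_nonneg]
        rw [sub_nonneg]
        exact_mod_cast htb
      rw [hs, ha] at hω
      rcases hω with hω | ⟨hk, hω⟩
      · exact Or.inl ⟨b - t, by omega, hω⟩
      · exact Or.inr ⟨b - t, by exact_mod_cast hk, hω⟩
    · right
      have hs : ∑ j ∈ Finset.range t, ε n j ω - ∑ j ∈ Finset.range b, ε n j ω =
          ∑ j ∈ Finset.range (t - b), vb j ω := by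
        rw [← Finset.sum_Ico_eq_sub _ hbt, Finset.sum_Ico_eq_sum_range, ← Finset.sum_range_reflect]
        refine Finset.sum_congr rfl fun l hl => ?_
        rw [Finset.mem_range] at hl
        simp only [hvb, he]
        rw [if_pos (by omega)]
        congr 1
        omega
      have ha : |(b : ℝ) - t| = (t - b : ℕ) := by
        rw [abs_sub_comm, Nat.cast_sub hbt, abs_of_nonneg]
        rw [sub_nonneg]
        exact_mod_cast hbt
      rw [norm_sub_rev, hs, ha] at hω
      rcases hω with hω | ⟨hk, hω⟩
      · exact Or.inl ⟨t - b, by omega, hω⟩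
      · exact Or.inr ⟨t - b, by exact_mod_cast hk, hω⟩
  refine (measure_mono hsub).trans ((measure_union_le _ _).trans ?_)
  rw [two_mul]
  refine add_le_add ((measure_union_le _ _).trans (add_le_add ?_ ?_))
    ((measure_union_le _ _).trans (add_le_add ?_ ?_))
  · exact_mod_cast measure_exists_norm_sum_gt_sqrt_le (fun j t => hem _ t) hf (n + 1) ha
  · exact measure_exists_norm_sum_gt_mul_le (fun j t => hem _ t) hf k₀ hη
  · exact_mod_cast measure_exists_norm_sum_gt_sqrt_le (fun j t => hem _ t) hb (n + 1) ha
  · exact measure_exists_norm_sum_gt_mul_le (fun j t => hem _ t) hb k₀ hη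

/-- With probability tending to one, the partial sums of the `n`-th row around finitely many
times satisfy bounds with a square root and a linear envelope. -/
lemma tendsto_measure_partial_sum (h1 : CondA1 P ε) {J : ℕ} (hJ2 : Even J) (hJ : 2 ≤ J)
    (h3 : CondA3 P ε J) (h4 : CondA4 P ε J) (M : ℕ) {t : ℕ → ℕ → ℕ}
    (ht : ∀ᶠ n in atTop, ∀ k ≤ M, 1 ≤ t n k ∧ t n k ≤ n + 1) {a r : ℕ → ℝ} {η : ℝ} (hη : 0 < η)
    (ha : Tendsto (fun n : ℕ => Real.log n ^ 3 / a n ^ 2) atTop (𝓝 0))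
    (ha0 : ∀ᶠ n in atTop, 0 < a n) (hr : Tendsto r atTop atTop) :
    Tendsto (fun n : ℕ => P {ω | ∃ k ≤ M, ∃ b : ℕ, 1 ≤ b ∧ b ≤ n + 1 ∧
        (a n * √|(b : ℝ) - t n k| <
          ‖∑ j ∈ Finset.range b, ε n j ω - ∑ j ∈ Finset.range (t n k), ε n j ω‖ ∨
        r n ≤ |(b : ℝ) - t n k| ∧ η * |(b : ℝ) - t n k| <
          ‖∑ j ∈ Finset.range b, ε n j ω - ∑ j ∈ Finset.range (t n k), ε n j ω‖)})
      atTop (𝓝 0) := by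
  obtain ⟨C, hC⟩ := exists_measure_partial_sum_gt_le h1 hJ2 hJ h3 h4
  -- The largest dyadic scale with 2^{k₀} ≤ r: it tends to infinity, and events about lengths at
  -- least r are contained in those about lengths at least 2^{k₀}.
  set k₀ : ℕ → ℕ := fun n => Nat.log 2 ⌊r n⌋₊ with hk₀
  set T : ℕ → ℝ := fun m => ∑' k : ℕ, (((k + m : ℕ) : ℝ) + 2) ^ 2 / 2 ^ (k + m) with hT
  have hT0 : Tendsto T atTop (𝓝 0) :=
    tendsto_sum_nat_add fun k : ℕ => ((k : ℝ) + 2) ^ 2 / 2 ^ k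
  have hk₀t : Tendsto k₀ atTop atTop := by
    have h := tendsto_nat_floor_atTop (α := ℝ).comp hr
    refine tendsto_atTop.2 fun m => ?_
    filter_upwards [h.eventually_ge_atTop (2 ^ m)] with n hn
    exact Nat.le_log_of_pow_le one_lt_two hn
  have hlogb : ∀ᶠ n : ℕ in atTop, (Nat.log 2 (n + 1) + 2 : ℝ) ≤ 8 * Real.log n := by
    have h := Real.tendsto_log_atTop.comp (tendsto_natCast_atTop_atTop (R := ℝ))
    filter_upwards [h.eventually_ge_atTop 1, eventually_ge_atTop 1] with n hn hn1
    simp only [Function.comp_apply] at hn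
    have e1 : (Nat.log 2 (n + 1) : ℝ) ≤ Real.logb 2 (n + 1 : ℕ) := Real.natLog_le_logb _ _
    have hn1' : (1 : ℝ) ≤ n := by exact_mod_cast hn1
    have e2 : Real.log ((n + 1 : ℕ) : ℝ) ≤ Real.log n + Real.log 2 := by
      rw [← Real.log_mul (by positivity) (by norm_num)]
      refine Real.log_le_log (by positivity) ?_
      push_cast
      linarith
    have e3 : (0.5 : ℝ) ≤ Real.log 2 := by linarith [Real.log_two_gt_d9]
    have e4 : Real.logb 2 (n + 1 : ℕ) ≤ 2 * Real.log n + 1 := by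
      rw [Real.logb, div_le_iff₀ (by linarith)]
      nlinarith
    linarith
  have hlim : Tendsto (fun n : ℕ => (M + 1 : ℕ) * (2 * (ENNReal.ofReal
      (2 * C * 8 ^ 3 * (Real.log n ^ 3 / a n ^ 2)) + ENNReal.ofReal (2 * C / η ^ 2 * T (k₀ n)))))
      atTop (𝓝 0) := by
    have l1 := ENNReal.tendsto_ofReal (ha.const_mul (2 * C * 8 ^ 3 : ℝ))
    have l2 := ENNReal.tendsto_ofReal ((hT0.comp hk₀t).const_mul (2 * C / η ^ 2 : ℝ))
    have l3 := ENNReal.Tendsto.const_mul (a := 2) (l1.add l2) (Or.inr (by norm_num))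
    have l4 := ENNReal.Tendsto.const_mul (a := ((M + 1 : ℕ) : ℝ≥0∞)) l3
      (Or.inr (ENNReal.natCast_ne_top _))
    simpa using l4
  refine tendsto_of_tendsto_of_tendsto_of_le_of_le' tendsto_const_nhds hlim
    (Eventually.of_forall fun _ => bot_le) ?_
  filter_upwards [ht, ha0, hlogb, hr.eventually_ge_atTop 1] with n htn han hlog hrn
  have hpow : (2 ^ k₀ n : ℝ) ≤ r n := by
    have : (2 ^ k₀ n : ℕ) ≤ ⌊r n⌋₊ := Nat.pow_log_le_self 2 (Nat.floor_pos.2 hrn).ne'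
    calc (2 ^ k₀ n : ℝ) = ((2 ^ k₀ n : ℕ) : ℝ) := by push_cast; rfl
      _ ≤ (⌊r n⌋₊ : ℝ) := by exact_mod_cast this
      _ ≤ _ := Nat.floor_le (by linarith)
  refine (measure_mono (t := ⋃ k ∈ Finset.range (M + 1), {ω | ∃ b : ℕ, 1 ≤ b ∧ b ≤ n + 1 ∧
        (a n * √|(b : ℝ) - t n k| <
          ‖∑ j ∈ Finset.range b, ε n j ω - ∑ j ∈ Finset.range (t n k), ε n j ω‖ ∨
        (2 ^ k₀ n : ℝ) ≤ |(b : ℝ) - t n k| ∧ η * |(b : ℝ) - t n k| <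
          ‖∑ j ∈ Finset.range b, ε n j ω - ∑ j ∈ Finset.range (t n k), ε n j ω‖)}) ?_).trans
    ((measure_biUnion_finset_le _ _).trans ?_)
  · rintro ω ⟨k, hk, b, hb1, hbn, hω⟩
    simp only [Set.mem_iUnion, Finset.mem_range]
    exact ⟨k, by omega, b, hb1, hbn, hω.imp_right fun h => ⟨hpow.trans h.1, h.2⟩⟩
  · calc _ ≤ ∑ k ∈ Finset.range (M + 1), 2 * (ENNReal.ofReal
      (2 * C * 8 ^ 3 * (Real.log n ^ 3 / a n ^ 2)) +
        ENNReal.ofReal (2 * C / η ^ 2 * T (k₀ n))) := by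
          refine Finset.sum_le_sum fun k hk => ?_
          rw [Finset.mem_range] at hk
          obtain ⟨g1, g2⟩ := htn k (by omega)
          refine (hC n (t n k) g1 g2 (a n) η (k₀ n) han hη).trans ?_
          gcongr ?_ * (?_ + ?_)
          · exact le_rfl
          · refine ENNReal.ofReal_le_ofReal ?_
            calc _ ≤ 2 * (C : ℝ) * (8 * Real.log n) ^ 3 / a n ^ 2 := by gcongr
              _ = _ := by ring
          · exact le_rfl
      _ = _ := by
          rw [Finset.sum_const, Finset.card_range, nsmul_eq_mul]

end RowSums

/-! ### The change point model for large samples -/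

/-- The times `1 ≤ ⌊n s_1⌋ ≤ ⋯ ≤ ⌊n s_m⌋ ≤ n + 1` at which the segments begin. -/
def cpTime {m : ℕ} (s : Fin m → ℝ) (n : ℕ) : ℕ → ℕ
  | 0 => 1
  | k + 1 => if h : k < m then ⌊(n : ℝ) * s ⟨k, h⟩⌋₊ else n + 1

/-- The numbers `0, s_1, …, s_m, 1`. -/
def cpFrac {m : ℕ} (s : Fin m → ℝ) : ℕ → ℝ
  | 0 => 0
  | k + 1 => if h : k < m then s ⟨k, h⟩ else 1

/-- The segment means, indexed by the natural numbers. -/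
def segCurve {m : ℕ} (μ : Fin (m + 1) → Curve) (k : ℕ) : Curve :=
  if h : k < m + 1 then μ ⟨k, h⟩ else 0

section Times

variable {m : ℕ} {s : Fin m → ℝ}

lemma cpFrac_lt (hs : StrictMono s) (hs01 : ∀ i, s i ∈ Set.Ioo (0 : ℝ) 1) {k : ℕ} (hk : k ≤ m) :
    cpFrac s k < cpFrac s (k + 1) := by
  cases k with
  | zero =>
    simp only [cpFrac]
    split_ifs with h
    · exact (hs01 _).1
    · exact one_pos
  | succ k =>
    simp only [cpFrac]
    rw [dif_pos (by omega)]
    split_ifs with h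
    · exact hs (Fin.mk_lt_mk.2 (Nat.lt_succ_self k))
    · exact (hs01 _).2

lemma cpTime_le_add (hs01 : ∀ i, s i ∈ Set.Ioo (0 : ℝ) 1) (n k : ℕ) :
    (cpTime s n k : ℝ) ≤ n * cpFrac s k + 1 := by
  cases k with
  | zero => simp [cpTime, cpFrac]
  | succ k =>
    simp only [cpTime, cpFrac]
    split_ifs with h
    · have := (hs01 ⟨k, h⟩).1
      linarith [Nat.floor_le (show (0 : ℝ) ≤ n * s ⟨k, h⟩ by positivity)]
    · push_cast
      linarith

lemma sub_le_cpTime (n k : ℕ) : (n * cpFrac s k - 1 : ℝ) ≤ cpTime s n k := by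
  cases k with
  | zero => simp [cpTime, cpFrac]
  | succ k =>
    simp only [cpTime, cpFrac]
    split_ifs with h
    · linarith [Nat.lt_floor_add_one ((n : ℝ) * s ⟨k, h⟩)]
    · push_cast
      linarith

/-- The change times increase with their index, so those not later than j form an initial segment,
of size k. -/
lemma segIndex_eq (hs : StrictMono s) {n j k : ℕ} (hk : k ≤ m)
    (h1 : cpTime s n k ≤ j) (h2 : j < cpTime s n (k + 1)) :
    (segIndex s n j : ℕ) = k := by
  have hmono : ∀ i i' : Fin m, i ≤ i' → ⌊(n : ℝ) * s i⌋₊ ≤ ⌊(n : ℝ) * s i'⌋₊ := fun i i' h => by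
    have := hs.monotone h
    gcongr
  have hfilter : (Finset.univ.filter fun i : Fin m => ⌊(n : ℝ) * s i⌋₊ ≤ j) =
      Finset.univ.filter fun i : Fin m => (i : ℕ) < k := by
    ext i
    simp only [Finset.mem_filter, Finset.mem_univ, true_and]
    constructor
    · intro hi
      by_contra! hki
      have hkm : k < m := hki.trans_lt i.2
      simp only [cpTime, hkm, dif_pos] at h2
      have := hmono ⟨k, hkm⟩ i hki
      omega
    · intro hi
      obtain ⟨k, rfl⟩ : ∃ k', k = k' + 1 := ⟨k - 1, by omega⟩
      have hkm : k < m := by omega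
      simp only [cpTime, hkm, dif_pos] at h1
      exact (hmono i ⟨k, hkm⟩ (by rw [Fin.le_def]; simp only; omega)).trans h1
  simp only [segIndex]
  rw [hfilter, Fin.card_filter_val_lt]
  omega

lemma exists_pos_forall_le (M : ℕ) {f : ℕ → ℝ} (hf : ∀ k ≤ M, 0 < f k) :
    ∃ c, 0 < c ∧ ∀ k ≤ M, c ≤ f k := by
  obtain ⟨i, hi, h⟩ := Finset.exists_min_image (Finset.range (M + 1)) f ⟨0, by simp⟩
  rw [Finset.mem_range] at hi
  exact ⟨f i, hf i (by omega), fun k hk => h k (by rw [Finset.mem_range]; omega)⟩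

end Times

/-! ### Logarithmic rates and the localization radius -/

section Rates

lemma tendsto_log_natCast : Tendsto (fun n : ℕ => Real.log n) atTop atTop :=
  Real.tendsto_log_atTop.comp tendsto_natCast_atTop_atTop

lemma tendsto_log_pow_div_rpow (k : ℕ) {p : ℝ} (hp : 0 < p) :
    Tendsto (fun n : ℕ => Real.log n ^ k / (n : ℝ) ^ p) atTop (𝓝 0) := by
  have h := (isLittleO_log_rpow_rpow_atTop (k : ℝ) hp).tendsto_div_nhds_zero.comp
    (tendsto_natCast_atTop_atTop (R := ℝ))
  refine h.congr fun n => ?_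
  simp

lemma eventually_log_pow_le (k : ℕ) {δ : ℝ} (hδ : 0 < δ) :
    ∀ᶠ n : ℕ in atTop, Real.log n ^ k ≤ δ * √n := by
  filter_upwards [(tendsto_log_pow_div_rpow k (p := 1 / 2) (by norm_num)).eventually
    (gt_mem_nhds hδ), eventually_gt_atTop 0] with n hn hn0
  have : (0 : ℝ) < (n : ℝ) ^ (1 / 2 : ℝ) := by positivity
  rw [div_lt_iff₀ this, ← Real.sqrt_eq_rpow] at hn
  exact hn.le

/-- The admissible distance between true and estimated change points. -/
def locRadius (ξ : ℕ → ℝ) (n : ℕ) : ℝ := min (√(ξ n) / Real.log n) (Real.log n)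

lemma tendsto_locRadius {ξ : ℕ → ℝ}
    (hξ : Tendsto (fun n : ℕ => ξ n / Real.log n ^ 2) atTop atTop) :
    Tendsto (locRadius ξ) atTop atTop := by
  have h : Tendsto (fun n => √(ξ n) / Real.log n) atTop atTop := by
    refine (Real.tendsto_sqrt_atTop.comp hξ).congr' ?_
    filter_upwards [tendsto_log_natCast.eventually_gt_atTop 0] with n hn
    simp only [Function.comp_apply]
    rw [Real.sqrt_div' _ (sq_nonneg _), Real.sqrt_sq hn.le]
  refine tendsto_atTop.2 fun x => ?_
  filter_upwards [h.eventually_ge_atTop x, tendsto_log_natCast.eventually_ge_atTop x] with n h1 h2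
  exact le_min h1 h2

/-- This bound is what the first entry of the minimum is for: it keeps r² (log n)² below the
threshold, which rules out false alarms. The second entry keeps r negligible against every power of
n. -/
lemma sq_locRadius_mul_le {ξ : ℕ → ℝ} {n : ℕ} (h0 : 0 ≤ locRadius ξ n) (hξ : 0 < ξ n)
    (hn : 0 < Real.log n) : locRadius ξ n ^ 2 * Real.log n ^ 2 ≤ ξ n := by
  have h : locRadius ξ n * Real.log n ≤ √(ξ n) := by
    rw [← le_div_iff₀ hn]
    exact min_le_left _ _
  calc _ = (locRadius ξ n * Real.log n) ^ 2 := by ring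
    _ ≤ √(ξ n) ^ 2 := by gcongr
    _ = _ := Real.sq_sqrt hξ.le

end Rates

/-! ### Verification of the deterministic model -/

section Model

variable {m : ℕ} {s : Fin m → ℝ} {μ : Fin (m + 1) → Curve} {ξ : ℕ → ℝ}

/-- For large samples, the change point model with sufficiently regular noise has the properties
required for the analysis of binary segmentation. -/
lemma exists_eventually_segModel (hs : StrictMono s) (hs01 : ∀ i, s i ∈ Set.Ioo (0 : ℝ) 1)
    (hμ : ∀ i : Fin m, μ i.castSucc ≠ μ i.succ)
    (hξ_lower : Tendsto (fun n : ℕ => ξ n / Real.log n ^ 2) atTop atTop)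
    (hξ_upper : Tendsto (fun n : ℕ => ξ n / √(n : ℝ)) atTop (𝓝 0)) :
    ∃ κ B Δ : ℝ, 0 < κ ∧ 0 < B ∧ 0 < Δ ∧ ∀ᶠ n : ℕ in atTop,
      (∀ k ≤ m + 1, 1 ≤ cpTime s n k ∧ cpTime s n k ≤ n + 1) ∧ ∀ e : ℕ → Curve,
      (∀ k ≤ m + 1, ∀ b : ℕ, 1 ≤ b → b ≤ n + 1 →
        ‖∑ j ∈ Finset.range b, e j - ∑ j ∈ Finset.range (cpTime s n k), e j‖ ≤
          (locRadius ξ n * Real.log n ^ 2) * √|(b : ℝ) - cpTime s n k|) →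
      (∀ k ≤ m + 1, ∀ b : ℕ, 1 ≤ b → b ≤ n + 1 → locRadius ξ n ≤ |(b : ℝ) - cpTime s n k| →
        ‖∑ j ∈ Finset.range b, e j - ∑ j ∈ Finset.range (cpTime s n k), e j‖ ≤
          κ ^ 2 * Δ / 64 * |(b : ℝ) - cpTime s n k|) →
      SegModel (fun j => μ (segIndex s n j) + e j) e (segCurve μ) (cpTime s n) m n
        (locRadius ξ n * Real.log n ^ 2) (locRadius ξ n) κ B Δ (ξ n) := by
  obtain ⟨κ₂, hκ₂, hgap⟩ := exists_pos_forall_le m (f := fun k => cpFrac s (k + 1) - cpFrac s k)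
    fun k hk => sub_pos.2 (cpFrac_lt hs hs01 hk)
  obtain ⟨Δ, hΔ, hjump⟩ := exists_pos_forall_le m
    (f := fun k => if k < m then ‖segCurve μ (k + 1) - segCurve μ k‖ else 1) (fun k hk => by
      split_ifs with h
      · rw [norm_pos_iff, sub_ne_zero]
        simp only [segCurve]
        rw [dif_pos (by omega), dif_pos (by omega)]
        exact (hμ ⟨k, h⟩).symm
      · exact one_pos)
  set B : ℝ := 1 + ∑ k ∈ Finset.range (m + 1), ‖segCurve μ k‖ with hB
  have hB0 : 0 < B := by positivity
  have hbound : ∀ k ≤ m, ‖segCurve μ k‖ ≤ B := fun k hk => by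
    have := Finset.single_le_sum (f := fun k => ‖segCurve μ k‖) (fun i _ => norm_nonneg _)
      (Finset.mem_range.2 (Nat.lt_succ_of_le hk))
    linarith
  -- Half of the smallest gap: rounding moves each change time by at most one, which costs 2 ≤ κn
  -- for large n.
  set κ := κ₂ / 2 with hκdef
  have hκ : 0 < κ := by positivity
  refine ⟨κ, B, Δ, hκ, hB0, hΔ, ?_⟩
  have hr := tendsto_locRadius hξ_lower
  set G := (κ * Δ / (16 * B)) ^ 2 with hG
  have hG0 : 0 < G := by positivity
  set H := 2 + 64 / (κ ^ 2 * Δ) with hH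
  have hH0 : 0 < H := by positivity
  filter_upwards [eventually_ge_atTop 1, hr.eventually_ge_atTop 1,
    hr.eventually_ge_atTop ((7 + 8 * B) ^ 2), tendsto_log_natCast.eventually_ge_atTop 1,
    eventually_log_pow_le 4 (show 0 < κ / 4 by positivity),
    eventually_log_pow_le 4 (show 0 < κ * Δ / 48 by positivity),
    eventually_log_pow_le 4 (show 0 < G / H by positivity),
    hξ_upper.eventually (gt_mem_nhds (show 0 < κ * Δ / 4 by positivity)),
    hξ_lower.eventually_gt_atTop 0,
    tendsto_natCast_atTop_atTop.eventually_ge_atTop (2 / κ)] with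
    n hn1 hr1 hrB hL hp1 hp2 hp3 hξu hξl hnκ
  set r := locRadius ξ n with hrdef
  set L := Real.log n with hLdef
  have hn1' : (1 : ℝ) ≤ n := by exact_mod_cast hn1
  have hn0 : (0 : ℝ) < n := by linarith
  have hsq1 : 1 ≤ √(n : ℝ) := by rwa [Real.one_le_sqrt]
  have hsqn : √(n : ℝ) ^ 2 = n := Real.sq_sqrt hn0.le
  have hL0 : 0 < L := by linarith
  have hξ0 : 0 < ξ n := by
    have := mul_pos hξl (pow_pos hL0 2)
    rwa [div_mul_cancel₀ _ (pow_pos hL0 2).ne'] at this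
  have hr0 : 0 < r := by linarith
  have hrL : r ≤ L := min_le_right _ _
  have hrξ : r ^ 2 * L ^ 2 ≤ ξ n := sq_locRadius_mul_le hr0.le hξ0 hL0
  set q := √r with hq
  have hq2 : q ^ 2 = r := Real.sq_sqrt hr0.le
  have hqB : 7 + 8 * B ≤ q := Real.le_sqrt_of_sq_le hrB
  have hq1 : 1 ≤ q := by linarith
  have hqr : q ≤ r := by
    rw [← hq2]
    exact le_self_pow₀ hq1 two_ne_zero
  have hsn : √(n : ℝ) ≤ n := by
    conv_rhs => rw [← hsqn]
    exact le_self_pow₀ hsq1 two_ne_zero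
  have hL4 : L ^ 3 ≤ L ^ 4 := pow_le_pow_right₀ hL (by norm_num)
  have hrL4 : r ≤ L ^ 4 := hrL.trans (le_self_pow₀ hL (by norm_num))
  have ha3 : r * L ^ 2 ≤ L ^ 3 := by
    calc r * L ^ 2 ≤ L * L ^ 2 := by gcongr
      _ = _ := by ring
  have haq : r * L ^ 2 * q ≤ L ^ 4 := by
    calc r * L ^ 2 * q ≤ L ^ 3 * L := by gcongr; exact hqr.trans hrL
      _ = _ := by ring
  have ha0 : 0 ≤ r * L ^ 2 := by positivity
  have haq' : r * L ^ 2 * (1 + 2 * q) ≤ 3 * L ^ 4 := by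
    linarith
  have hnκ' : 2 ≤ κ * n := by
    rw [div_le_iff₀ hκ] at hnκ
    linarith
  have hgapn : ∀ k ≤ m, κ * n ≤ (cpTime s n (k + 1) : ℝ) - cpTime s n k := by
    intro k hk
    have e1 := cpTime_le_add hs01 n k
    have e2 := sub_le_cpTime (s := s) n (k + 1)
    have e3 := mul_le_mul_of_nonneg_left (hgap k hk) hn0.le
    have e4 : κ₂ = 2 * κ := by rw [hκdef]; ring
    rw [e4] at e3
    linarith
  have hlast : cpTime s n (m + 1) = n + 1 := by simp [cpTime]
  have hmono : ∀ k ≤ m, cpTime s n k ≤ cpTime s n (k + 1) := fun k hk => by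
    have := hgapn k hk
    have : (cpTime s n k : ℝ) ≤ cpTime s n (k + 1) := by linarith
    exact_mod_cast this
  have hlow : ∀ k ≤ m + 1, 1 ≤ cpTime s n k := by
    intro k
    induction k with
    | zero => intro _; exact le_rfl
    | succ k ih => exact fun hk => (ih (by omega)).trans (hmono k (by omega))
  have hupp : ∀ d k, k + d = m + 1 → cpTime s n k ≤ n + 1 := by
    intro d
    induction d with
    | zero => rintro k rfl; exact hlast.le
    | succ d ih => exact fun k hk => (hmono k (by omega)).trans (ih (k + 1) (by omega))
  have hupp' : ∀ k ≤ m + 1, cpTime s n k ≤ n + 1 := fun k hk => hupp (m + 1 - k) k (by omega)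
  refine ⟨fun k hk => ⟨hlow k hk, hupp' k hk⟩, fun e hnoise hfar => ?_⟩
  refine
    { κ_pos := hκ
      Δ_pos := hΔ
      B_pos := hB0
      a_nonneg := ha0
      one_le_r := hr1
      t_zero := rfl
      t_last := hlast
      gap := hgapn
      mean := fun k hk j hj1 hj2 => ?_
      bound := hbound
      jump := fun k hk => by simpa [hk] using hjump k hk.le
      noise := hnoise
      noise_far := hfar
      r_le := ?_
      a_le := ?_
      le_threshold := ?_
      threshold_lt := ?_
      a_le' := ?_
      r_le' := ?_ }
  · have h := segIndex_eq hs hk hj1 hj2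
    simp only [segCurve]
    rw [dif_pos (by omega)]
    congr 2
    exact Fin.ext h
  · have : κ / 4 * √(n : ℝ) ≤ κ / 4 * n := by gcongr
    linarith
  · have : L ^ 3 * √n ≤ κ * Δ / 48 * n := by
      calc L ^ 3 * √n ≤ (κ * Δ / 48 * √n) * √n := by gcongr; linarith
        _ = κ * Δ / 48 * √n ^ 2 := by ring
        _ = _ := by rw [hsqn]
    have h2 : r * L ^ 2 * √n ≤ L ^ 3 * √n := by gcongr
    have h3 : 0 < κ * Δ * n := by positivity
    linarith
  -- With q = √r and a = r L², the false alarm bound is at most r L² (8B + 6q), and 8B + 6q ≤ q² = r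
  -- once q ≥ 7 + 8B. The lower rate of the threshold enters here through r² L² ≤ ξ n and r → ∞.
  · refine le_trans ?_ hrξ
    have h1 : 8 * B + 6 * q ≤ r := by
      have g1 : (7 + 8 * B) * q ≤ q * q := by gcongr
      have g2 : 8 * B * 1 ≤ 8 * B * q := by gcongr
      rw [← hq2, sq]
      linarith
    have h2 : 1 ≤ L ^ 2 := one_le_pow₀ hL
    have h3 : r * L ^ 2 * (8 * B + 6 * q) ≤ r * L ^ 2 * r := by gcongr
    have h4 : B * r ≤ B * r * L ^ 2 := le_mul_of_one_le_right (by positivity) h2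
    have h5 : r * L ^ 2 * 1 ≤ r * L ^ 2 * q := by gcongr
    linarith
  · rwa [div_lt_iff₀ (by positivity)] at hξu
  · linarith
  · have h1 : L ^ 4 * H ≤ G * √n := by
      calc L ^ 4 * H ≤ (G / H * √n) * H := by gcongr
        _ = _ := by field_simp
    calc 2 * r + 64 * (r * L ^ 2 * q) / (κ ^ 2 * Δ)
        ≤ 2 * L ^ 4 + 64 * L ^ 4 / (κ ^ 2 * Δ) := by gcongr
      _ = L ^ 4 * H := by rw [hH]; ring
      _ ≤ G * √n := h1
      _ ≤ G * n := by gcongr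

end Model

/-! ### The error of the estimated mean function -/

section Deterministic

variable {x ε μ : ℕ → Curve} {t : ℕ → ℕ} {m n : ℕ} {a r κ B Δ ξ : ℝ} {S : Finset ℕ}

-- The means at p and q differ only if a change point lies between them, and it is then within c of
-- p.
open Classical in
lemma SegModel.norm_mean_sub_mean_le (h : SegModel x ε μ t m n a r κ B Δ ξ) {p q : ℕ}
    (hp1 : 1 ≤ p) (hpn : p ≤ n) (hq1 : 1 ≤ q) (hqn : q ≤ n) {c : ℝ} (hpq : |(q : ℝ) - p| ≤ c) :
    ‖(x q - ε q) - (x p - ε p)‖ ≤ if ∃ k ≤ m + 1, |(p : ℝ) - t k| ≤ c then 2 * B else 0 := by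
  obtain ⟨i, -, hi, hi1, hi2⟩ := SegModel.exists_segment (t := t) (i' := m + 1)
    (Nat.succ_pos m) (h.t_zero ▸ hp1 : t 0 ≤ p) (by rw [h.t_last]; omega)
  obtain ⟨k, -, hk, hk1, hk2⟩ := SegModel.exists_segment (t := t) (i' := m + 1)
    (Nat.succ_pos m) (h.t_zero ▸ hq1 : t 0 ≤ q) (by rw [h.t_last]; omega)
  rw [h.mean i (by omega) p hi1 hi2, h.mean k (by omega) q hk1 hk2, add_sub_cancel_right,
    add_sub_cancel_right]
  rw [abs_le] at hpq
  have hle : ‖μ k - μ i‖ ≤ 2 * B := by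
    have := norm_sub_le (μ k) (μ i)
    linarith [h.bound i (by omega), h.bound k (by omega)]
  have hcast : ∀ {u v : ℕ}, u ≤ v → (u : ℝ) ≤ v := fun h => by exact_mod_cast h
  rcases lt_trichotomy i k with hik | rfl | hik
  · have hm := h.monotone hik (by omega)
    have hex : ∃ k ≤ m + 1, |(p : ℝ) - t k| ≤ c := by
      have := hcast (hm.trans hk1)
      have := hcast hi2.le
      refine ⟨i + 1, by omega, ?_⟩
      rw [abs_le]
      constructor <;> linarith
    rw [if_pos hex]
    exact hle
  · rw [sub_self, norm_zero]
    split_ifs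
    · linarith [h.B_pos]
    · exact le_rfl
  · have hm := h.monotone hik (by omega)
    have hex : ∃ k ≤ m + 1, |(p : ℝ) - t k| ≤ c := by
      have := hcast (hk2.le.trans hm)
      have := hcast hi1
      refine ⟨i, by omega, ?_⟩
      rw [abs_le]
      constructor <;> linarith
    rw [if_pos hex]
    exact hle

/-- A bound for the deviation of the estimated mean from the true mean at times near `p`. -/
def meanErr (t : ℕ → ℕ) (m n : ℕ) (a r κ B c : ℝ) (p : ℕ) : ℝ :=
  open Classical in
  2 * (4 * B * r + a * (√n + 2 * √r)) / (κ * n) +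
    if ∃ k ≤ m + 1, |(p : ℝ) - t k| ≤ r + c then 4 * B else 0

/-- The lag estimator centres both factors with the segment mean belonging to the first index p, so
the error must also be controlled at times q up to c away. Misestimation near a change point and a
change of mean between p and q cost 2B each, both confined to distance r + c. -/
lemma SegModel.norm_sub_segMean_le (h : SegModel x ε μ t m n a r κ B Δ ξ)
    (hS : BinSeg x ξ 1 n S) {p q : ℕ} (hp1 : 1 ≤ p) (hpn : p ≤ n) (hq1 : 1 ≤ q) (hqn : q ≤ n)
    {c : ℝ} (hc : 0 ≤ c) (hpq : |(q : ℝ) - p| ≤ c) :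
    ‖x q - ε q - segMean x n S p‖ ≤ meanErr t m n a r κ B c p := by
  classical
  have e1 := h.norm_mean_sub_segMean_le hS hp1 hpn
  have e2 := h.norm_mean_sub_mean_le hp1 hpn hq1 hqn hpq
  have e3 : x q - ε q - segMean x n S p =
      (x p - ε p - segMean x n S p) + ((x q - ε q) - (x p - ε p)) := by abel
  have hr := h.one_le_r
  have hB := h.B_pos
  have mono : ∀ {R : ℝ}, R ≤ r + c →
      (if ∃ k ≤ m + 1, |(p : ℝ) - t k| ≤ R then 2 * B else 0) ≤
        if ∃ k ≤ m + 1, |(p : ℝ) - t k| ≤ r + c then 2 * B else 0 := by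
    intro R hR
    by_cases h1 : ∃ k ≤ m + 1, |(p : ℝ) - t k| ≤ R
    · obtain ⟨k, hk, hkR⟩ := h1
      rw [if_pos ⟨k, hk, hkR⟩, if_pos ⟨k, hk, hkR.trans hR⟩]
    · rw [if_neg h1]
      split_ifs
      · positivity
      · exact le_rfl
  have e4 := mono (R := r) (by linarith)
  have e5 := mono (R := c) (by linarith)
  have e6 : (if ∃ k ≤ m + 1, |(p : ℝ) - t k| ≤ r + c then 2 * B else 0) +
      (if ∃ k ≤ m + 1, |(p : ℝ) - t k| ≤ r + c then 2 * B else 0) =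
      if ∃ k ≤ m + 1, |(p : ℝ) - t k| ≤ r + c then 4 * B else 0 := by
    split_ifs <;> ring
  rw [e3, meanErr]
  refine (norm_add_le _ _).trans ?_
  linarith

lemma card_near_le (A : Finset ℕ) (t : ℕ) {R : ℝ} (hR : 0 ≤ R) :
    ((A.filter fun p : ℕ => |(p : ℝ) - t| ≤ R).card : ℝ) ≤ 2 * R + 1 := by
  have hsub : (A.filter fun p : ℕ => |(p : ℝ) - t| ≤ R) ⊆ Finset.Icc (t - ⌊R⌋₊) (t + ⌊R⌋₊) := by
    intro p hp
    rw [Finset.mem_filter, abs_le] at hp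
    rw [Finset.mem_Icc]
    constructor
    · rcases le_total t p with h | h
      · omega
      · have : t - p ≤ ⌊R⌋₊ := Nat.le_floor (by rw [Nat.cast_sub h]; linarith [hp.2.1])
        omega
    · rcases le_total p t with h | h
      · omega
      · have : p - t ≤ ⌊R⌋₊ := Nat.le_floor (by rw [Nat.cast_sub h]; linarith [hp.2.2])
        omega
  have h1 := Finset.card_le_card hsub
  rw [Nat.card_Icc] at h1
  have h2 : (A.filter fun p : ℕ => |(p : ℝ) - t| ≤ R).card ≤ 2 * ⌊R⌋₊ + 1 := by omega
  have h3 := Nat.floor_le hR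
  calc _ ≤ ((2 * ⌊R⌋₊ + 1 : ℕ) : ℝ) := by exact_mod_cast h2
    _ ≤ _ := by push_cast; linarith

/-- The exceptional times lie in neighbourhoods of the m + 2 points t 0, …, t (m+1), each with at
most 2(r + c) + 1 elements. -/
lemma sum_meanErr_le (t : ℕ → ℕ) (m n : ℕ) {a r κ B c : ℝ} (hr : 0 ≤ r + c) (hB : 0 ≤ B) :
    ∑ p ∈ Finset.Icc 1 n, meanErr t m n a r κ B c p ≤
      n * (2 * (4 * B * r + a * (√n + 2 * √r)) / (κ * n)) +
        4 * B * ((m + 2) * (2 * (r + c) + 1)) := by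
  classical
  simp only [meanErr]
  rw [Finset.sum_add_distrib, Finset.sum_const, Nat.card_Icc, nsmul_eq_mul, Nat.add_sub_cancel]
  gcongr
  rw [← Finset.sum_filter, Finset.sum_const, nsmul_eq_mul, mul_comm]
  gcongr
  have hsub : (Finset.Icc 1 n).filter (fun p : ℕ => ∃ k ≤ m + 1, |(p : ℝ) - t k| ≤ r + c) ⊆
      (Finset.range (m + 2)).biUnion fun k =>
        (Finset.Icc 1 n).filter fun p : ℕ => |(p : ℝ) - t k| ≤ r + c := by
    intro p hp
    rw [Finset.mem_filter] at hp
    obtain ⟨hp, k, hk, hkp⟩ := hp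
    rw [Finset.mem_biUnion]
    exact ⟨k, by rw [Finset.mem_range]; omega, Finset.mem_filter.2 ⟨hp, hkp⟩⟩
  have h1 := (Finset.card_le_card hsub).trans Finset.card_biUnion_le
  calc _ ≤ ((∑ k ∈ Finset.range (m + 2), ((Finset.Icc 1 n).filter
        fun p : ℕ => |(p : ℝ) - t k| ≤ r + c).card : ℕ) : ℝ) := by exact_mod_cast h1
    _ ≤ ∑ k ∈ Finset.range (m + 2), (2 * (r + c) + 1) := by
        push_cast
        exact Finset.sum_le_sum fun k _ => card_near_le _ _ hr
    _ = _ := by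
        rw [Finset.sum_const, Finset.card_range, nsmul_eq_mul]
        push_cast
        ring

end Deterministic

section Stochastic

variable {Ω : Type*} {mΩ : MeasurableSpace Ω} {P : Measure Ω} [IsProbabilityMeasure P]
  {ε : ℕ → ℕ → Ω → Curve}

/-- A bound for the bandwidth times the logarithmic error rate. -/
lemma tendsto_bandwidth_mul_log {c : ℕ → ℕ} (hc : Tendsto c atTop atTop)
    (hcn : Tendsto (fun n : ℕ => (c n : ℝ) ^ 3 / (n : ℝ)) atTop (𝓝 0)) :
    Tendsto (fun n : ℕ => ((c n : ℝ) + 1) ^ 3 / n) atTop (𝓝 0) ∧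
      Tendsto (fun n : ℕ => ((c n : ℝ) + 1) * Real.log n ^ 4 / √n) atTop (𝓝 0) := by
  have h1 : Tendsto (fun n : ℕ => ((c n : ℝ) + 1) ^ 3 / n) atTop (𝓝 0) := by
    have h8 := hcn.const_mul 8
    rw [mul_zero] at h8
    refine squeeze_zero' (Eventually.of_forall fun n => by positivity) ?_ h8
    filter_upwards [hc.eventually_ge_atTop 1] with n hn
    have hn' : (1 : ℝ) ≤ c n := by exact_mod_cast hn
    rw [mul_div_assoc']
    gcongr
    calc ((c n : ℝ) + 1) ^ 3 ≤ (2 * c n) ^ 3 := by gcongr; linarith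
      _ = _ := by ring
  refine ⟨h1, squeeze_zero' ?_ ?_ (tendsto_log_pow_div_rpow 4 (p := 1 / 6) (by norm_num))⟩
  · filter_upwards [tendsto_log_natCast.eventually_ge_atTop 0] with n hn
    positivity
  · filter_upwards [h1.eventually (gt_mem_nhds zero_lt_one), eventually_gt_atTop 0] with n hn hn0
    have hn0' : (0 : ℝ) < n := by exact_mod_cast hn0
    rw [div_lt_one hn0'] at hn
    -- The bandwidth is at most n^{1/3}, which leaves n^{1/6} of √n to beat the logarithms.
    have hD : (c n : ℝ) + 1 ≤ (n : ℝ) ^ (1 / 3 : ℝ) := by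
      have h0 : (0 : ℝ) ≤ (c n : ℝ) + 1 := by positivity
      calc (c n : ℝ) + 1 = (((c n : ℝ) + 1) ^ 3) ^ (1 / 3 : ℝ) := by
            rw [← Real.rpow_natCast, ← Real.rpow_mul h0]; norm_num
        _ ≤ _ := Real.rpow_le_rpow (by positivity) hn.le (by norm_num)
    have hs : √(n : ℝ) = (n : ℝ) ^ (1 / 3 : ℝ) * (n : ℝ) ^ (1 / 6 : ℝ) := by
      rw [Real.sqrt_eq_rpow, ← Real.rpow_add hn0']; norm_num
    rw [hs, div_le_div_iff₀ (by positivity) (by positivity)]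
    have : 0 ≤ Real.log n ^ 4 := by positivity
    calc _ ≤ (n : ℝ) ^ (1 / 3 : ℝ) * Real.log n ^ 4 * (n : ℝ) ^ (1 / 6 : ℝ) := by gcongr
      _ = _ := by ring

/-- Binary segmentation estimates the mean function well enough, with probability tending to one:
the weights `w n p` bound the errors, and their sum is small. -/
lemma exists_weights (h1 : CondA1 P ε) {J : ℕ} (hJ2 : Even J) (hJ : 2 ≤ J)
    (h3 : CondA3 P ε J) (h4 : CondA4 P ε J) {m : ℕ} {s : Fin m → ℝ} (hs : StrictMono s)
    (hs01 : ∀ i, s i ∈ Set.Ioo (0 : ℝ) 1) {μ : Fin (m + 1) → Curve}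
    (hμ : ∀ i : Fin m, μ i.castSucc ≠ μ i.succ) {ξ : ℕ → ℝ}
    (hξ_lower : Tendsto (fun n : ℕ => ξ n / Real.log n ^ 2) atTop atTop)
    (hξ_upper : Tendsto (fun n : ℕ => ξ n / √(n : ℝ)) atTop (𝓝 0)) {S : ℕ → Ω → Finset ℕ}
    (hS : ∀ n ω, BinSeg (fun j => obs s μ ε n j ω) (ξ n) 1 n (S n ω))
    {c : ℕ → ℕ} (hc : Tendsto c atTop atTop)
    (hcn : Tendsto (fun n : ℕ => (c n : ℝ) ^ 3 / (n : ℝ)) atTop (𝓝 0)) :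
    ∃ (w : ℕ → ℕ → ℝ) (W : ℝ), (∀ᶠ n in atTop, ∀ p, 0 ≤ w n p ∧ w n p ≤ W) ∧
      Tendsto (fun n : ℕ => ((c n : ℝ) + 1) / n * ∑ p ∈ Finset.Icc 1 n, w n p) atTop (𝓝 0) ∧
      Tendsto (fun n : ℕ => P {ω | ¬ ∀ p ∈ Finset.Icc 1 n, ∀ q ∈ Finset.Icc 1 n,
        |(q : ℝ) - p| ≤ c n → ‖obs s μ ε n q ω - ε n q ω -
          segMean (fun j => obs s μ ε n j ω) n (S n ω) p‖ ≤ w n p}) atTop (𝓝 0) := by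
  obtain ⟨κ, B, Δ, hκ, hB, hΔ, hmodel⟩ :=
    exists_eventually_segModel hs hs01 hμ hξ_lower hξ_upper
  set r := locRadius ξ with hr
  set a : ℕ → ℝ := fun n => r n * Real.log n ^ 2 with ha
  have hrt := tendsto_locRadius hξ_lower
  obtain ⟨hc3, hcL⟩ := tendsto_bandwidth_mul_log hc hcn
  -- The part of the error common to all times: the inaccuracy of the average over an estimated
  -- segment.
  set R : ℕ → ℝ := fun n => 2 * (4 * B * r n + a n * (√n + 2 * √(r n))) / (κ * n) with hR
  set A : ℝ := 2 * (4 * B + 3) / κ with hA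
  have hA0 : 0 < A := by positivity
  have hRle : ∀ᶠ n : ℕ in atTop, 0 ≤ R n ∧ R n ≤ A * (Real.log n ^ 4 / √n) ∧
      1 ≤ r n ∧ r n ≤ Real.log n ^ 4 ∧ 1 ≤ √(n : ℝ) := by
    filter_upwards [hrt.eventually_ge_atTop 1, tendsto_log_natCast.eventually_ge_atTop 1,
      eventually_ge_atTop 1] with n hr1 hL hn1
    have hn1' : (1 : ℝ) ≤ n := by exact_mod_cast hn1
    have hsq : 1 ≤ √(n : ℝ) := by rwa [Real.one_le_sqrt]
    have hsqn : √(n : ℝ) ^ 2 = n := Real.sq_sqrt (by linarith)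
    set L := Real.log n
    have hrL : r n ≤ L := min_le_right _ _
    have hrL4 : r n ≤ L ^ 4 := hrL.trans (le_self_pow₀ hL (by norm_num))
    have hsr : √(r n) ≤ L := by
      refine le_trans ?_ hrL
      rw [Real.sqrt_le_left (by linarith)]
      exact le_self_pow₀ hr1 two_ne_zero
    have haL : a n ≤ L ^ 3 := by
      calc a n = r n * L ^ 2 := rfl
        _ ≤ L * L ^ 2 := by gcongr
        _ = _ := by ring
    have ha0 : 0 ≤ a n := by positivity
    refine ⟨by positivity, ?_, hr1, hrL4, hsq⟩
    have hL34 : L ^ 3 ≤ L ^ 4 := pow_le_pow_right₀ hL (by norm_num)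
    have har : a n * (√n + 2 * √(r n)) ≤ L ^ 4 * √n + 2 * (L ^ 4 * √n) := by
      rw [mul_add]
      refine add_le_add (mul_le_mul_of_nonneg_right (haL.trans hL34) (by positivity)) ?_
      calc a n * (2 * √(r n)) ≤ L ^ 3 * (2 * L) := by gcongr
        _ = 2 * (L ^ 4 * 1) := by ring
        _ ≤ _ := by gcongr
    calc R n ≤ 2 * (4 * B * (L ^ 4 * √n) + (L ^ 4 * √n + 2 * (L ^ 4 * √n))) / (κ * n) := by
          simp only [hR]
          gcongr
          exact hrL4.trans (le_mul_of_one_le_right (by positivity) hsq)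
      _ = 2 * (4 * B + 3) * (L ^ 4 * √n) / (κ * √n ^ 2) := by rw [hsqn]; ring
      _ = A * (L ^ 4 / √n) := by
          rw [hA]
          field_simp
  refine ⟨fun n => meanErr (cpTime s n) m n (a n) (r n) κ B (c n), 1 + 4 * B, ?_, ?_, ?_⟩
  · have hlim := (tendsto_log_pow_div_rpow 4 (p := 1 / 2) (by norm_num)).const_mul A
    rw [mul_zero] at hlim
    filter_upwards [hRle, hlim.eventually (gt_mem_nhds one_pos)] with n hn hn1 p
    rw [← Real.sqrt_eq_rpow] at hn1
    change 0 ≤ R n + _ ∧ R n + _ ≤ _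
    split_ifs
    · constructor <;> linarith
    · constructor <;> linarith
  · have hlim := (hcL.const_mul (A + 4 * B * (m + 2) * 2)).add
      (hc3.const_mul (4 * B * (m + 2) * 2))
    rw [mul_zero, mul_zero, add_zero] at hlim
    refine squeeze_zero' ?_ ?_ hlim
    · filter_upwards [hRle] with n hn
      refine mul_nonneg (by positivity) (Finset.sum_nonneg fun p _ => ?_)
      change 0 ≤ R n + _
      split_ifs
      · linarith
      · linarith
    · filter_upwards [hRle, eventually_gt_atTop 0] with n hn hn0
      obtain ⟨hR0, hRA, hr1, hrL, hsq⟩ := hn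
      have hn0' : (0 : ℝ) < n := by exact_mod_cast hn0
      have hsqn : √(n : ℝ) ^ 2 = n := Real.sq_sqrt hn0'.le
      have hsn : √(n : ℝ) ≤ n := by
        conv_rhs => rw [← hsqn]
        exact le_self_pow₀ hsq two_ne_zero
      set D : ℝ := (c n : ℝ) + 1 with hD
      have hD1 : 1 ≤ D := by simp [hD]
      have hsum := sum_meanErr_le (cpTime s n) m n (a := a n) (r := r n) (κ := κ) (B := B)
        (c := c n) (by positivity) hB.le
      calc D / n * ∑ p ∈ Finset.Icc 1 n, meanErr (cpTime s n) m n (a n) (r n) κ B (c n) p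
          ≤ D / n * (n * R n + 4 * B * ((m + 2) * (2 * (r n + c n) + 1))) := by gcongr
        _ = D * R n + 4 * B * (m + 2) * (D * (2 * (r n + c n) + 1) / n) := by
            field_simp
        _ ≤ D * (A * (Real.log n ^ 4 / √n)) +
            4 * B * (m + 2) * (2 * (D * Real.log n ^ 4 / √n) + 2 * (D ^ 3 / n)) := by
            gcongr
            calc D * (2 * (r n + c n) + 1) / n ≤ D * (2 * r n + 2 * D) / n := by
                  refine div_le_div_of_nonneg_right (mul_le_mul_of_nonneg_left ?_ ?_) hn0'.le
                  · linarith
                  · linarith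
              _ = 2 * (D * r n / n) + 2 * (D ^ 2 / n) := by ring
              _ ≤ _ := by
                  gcongr
                  · norm_num
        _ = _ := by ring
  · have hη : 0 < κ ^ 2 * Δ / 64 := by positivity
    have ha3 : Tendsto (fun n : ℕ => Real.log n ^ 3 / a n ^ 2) atTop (𝓝 0) := by
      have hlim : Tendsto (fun n => (r n)⁻¹) atTop (𝓝 0) := tendsto_inv_atTop_zero.comp hrt
      refine squeeze_zero' ?_ ?_ hlim
      · filter_upwards [tendsto_log_natCast.eventually_ge_atTop 0] with n hn
        positivity
      · filter_upwards [tendsto_log_natCast.eventually_ge_atTop 1, hrt.eventually_ge_atTop 1]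
          with n hn hrn
        simp only [ha]
        rw [div_le_iff₀ (by positivity)]
        calc Real.log n ^ 3 ≤ Real.log n ^ 4 := pow_le_pow_right₀ hn (by norm_num)
          _ ≤ r n * Real.log n ^ 4 := le_mul_of_one_le_left (by positivity) hrn
          _ = _ := by
              field_simp
    have ha0 : ∀ᶠ n in atTop, 0 < a n := by
      filter_upwards [tendsto_log_natCast.eventually_ge_atTop 1, hrt.eventually_ge_atTop 1]
          with n hn hrn
      positivity
    have hlim := tendsto_measure_partial_sum h1 hJ2 hJ h3 h4 (m + 1)
      (hmodel.mono fun n hn => hn.1) hη ha3 ha0 hrt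
    refine tendsto_of_tendsto_of_tendsto_of_le_of_le' tendsto_const_nhds hlim
      (Eventually.of_forall fun _ => bot_le) ?_
    filter_upwards [hmodel] with n hn
    refine measure_mono fun ω hω => ?_
    by_contra hcon
    refine hω fun p hp q hq hpq => ?_
    simp only [Set.mem_ofPred_eq, not_exists, not_and, not_or, not_lt] at hcon
    rw [Finset.mem_Icc] at hp hq
    exact (hn.2 (fun j => ε n j ω) (fun k hk b hb1 hb2 => (hcon k hk b hb1 hb2).1)
      (fun k hk b hb1 hb2 => (hcon k hk b hb1 hb2).2)).norm_sub_segMean_le (hS n ω) hp.1 hp.2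
      hq.1 hq.2 (Nat.cast_nonneg _) hpq

end Stochastic

/-! ### The long run variance estimator -/

/-- The pairs of times with lag `l`. -/
abbrev lagPairs (n : ℕ) (l : ℤ) : Finset (ℕ × ℕ) :=
  (Finset.Icc 1 n ×ˢ Finset.Icc 1 n).filter fun p => (p.2 : ℤ) = (p.1 : ℤ) + l

/-- For a fixed lag the first index determines the pair. -/
lemma sum_lagPairs_fst_le (n : ℕ) (l : ℤ) (f : ℕ → ℝ≥0∞) :
    ∑ p ∈ lagPairs n l, f p.1 ≤ ∑ p ∈ Finset.Icc 1 n, f p := by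
  have hinj : Set.InjOn Prod.fst (lagPairs n l : Set (ℕ × ℕ)) := by
    rintro ⟨p, q⟩ hp ⟨p', q'⟩ hp' (rfl : p = p')
    simp only [Finset.coe_filter, Set.mem_ofPred_eq] at hp hp'
    simp only [Prod.mk.injEq, true_and]
    omega
  rw [← Finset.sum_image (f := f) hinj]
  refine Finset.sum_le_sum_of_subset fun p hp => ?_
  obtain ⟨q, hq, rfl⟩ := Finset.mem_image.1 hp
  exact (Finset.mem_product.1 (Finset.mem_filter.1 hq).1).1

/-- Interchanging the two indices maps lag l to lag -l, so by symmetry of `g` only the absolute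
value of the lag matters. -/
lemma sum_lagPairs_eq {M : Type*} [AddCommMonoid M] (n : ℕ) (l : ℤ) {g : ℕ → ℕ → M}
    (hg : ∀ p q, g p q = g q p) :
    ∑ p ∈ lagPairs n l, g p.1 p.2 =
      ∑ j ∈ Finset.range (n - l.natAbs), g (1 + j) (1 + j + l.natAbs) := by
  symm
  rcases le_total 0 l with hl | hl
  · refine Finset.sum_bij (fun j _ => (1 + j, 1 + j + l.natAbs)) (fun j hj => ?_)
      (fun i _ j _ hij => ?_) (fun p hp => ?_) (fun j _ => rfl)
    · simp only [Finset.mem_range, lagPairs, Finset.mem_filter, Finset.mem_product,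
        Finset.mem_Icc] at hj ⊢
      omega
    · simp only [Prod.mk.injEq] at hij
      omega
    · obtain ⟨p, q⟩ := p
      simp only [lagPairs, Finset.mem_filter, Finset.mem_product, Finset.mem_Icc] at hp
      refine ⟨p - 1, ?_, ?_⟩
      · rw [Finset.mem_range]; omega
      · rw [Prod.mk.injEq]; omega
  · refine Finset.sum_bij (fun j _ => (1 + j + l.natAbs, 1 + j)) (fun j hj => ?_)
      (fun i _ j _ hij => ?_) (fun p hp => ?_) (fun j _ => hg _ _)
    · simp only [Finset.mem_range, lagPairs, Finset.mem_filter, Finset.mem_product,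
        Finset.mem_Icc] at hj ⊢
      omega
    · simp only [Prod.mk.injEq] at hij
      omega
    · obtain ⟨p, q⟩ := p
      simp only [lagPairs, Finset.mem_filter, Finset.mem_product, Finset.mem_Icc] at hp
      refine ⟨q - 1, ?_, ?_⟩
      · rw [Finset.mem_range]; omega
      · rw [Prod.mk.injEq]; omega

section Expansion

variable {x e : ℕ → Curve} {n : ℕ} {S : Finset ℕ} {c : ℕ} {K : ℝ → ℝ} {w : ℕ → ℝ} {W B : ℝ}

/-- The estimator that uses the unobservable errors. -/
def errorEstimator (K : ℝ → ℝ) (c : ℕ) (e : ℕ → Curve) (n : ℕ) : Curve :=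
  ∑ l ∈ Finset.Icc (-(c : ℤ)) (c : ℤ),
    K ((l : ℝ) / (c : ℝ)) • ((n : ℝ)⁻¹ • ∑ p ∈ lagPairs n l, e p.1 * e p.2)

/-- The mean of the estimator that uses the errors. -/
def biasedVariance (K : ℝ → ℝ) (c : ℕ) (Γ : ℕ → Curve) (n : ℕ) : Curve :=
  ∑ l ∈ Finset.Icc (-(c : ℤ)) (c : ℤ),
    (K ((l : ℝ) / (c : ℝ)) * ((n : ℝ)⁻¹ * (n - l.natAbs : ℕ))) • Γ l.natAbs

/-- With d, d' the deviations of the segment mean from the true means at p and q, the difference is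
e_p d' + d e_q + d d'. The quadratic term is made linear in the weight by the uniform bound W, so
only the sum of the weights has to be small. -/
lemma enorm_mul_sub_mul_le {p q : ℕ} (hw0 : 0 ≤ w p) (hwW : w p ≤ W)
    (h1 : ‖x p - e p - segMean x n S p‖ ≤ w p) (h2 : ‖x q - e q - segMean x n S p‖ ≤ w p) :
    ‖(x p - segMean x n S p) * (x q - segMean x n S p) - e p * e q‖ₑ ≤
      ENNReal.ofReal (w p) * (‖e p‖ₑ + ‖e q‖ₑ + ENNReal.ofReal W) := by
  rw [← ofReal_norm, ← ofReal_norm, ← ofReal_norm, ← ENNReal.ofReal_add (norm_nonneg _)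
    (norm_nonneg _), ← ENNReal.ofReal_add (by positivity) (hw0.trans hwW),
    ← ENNReal.ofReal_mul hw0]
  refine ENNReal.ofReal_le_ofReal ?_
  set d := x p - e p - segMean x n S p
  set d' := x q - e q - segMean x n S p
  have hd : (x p - segMean x n S p) * (x q - segMean x n S p) - e p * e q =
      e p * d' + d * e q + d * d' := by
    simp only [d, d']; ring
  rw [hd]
  have a1 : ‖e p * d'‖ ≤ ‖e p‖ * w p := (norm_mul_le _ _).trans (by gcongr)
  have a2 : ‖d * e q‖ ≤ w p * ‖e q‖ := (norm_mul_le _ _).trans (by gcongr)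
  have a3 : ‖d * d'‖ ≤ w p * W :=
    (norm_mul_le _ _).trans (mul_le_mul h1 (h2.trans hwW) (norm_nonneg _) hw0)
  have := norm_add₃_le (a := e p * d') (b := d * e q) (c := d * d')
  linarith

lemma enorm_smul_smul_le {k : ℝ} (hk : |k| ≤ B) (n : ℕ) (f : Curve) :
    ‖k • ((n : ℝ)⁻¹ • f)‖ₑ ≤ ENNReal.ofReal (B / n) * ‖f‖ₑ := by
  rw [← ofReal_norm, ← ofReal_norm, ← ENNReal.ofReal_mul (div_nonneg ((abs_nonneg k).trans hk)
    (Nat.cast_nonneg n))]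
  refine ENNReal.ofReal_le_ofReal ?_
  rw [norm_smul, norm_smul, Real.norm_eq_abs, norm_inv, Real.norm_natCast, div_eq_mul_inv, mul_assoc]
  gcongr

/-- The difference between the estimator and its version for the errors. -/
lemma enorm_lrvEstimator_sub_le (hK : ∀ x, |K x| ≤ B) (hw : ∀ p, 0 ≤ w p ∧ w p ≤ W)
    (h : ∀ p ∈ Finset.Icc 1 n, ∀ q ∈ Finset.Icc 1 n, |(q : ℝ) - p| ≤ c →
      ‖x q - e q - segMean x n S p‖ ≤ w p) :
    ‖lrvEstimator K c x n S - errorEstimator K c e n‖ₑ ≤ ENNReal.ofReal (B / n) *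
      ∑ l ∈ Finset.Icc (-(c : ℤ)) (c : ℤ), ∑ p ∈ lagPairs n l,
        ENNReal.ofReal (w p.1) * (‖e p.1‖ₑ + ‖e p.2‖ₑ + ENNReal.ofReal W) := by
  rw [lrvEstimator, errorEstimator, ← Finset.sum_sub_distrib, Finset.mul_sum]
  refine (enorm_sum_curve_le _ _).trans (Finset.sum_le_sum fun l hl => ?_)
  rw [lagEstimator, ← smul_sub, ← smul_sub, ← Finset.sum_sub_distrib]
  refine (enorm_smul_smul_le (hK _) n _).trans ?_
  gcongr
  refine (enorm_sum_curve_le _ _).trans (Finset.sum_le_sum fun p hp => ?_)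
  rw [Finset.mem_filter, Finset.mem_product] at hp
  refine enorm_mul_sub_mul_le (hw _).1 (hw _).2 (h _ hp.1.1 _ hp.1.1 (by simp))
    (h _ hp.1.1 _ hp.1.2 ?_)
  have e1 : ((p.2 : ℤ) : ℝ) = ((p.1 : ℤ) : ℝ) + l := by exact_mod_cast hp.2
  simp only [Int.cast_natCast] at e1
  rw [e1, add_sub_cancel_left]
  rw [Finset.mem_Icc, ← abs_le] at hl
  exact_mod_cast hl

/-- The difference between the estimator for the errors and its mean. -/
lemma enorm_errorEstimator_sub_le (hK : ∀ x, |K x| ≤ B) (Γ : ℕ → Curve) :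
    ‖errorEstimator K c e n - biasedVariance K c Γ n‖ₑ ≤ ENNReal.ofReal (B / n) *
      ∑ l ∈ Finset.Icc (-(c : ℤ)) (c : ℤ), ‖∑ j ∈ Finset.range (n - l.natAbs),
        (e (1 + j) * e (1 + j + l.natAbs) - Γ l.natAbs)‖ₑ := by
  rw [biasedVariance, errorEstimator, ← Finset.sum_sub_distrib, Finset.mul_sum]
  refine (enorm_sum_curve_le _ _).trans (Finset.sum_le_sum fun l _ => ?_)
  rw [sum_lagPairs_eq n l (g := fun p q => e p * e q) fun p q => mul_comm _ _, mul_smul, mul_smul,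
    Nat.cast_smul_eq_nsmul, ← smul_sub, ← smul_sub, Finset.sum_sub_distrib, Finset.sum_const,
    Finset.card_range]
  exact enorm_smul_smul_le (hK _) n _

end Expansion

/-! ### Bias -/

section Bias

/-- The bias of the estimator for the errors tends to zero. -/
lemma tendsto_biasedVariance {K : ℝ → ℝ} (hK : IsKernel K) {c : ℕ → ℕ} (hc : Tendsto c atTop atTop)
    {Γ : ℕ → Curve} (hΓ : Summable fun l => ‖Γ l‖) :
    Tendsto (fun n => biasedVariance K (c n) Γ n) atTop (𝓝 (∑' l : ℤ, Γ l.natAbs)) := by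
  obtain ⟨B, hB⟩ := hK.bounded
  have hB0 : 0 ≤ B := (abs_nonneg _).trans (hB 0)
  -- Extension by zero to all lags makes dominated convergence for series applicable, with
  -- dominating terms B ‖Γ l‖.
  set f : ℕ → ℤ → Curve := fun n l => if l ∈ Finset.Icc (-(c n : ℤ)) (c n : ℤ) then
    (K ((l : ℝ) / (c n : ℝ)) * ((n : ℝ)⁻¹ * (n - l.natAbs : ℕ))) • Γ l.natAbs else 0 with hf
  have e : ∀ n, biasedVariance K (c n) Γ n = ∑' l, f n l := fun n => by
    rw [tsum_eq_sum (s := Finset.Icc (-(c n : ℤ)) (c n : ℤ)) fun l hl => if_neg hl]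
    exact Finset.sum_congr rfl fun l hl => (if_pos hl).symm
  simp_rw [e]
  refine tendsto_tsum_of_dominated_convergence
    ((summable_norm_natAbs hΓ).mul_left B) (fun l => ?_) (Eventually.of_forall fun n l => ?_)
  · have hcR : Tendsto (fun n => (c n : ℝ)) atTop atTop := tendsto_natCast_atTop_atTop.comp hc
    have l1 : Tendsto (fun n => K ((l : ℝ) / (c n : ℝ))) atTop (𝓝 1) := by
      have := hK.continuousAt.tendsto.comp (tendsto_const_nhds.div_atTop hcR (a := (l : ℝ)))
      rwa [hK.zero] at this
    have l2 : Tendsto (fun n : ℕ => (n : ℝ)⁻¹ * (n - l.natAbs : ℕ)) atTop (𝓝 1) := by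
      have h0 : Tendsto (fun n : ℕ => 1 - (l.natAbs : ℝ) / n) atTop (𝓝 (1 - 0)) :=
        tendsto_const_nhds.sub (tendsto_const_nhds.div_atTop tendsto_natCast_atTop_atTop)
      rw [sub_zero] at h0
      refine h0.congr' ?_
      filter_upwards [eventually_ge_atTop l.natAbs, eventually_gt_atTop 0] with n hn hn0
      have : (n : ℝ) ≠ 0 := by positivity
      rw [Nat.cast_sub hn]
      field_simp
    have l3 := (l1.mul l2).smul_const (Γ l.natAbs)
    rw [one_mul, one_smul] at l3
    refine l3.congr' ?_
    filter_upwards [hc.eventually_ge_atTop l.natAbs] with n hn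
    simp only [hf]
    rw [if_pos (by rw [Finset.mem_Icc]; omega)]
  · simp only [hf]
    split_ifs
    · rw [norm_smul, norm_mul, Real.norm_eq_abs]
      gcongr
      rw [← mul_one B]
      refine mul_le_mul (hB _) ?_ (norm_nonneg _) hB0
      rw [Real.norm_of_nonneg (by positivity), inv_mul_eq_div]
      refine div_le_one_of_le₀ ?_ (Nat.cast_nonneg n)
      exact_mod_cast Nat.sub_le n _
    · rw [norm_zero]
      positivity

end Bias

/-! ### A criterion for convergence in probability -/

section Convergence

variable {Ω : Type*} {mΩ : MeasurableSpace Ω} {P : Measure Ω}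

/-- Convergence in measure from a bound that holds with probability tending to one. -/
lemma tendstoInMeasure_of_enorm_sub_le {f : ℕ → Ω → Curve} {g : Curve} {A : ℕ → Set Ω}
    {V : ℕ → Ω → ℝ≥0∞} {β : ℕ → ℝ≥0∞} (hV : ∀ n, Measurable (V n))
    (h : ∀ᶠ n in atTop, ∀ ω ∉ A n, ‖f n ω - g‖ₑ ≤ V n ω + β n)
    (hA : Tendsto (fun n => P (A n)) atTop (𝓝 0)) (hβ : Tendsto β atTop (𝓝 0))
    (hVint : Tendsto (fun n => ∫⁻ ω, V n ω ∂P) atTop (𝓝 0)) :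
    TendstoInMeasure P f atTop fun _ => g := by
  intro δ' hδ'
  -- The tolerance may be infinite, in which case Markov's inequality could not be applied to it
  -- directly.
  set δ := min δ' 1 with hδdef
  have hδ : 0 < δ := lt_min hδ' one_pos
  have hδ2 : 0 < δ / 2 := ENNReal.half_pos hδ.ne'
  have hδ2' : δ / 2 ≠ ∞ := (ENNReal.div_lt_top (ne_top_of_le_ne_top ENNReal.one_ne_top
    (min_le_right _ _)) two_ne_zero).ne
  have hlim : Tendsto (fun n => P (A n) + (∫⁻ ω, V n ω ∂P) / (δ / 2)) atTop (𝓝 0) := by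
    have := hA.add (ENNReal.Tendsto.div_const hVint (Or.inr hδ2.ne'))
    simpa using this
  refine tendsto_of_tendsto_of_tendsto_of_le_of_le' tendsto_const_nhds hlim
    (Eventually.of_forall fun _ => bot_le) ?_
  filter_upwards [h, hβ.eventually (gt_mem_nhds hδ2)] with n hn hβn
  have hsub : {ω | δ' ≤ edist (f n ω) g} ⊆ A n ∪ {ω | δ / 2 ≤ V n ω} := by
    intro ω hω
    by_cases hωA : ω ∈ A n
    · exact Or.inl hωA
    refine Or.inr ?_
    by_contra hcon
    rw [Set.mem_ofPred_eq, not_le] at hcon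
    have h1 := (hn ω hωA).trans_lt (ENNReal.add_lt_add hcon hβn)
    rw [ENNReal.add_halves, ← edist_eq_enorm_sub] at h1
    exact absurd (h1.trans_le (min_le_left _ _)) (not_lt.2 hω)
  exact (measure_mono hsub).trans ((measure_union_le _ _).trans (add_le_add le_rfl
    (meas_ge_le_lintegral_div (hV n).aemeasurable hδ2.ne' hδ2')))

end Convergence

/-! ### Consistency -/

section Consistency

variable {Ω : Type*} {mΩ : MeasurableSpace Ω} {P : Measure Ω} [IsProbabilityMeasure P]
  {ε : ℕ → ℕ → Ω → Curve} {γ : ℤ → I → I → ℝ}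

lemma mem_of_mem_lagPairs {n : ℕ} {l : ℤ} {p : ℕ × ℕ} (hp : p ∈ lagPairs n l) :
    p.1 ∈ Finset.Icc 1 n ∧ p.2 ∈ Finset.Icc 1 n :=
  Finset.mem_product.1 (Finset.mem_filter.1 hp).1

lemma CondA1.exists_lintegral_enorm_le (h1 : CondA1 P ε) : ∃ K : ℝ≥0, ∀ n, ∀ j ∈ Finset.Icc 1 n,
    ∫⁻ ω, ‖ε n j ω‖ₑ ∂P ≤ K := by
  obtain ⟨K, hK⟩ := h1.exists_eLpNorm_two_le
  refine ⟨K, fun n j hj => ?_⟩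
  have h := (eLpNorm_le_eLpNorm_of_exponent_le (p := 1) (q := 2) (by norm_num)
    (h1.measurable_enorm hj).aestronglyMeasurable).trans (hK n j hj)
  rw [eLpNorm_one_eq_lintegral_enorm] at h
  simpa only [enorm_eq_self] using h

lemma card_lags_le (c : ℕ) : ((Finset.Icc (-(c : ℤ)) (c : ℤ)).card : ℝ≥0∞) ≤
    ENNReal.ofReal (2 * ((c : ℝ) + 1)) := by
  rw [Int.card_Icc, show ((c : ℤ) + 1 - -(c : ℤ)).toNat = 2 * c + 1 by omega,
    ← ENNReal.ofReal_natCast]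
  refine ENNReal.ofReal_le_ofReal ?_
  push_cast
  linarith

omit [IsProbabilityMeasure P] in
lemma measurable_mean_error (h1 : CondA1 P ε) (n c : ℕ) (w : ℕ → ℝ) (W b : ℝ) :
    Measurable fun ω => ENNReal.ofReal b * ∑ l ∈ Finset.Icc (-(c : ℤ)) (c : ℤ),
      ∑ p ∈ lagPairs n l,
        ENNReal.ofReal (w p.1) * (‖ε n p.1 ω‖ₑ + ‖ε n p.2 ω‖ₑ + ENNReal.ofReal W) :=
  (Finset.measurable_fun_sum _ fun _ _ => Finset.measurable_fun_sum _ fun _ hp =>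
    (((h1.measurable_enorm (mem_of_mem_lagPairs hp).1).add
      (h1.measurable_enorm (mem_of_mem_lagPairs hp).2)).add_const _).const_mul _).const_mul _

/-- There are at most 2(c + 1) lags. For each, the expected norms of the errors are bounded and the
sum over pairs reduces to the sum of the weights over first indices. -/
lemma exists_lintegral_mean_error_le (h1 : CondA1 P ε) (B W : ℝ) :
    ∃ C : ℝ≥0, ∀ (n c : ℕ) (w : ℕ → ℝ), (∀ p, 0 ≤ w p) →
      ∫⁻ ω, ENNReal.ofReal (B / n) * ∑ l ∈ Finset.Icc (-(c : ℤ)) (c : ℤ), ∑ p ∈ lagPairs n l,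
        ENNReal.ofReal (w p.1) * (‖ε n p.1 ω‖ₑ + ‖ε n p.2 ω‖ₑ + ENNReal.ofReal W) ∂P ≤
      C * ENNReal.ofReal (((c : ℝ) + 1) / n * ∑ p ∈ Finset.Icc 1 n, w p) := by
  obtain ⟨K, hK⟩ := h1.exists_lintegral_enorm_le
  refine ⟨B.toNNReal * 2 * (K + K + W.toNNReal), fun n c w hw => ?_⟩
  have hm : ∀ {l : ℤ} {p : ℕ × ℕ}, p ∈ lagPairs n l → Measurable fun ω =>
      ENNReal.ofReal (w p.1) * (‖ε n p.1 ω‖ₑ + ‖ε n p.2 ω‖ₑ + ENNReal.ofReal W) := fun hp =>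
    (((h1.measurable_enorm (mem_of_mem_lagPairs hp).1).add
      (h1.measurable_enorm (mem_of_mem_lagPairs hp).2)).add_const _).const_mul _
  rw [lintegral_const_mul _ (Finset.measurable_fun_sum _ fun l _ =>
    Finset.measurable_fun_sum _ fun p hp => hm hp),
    lintegral_finsetSum _ fun l _ => Finset.measurable_fun_sum _ fun p hp => hm hp]
  have hterm : ∀ l ∈ Finset.Icc (-(c : ℤ)) (c : ℤ), ∫⁻ ω, ∑ p ∈ lagPairs n l,
      ENNReal.ofReal (w p.1) * (‖ε n p.1 ω‖ₑ + ‖ε n p.2 ω‖ₑ + ENNReal.ofReal W) ∂P ≤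
      ENNReal.ofReal (∑ p ∈ Finset.Icc 1 n, w p) * (K + K + ENNReal.ofReal W) := by
    intro l _
    rw [lintegral_finsetSum _ fun p hp => hm hp, ENNReal.ofReal_sum_of_nonneg fun p _ => hw p,
      Finset.sum_mul]
    refine le_trans (Finset.sum_le_sum fun p hp => ?_) (sum_lagPairs_fst_le n l
      fun p => ENNReal.ofReal (w p) * (K + K + ENNReal.ofReal W))
    obtain ⟨hp1, hp2⟩ := mem_of_mem_lagPairs hp
    rw [lintegral_const_mul' _ _ ENNReal.ofReal_ne_top, lintegral_add_right _ measurable_const, lintegral_add_left (h1.measurable_enorm hp1),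
      lintegral_const, measure_univ, mul_one]
    gcongr
    · exact hK n _ hp1
    · exact hK n _ hp2
  refine (mul_le_mul_right ((Finset.sum_le_sum hterm).trans (le_of_eq
    (Finset.sum_const _))) _).trans ?_
  rw [nsmul_eq_mul]
  refine (mul_le_mul_right (mul_le_mul_left (card_lags_le c) _) _).trans (le_of_eq ?_)
  have hs : 0 ≤ ∑ p ∈ Finset.Icc 1 n, w p := Finset.sum_nonneg fun p _ => hw p
  rw [div_eq_mul_inv, ENNReal.ofReal_mul' (by positivity), ENNReal.ofReal_mul (by norm_num),
    div_eq_mul_inv, ENNReal.ofReal_mul (by positivity), ENNReal.ofReal_mul (by positivity),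
    ENNReal.ofReal_ofNat]
  push_cast
  simp only [ENNReal.ofReal]
  ring

omit [IsProbabilityMeasure P] in
lemma measurable_enorm_sum_mul_sub (h1 : CondA1 P ε) (n l : ℕ) (Γ : ℕ → Curve) :
    Measurable fun ω => ‖∑ j ∈ Finset.range (n - l),
      (ε n (1 + j) ω * ε n (1 + j + l) ω - Γ l)‖ₑ := by
  refine measurable_enorm_curve fun t => ?_
  simp only [ContinuousMap.coe_sum, Finset.sum_apply]
  refine Finset.measurable_fun_sum _ fun j hj => ?_
  rw [Finset.mem_range] at hj
  exact (measurable_mul_apply h1 (Finset.mem_Icc.2 ⟨by omega, by omega⟩)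
    (Finset.mem_Icc.2 ⟨by omega, by omega⟩) t).sub_const _

/-- Each of the at most 2(c + 1) lags contributes O(√(n(c+1))), and lags of size n or more
contribute an empty sum. Division by n turns the total into √((c+1)³/n). -/
lemma exists_lintegral_autocov_error_le (h1 : CondA1 P ε) (h2 : CondA2 P ε γ) {J : ℕ}
    (hJ2 : Even J) (hJ : 2 ≤ J) (h3 : CondA3 P ε J) (h4 : CondA4 P ε J) {Γ : ℕ → Curve}
    (hΓ : ∀ l t, Γ l t = γ l t t) (B : ℝ) : ∃ C : ℝ≥0, ∀ n c : ℕ, 0 < n →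
      ∫⁻ ω, ENNReal.ofReal (B / n) * ∑ l ∈ Finset.Icc (-(c : ℤ)) (c : ℤ),
        ‖∑ j ∈ Finset.range (n - l.natAbs),
          (ε n (1 + j) ω * ε n (1 + j + l.natAbs) ω - Γ l.natAbs)‖ₑ ∂P ≤
      C * ENNReal.ofReal √(((c : ℝ) + 1) ^ 3 / n) := by
  obtain ⟨D, hD⟩ := exists_lintegral_sum_mul_le h1 h2 hJ2 hJ h3 h4 hΓ
  refine ⟨B.toNNReal * 2 * D, fun n c hn => ?_⟩
  rw [lintegral_const_mul _ (Finset.measurable_fun_sum _ fun l _ =>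
    measurable_enorm_sum_mul_sub h1 n _ Γ),
    lintegral_finsetSum _ fun l _ => measurable_enorm_sum_mul_sub h1 n _ Γ]
  have hterm : ∀ l ∈ Finset.Icc (-(c : ℤ)) (c : ℤ), ∫⁻ ω, ‖∑ j ∈ Finset.range (n - l.natAbs),
      (ε n (1 + j) ω * ε n (1 + j + l.natAbs) ω - Γ l.natAbs)‖ₑ ∂P ≤
      D * ENNReal.ofReal √(n * (c + 1)) := by
    intro l hl
    rw [Finset.mem_Icc] at hl
    have hlc : (l.natAbs : ℝ) ≤ c := by exact_mod_cast (by omega : l.natAbs ≤ c)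
    rcases lt_or_ge l.natAbs n with h | h
    · refine (hD n l.natAbs h).trans ?_
      gcongr
    · rw [Nat.sub_eq_zero_of_le h]
      simp [enorm_eq_nnnorm]
  refine (mul_le_mul_right ((Finset.sum_le_sum hterm).trans (le_of_eq
    (Finset.sum_const _))) _).trans ?_
  rw [nsmul_eq_mul]
  refine (mul_le_mul_right (mul_le_mul_left (card_lags_le c) _) _).trans (le_of_eq ?_)
  have hn0 : (0 : ℝ) < n := by exact_mod_cast hn
  have hs : √(((c : ℝ) + 1) ^ 3 / n) = (n : ℝ)⁻¹ * (((c : ℝ) + 1) * √(n * (c + 1))) := by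
    rw [Real.sqrt_eq_iff_mul_self_eq (by positivity) (by positivity)]
    have : √((n : ℝ) * (c + 1)) * √((n : ℝ) * (c + 1)) = n * (c + 1) :=
      Real.mul_self_sqrt (by positivity)
    calc ((c : ℝ) + 1) ^ 3 / n = ((n : ℝ)⁻¹) ^ 2 * ((c : ℝ) + 1) ^ 2 * (n * (c + 1)) := by
          field_simp
      _ = ((n : ℝ)⁻¹) ^ 2 * ((c : ℝ) + 1) ^ 2 *
          (√((n : ℝ) * (c + 1)) * √((n : ℝ) * (c + 1))) := by rw [this]
      _ = _ := by ring
  rw [hs, div_eq_mul_inv, ENNReal.ofReal_mul' (by positivity), ENNReal.ofReal_mul (by norm_num),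
    ENNReal.ofReal_mul (p := (n : ℝ)⁻¹) (by positivity), ENNReal.ofReal_mul (by positivity),
    ENNReal.ofReal_ofNat]
  push_cast
  simp only [ENNReal.ofReal]
  ring

end Consistency

end FunctionalTS

end

theorem lemma1 {Ω : Type*} [MeasurableSpace Ω] (P : Measure Ω) [IsProbabilityMeasure P]
    -- the mean: `m ≥ 0` changes at `0 < s_1 < ⋯ < s_m < 1`, segment means `μ_0, …, μ_m`
    (m : ℕ) (s : Fin m → ℝ) (hs : StrictMono s) (hs01 : ∀ i, s i ∈ Set.Ioo (0 : ℝ) 1)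
    (μ : Fin (m + 1) → FunctionalTS.Curve) (hμ : ∀ i : Fin m, μ i.castSucc ≠ μ i.succ)
    -- the errors
    (ε : ℕ → ℕ → Ω → FunctionalTS.Curve) (γ : ℤ → I → I → ℝ)
    (J : ℕ) (hJ : 0 < J) (hJ2 : Even J)
    (h1 : FunctionalTS.CondA1 P ε) (h2 : FunctionalTS.CondA2 P ε γ)
    (h3 : FunctionalTS.CondA3 P ε J) (h4 : FunctionalTS.CondA4 P ε J)
    -- the change points estimated by binary segmentation
    (ξ : ℕ → ℝ)
    (hξ_lower : Tendsto (fun n : ℕ => ξ n / Real.log n ^ 2) atTop atTop)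
    (hξ_upper : Tendsto (fun n : ℕ => ξ n / √(n : ℝ)) atTop (𝓝 0))
    (S : ℕ → Ω → Finset ℕ)
    (hS : ∀ n ω, FunctionalTS.BinSeg (fun j => FunctionalTS.obs s μ ε n j ω) (ξ n) 1 n (S n ω))
    -- kernel and bandwidth
    (K : ℝ → ℝ) (hK : FunctionalTS.IsKernel K)
    (c : ℕ → ℕ) (hc : Tendsto c atTop atTop)
    (hcn : Tendsto (fun n : ℕ => (c n : ℝ) ^ 3 / (n : ℝ)) atTop (𝓝 0)) :
    ∃ σ2 : FunctionalTS.Curve,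
      (∀ t, HasSum (fun h : ℤ => γ h t t) (σ2 t)) ∧
      TendstoInMeasure P
        (fun n ω => FunctionalTS.lrvEstimator K (c n)
          (fun j => FunctionalTS.obs s μ ε n j ω) n (S n ω))
        atTop (fun _ => σ2) := by
  open FunctionalTS in
  have hJ' : 2 ≤ J := by
    obtain ⟨k, rfl⟩ := hJ2
    omega
  obtain ⟨Γ, hΓ⟩ := exists_autocov_curve h1 h2
  have hsum := summable_norm_autocov h1 h2 hJ' h4 hΓ
  refine ⟨∑' l : ℤ, Γ l.natAbs, fun t => ?_, ?_⟩
  -- The series converges absolutely in the supremum norm, so its sum is a continuous curve, and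
  -- evaluation at t commutes with it.
  · have h := (summable_norm_natAbs hsum).of_norm.hasSum.mapL
      (ContinuousMap.evalCLM ℝ t)
    have e : (fun h : ℤ => γ h t t) = fun l => ContinuousMap.evalCLM ℝ t (Γ l.natAbs) := by
      funext l
      change γ l t t = Γ l.natAbs t
      rw [hΓ, h2.apply_natAbs]
    rw [e]
    exact h
  obtain ⟨B, hB⟩ := hK.bounded
  obtain ⟨w, W, hw, hwsum, hgood⟩ :=
    exists_weights h1 hJ2 hJ' h3 h4 hs hs01 hμ hξ_lower hξ_upper hS hc hcn
  obtain ⟨C₁, hC₁⟩ := exists_lintegral_mean_error_le h1 B W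
  obtain ⟨C₂, hC₂⟩ := exists_lintegral_autocov_error_le h1 h2 hJ2 hJ' h3 h4 hΓ B
  have hbias := tendsto_biasedVariance hK hc hsum
  obtain ⟨hc3, -⟩ := tendsto_bandwidth_mul_log hc hcn
  -- `V` collects the two random bounds, which depend on the errors alone and are measurable. The
  -- estimated change points are an arbitrary selection, so neither the estimator nor the
  -- exceptional set of `hgood` has to be measurable.
  refine tendstoInMeasure_of_enorm_sub_le
    (V := fun n ω => ENNReal.ofReal (B / n) * ∑ l ∈ Finset.Icc (-(c n : ℤ)) (c n : ℤ),
        ∑ p ∈ lagPairs n l, ENNReal.ofReal (w n p.1) *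
          (‖ε n p.1 ω‖ₑ + ‖ε n p.2 ω‖ₑ + ENNReal.ofReal W) +
      ENNReal.ofReal (B / n) * ∑ l ∈ Finset.Icc (-(c n : ℤ)) (c n : ℤ),
        ‖∑ j ∈ Finset.range (n - l.natAbs),
          (ε n (1 + j) ω * ε n (1 + j + l.natAbs) ω - Γ l.natAbs)‖ₑ)
    (β := fun n => edist (biasedVariance K (c n) Γ n) (∑' l : ℤ, Γ l.natAbs))
    (fun n => ?_) ?_ hgood (tendsto_iff_edist_tendsto_0.1 hbias) ?_
  · exact (measurable_mean_error h1 n (c n) (w n) W _).add ((Finset.measurable_fun_sum _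
      fun l _ => measurable_enorm_sum_mul_sub h1 n _ Γ).const_mul _)
  · filter_upwards [hw] with n hwn ω hω
    replace hω := not_not.1 hω
    have e1 := enorm_lrvEstimator_sub_le (c := c n) (S := S n ω) (K := K)
      (x := fun j => obs s μ ε n j ω) (e := fun j => ε n j ω) hB hwn hω
    have e2 := enorm_errorEstimator_sub_le (c := c n) (n := n) (e := fun j => ε n j ω) hB Γ
    rw [edist_eq_enorm_sub, ← sub_add_sub_cancel _ (errorEstimator K (c n) (fun j => ε n j ω) n),
      ← sub_add_sub_cancel (errorEstimator K (c n) (fun j => ε n j ω) n)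
        (biasedVariance K (c n) Γ n)]
    refine (enorm_curve_add_le _ _).trans ?_
    rw [add_assoc]
    refine add_le_add e1 ((enorm_curve_add_le _ _).trans (add_le_add e2 le_rfl))
  · have l1 := ENNReal.Tendsto.const_mul (a := (C₁ : ℝ≥0∞)) (ENNReal.tendsto_ofReal hwsum)
      (Or.inr ENNReal.coe_ne_top)
    have l2 := ENNReal.Tendsto.const_mul (a := (C₂ : ℝ≥0∞))
      (ENNReal.tendsto_ofReal ((Real.continuous_sqrt.tendsto 0).comp hc3))
      (Or.inr ENNReal.coe_ne_top)
    have hlim := l1.add l2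
    simp only [Real.sqrt_zero, ENNReal.ofReal_zero, mul_zero, add_zero] at hlim
    refine tendsto_of_tendsto_of_tendsto_of_le_of_le' tendsto_const_nhds hlim
      (Eventually.of_forall fun _ => bot_le) ?_
    filter_upwards [hw, eventually_gt_atTop 0] with n hwn hn
    rw [lintegral_add_left (measurable_mean_error h1 n (c n) (w n) W _)]
    exact add_le_add (hC₁ n (c n) (w n) fun p => (hwn p).1) (hC₂ n (c n) hn)
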